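/- **Theorem.** For two curves (finite sequences of points) $P=(p_1,\dots,p_{m_1})$ and $Q=(q_1,\dots,q_{m_2})$ in $\mathbb{R}^d$, an *alignment* is a sequence of index pairs from $(1,1)$ to $(m_1,m_2)$ in which every step increases the first index, the second index, or both by one; the *discrete Fréchet distance* $d_{dF}(P,Q)$ is the minimum over all alignments $\tau$ of $\max_{(i,j)\in\tau}\|p_i-q_j\|_2$. There are a deterministic data structure, i.e. a preprocessing program and a query program for a real random access machine (unit-cost exact arithmetic and comparisons of reals; addition, truncated subtraction, halving and comparison of natural numbers, which are used as addresses; no randomness and no rounding operation), and an absolute constant $c>0$ such that the following holds for all integers $n,d\ge 1$ and $m\ge k\ge 1$, all $\varepsilon\in(0,1]$ and $r>0$, and every family $C_1,\dots,C_n$ of curves of $m$ points in $\mathbb{R}^d$. 1. Given $C_1,\dots,C_n$, $k$, $\varepsilon$ and $r$, the preprocessing halts after at most $$nm\left(1+\log\frac n\varepsilon\right)\left(c\,d\log m+\left(\frac c\varepsilon\right)^{kd}\right)$$ steps and leaves a data structure of at most $n\left(\frac c\varepsilon\right)^{dk}$ memory cells. 2. Given the data structure (but not the input curves) and any query curve $Q$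 of $k$ points in $\mathbb{R}^d$, the query program halts after at most $$c\,kd\left(1+\log\frac{nkd}\varepsilon\right)$$ steps, and if $d_{dF}(Q,C_i)\le r$ for some $i$, then it returns an index $j$ with $d_{dF}(Q,C_j)\le(1+\varepsilon)r$. That is, the asymmetric $(1+\varepsilon,r)$-approximate near-neighbor problem for curves under the discrete Fréchet distance has a deterministic data structure with $n\cdot O(\frac1\varepsilon)^{dk}$ space, $nm\log(\frac n\varepsilon)\cdot(O(d\log m)+O(\frac1\varepsilon)^{kd})$ preprocessing time and $O(kd\log(\frac{nkd}\varepsilon))$ query time. -/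

import Mathlib

noncomputable section

namespace CurveANN

/-! ### Curves and the discrete Fréchet distance -/

/-- A curve consisting of `m` points in `d`-dimensional Euclidean space. -/
abbrev Curve (m d : ℕ) : Type := Fin m → EuclideanSpace ℝ (Fin d)

/-- One hop of an alignment: the first index, the second index, or both advance by one. -/
def Hop {m₁ m₂ : ℕ} (p q : Fin m₁ × Fin m₂) : Prop :=
  (q.1.val = p.1.val + 1 ∧ q.2.val = p.2.val) ∨
  (q.1.val = p.1.val ∧ q.2.val = p.2.val + 1) ∨
  (q.1.val = p.1.val + 1 ∧ q.2.val = p.2.val + 1)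

/-- An alignment of two curves with `m₁` and `m₂` points: a nonempty sequence of index pairs that
starts at the pair of first indices, ends at the pair of last indices, and proceeds by hops.
(Indices start at `0`.) -/
structure IsAlignment {m₁ m₂ : ℕ} (τ : List (Fin m₁ × Fin m₂)) : Prop where
  ne_nil : τ ≠ []
  first : ∀ p ∈ τ.head?, p.1.val = 0 ∧ p.2.val = 0
  last : ∀ p ∈ τ.getLast?, p.1.val + 1 = m₁ ∧ p.2.val + 1 = m₂
  hops : τ.IsChain Hop

/-- The Fréchet cost of an alignment: the maximal distance of two matched points.
(Distances are nonnegative, so starting the maximum at `0` is harmless.) -/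
def frechetCost {m₁ m₂ d : ℕ} (P : Curve m₁ d) (Q : Curve m₂ d)
    (τ : List (Fin m₁ × Fin m₂)) : ℝ :=
  (τ.map fun p => dist (P p.1) (Q p.2)).foldr max 0

/-- The discrete Fréchet distance: the minimum of the Fréchet cost over all alignments. -/
def dfd {m₁ m₂ d : ℕ} (P : Curve m₁ d) (Q : Curve m₂ d) : ℝ :=
  ⨅ τ : {τ : List (Fin m₁ × Fin m₂) // IsAlignment τ}, frechetCost P Q τ

/-! ### The real random access machine

The memory consists of arrays of natural numbers and arrays of real numbers.  A program is a finite
text of a structured language and mentions only finitely many arrays, by name; the position inside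
an array is computed.  There is no random instruction, no rounding instruction, and no way to turn
a real number into a natural number except by comparing real numbers.  The constants in a program
are natural numbers. -/

/-- The memory: `nat x i` and `real x i` are the cells at position `i` of the integer array and of
the real array with name `x`.  Scalar variables are arrays used at position `0` only. -/
structure Store where
  nat : ℕ → ℕ → ℕ
  real : ℕ → ℕ → ℝ

/-- Integer expressions: constants, memory access, addition, truncated subtraction, and
division by two. -/
inductive NatExp : Type
  | lit (c : ℕ)
  | get (x : ℕ) (i : NatExp)
  | add (a b : NatExp)
  | sub (a b : NatExp)
  | half (a : NatExp)

/-- Real expressions: integers, memory access, and the exact arithmetic operations. -/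
inductive RealExp : Type
  | ofNat (a : NatExp)
  | get (x : ℕ) (i : NatExp)
  | add (a b : RealExp)
  | sub (a b : RealExp)
  | mul (a b : RealExp)
  | div (a b : RealExp)

/-- Tests: comparisons and their Boolean combinations. -/
inductive Test : Type
  | natLe (a b : NatExp)
  | realLe (a b : RealExp)
  | neg (p : Test)
  | conj (p q : Test)

/-- Programs. `setNat x i e` writes the value of `e` at position `i` of the integer array `x`. -/
inductive Prog : Type
  | skip
  | setNat (x : ℕ) (i e : NatExp)
  | setReal (x : ℕ) (i : NatExp) (e : RealExp)
  | seq (p q : Prog)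
  | ite (b : Test) (p q : Prog)
  | while (b : Test) (p : Prog)

def NatExp.eval (s : Store) : NatExp → ℕ
  | .lit c => c
  | .get x i => s.nat x (i.eval s)
  | .add a b => a.eval s + b.eval s
  | .sub a b => a.eval s - b.eval s
  | .half a => a.eval s / 2

def RealExp.eval (s : Store) : RealExp → ℝ
  | .ofNat a => (a.eval s : ℝ)
  | .get x i => s.real x (i.eval s)
  | .add a b => a.eval s + b.eval s
  | .sub a b => a.eval s - b.eval s
  | .mul a b => a.eval s * b.eval s
  | .div a b => a.eval s / b.eval s

def Test.Holds (s : Store) : Test → Prop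
  | .natLe a b => a.eval s ≤ b.eval s
  | .realLe a b => a.eval s ≤ b.eval s
  | .neg p => ¬ p.Holds s
  | .conj p q => p.Holds s ∧ q.Holds s

/-- Write `v` at position `i` of the integer array `x`. -/
def Store.putNat (s : Store) (x i v : ℕ) : Store :=
  { s with nat := Function.update s.nat x (Function.update (s.nat x) i v) }

/-- Write `v` at position `i` of the real array `x`. -/
def Store.putReal (s : Store) (x i : ℕ) (v : ℝ) : Store :=
  { s with real := Function.update s.real x (Function.update (s.real x) i v) }

/-- `p.Runs s t s'`: started with memory `s`, the program `p` halts after `t` steps with memory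
`s'`.  Every execution of an assignment and every evaluation of a test is one step; the number of
elementary operations in it is bounded by the length of the program text, hence by a constant. -/
inductive Prog.Runs : Prog → Store → ℕ → Store → Prop
  | skip (s : Store) : Prog.Runs .skip s 0 s
  | setNat (s : Store) (x : ℕ) (i e : NatExp) :
      Prog.Runs (.setNat x i e) s 1 (s.putNat x (i.eval s) (e.eval s))
  | setReal (s : Store) (x : ℕ) (i : NatExp) (e : RealExp) :
      Prog.Runs (.setReal x i e) s 1 (s.putReal x (i.eval s) (e.eval s))
  | seq {p q : Prog} {s s₁ s₂ : Store} {t₁ t₂ : ℕ} :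
      Prog.Runs p s t₁ s₁ → Prog.Runs q s₁ t₂ s₂ → Prog.Runs (.seq p q) s (t₁ + t₂) s₂
  | iteTrue {b : Test} {p q : Prog} {s s₁ : Store} {t : ℕ} :
      b.Holds s → Prog.Runs p s t s₁ → Prog.Runs (.ite b p q) s (t + 1) s₁
  | iteFalse {b : Test} {p q : Prog} {s s₁ : Store} {t : ℕ} :
      ¬ b.Holds s → Prog.Runs q s t s₁ → Prog.Runs (.ite b p q) s (t + 1) s₁
  | whileTrue {b : Test} {p : Prog} {s s₁ s₂ : Store} {t₁ t₂ : ℕ} :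
      b.Holds s → Prog.Runs p s t₁ s₁ → Prog.Runs (.while b p) s₁ t₂ s₂ →
      Prog.Runs (.while b p) s (t₁ + t₂ + 1) s₂
  | whileFalse {b : Test} {p : Prog} {s : Store} :
      ¬ b.Holds s → Prog.Runs (.while b p) s 1 s

/-- Programs are deterministic: memory and step count at termination are determined by the input. -/
theorem Prog.Runs.deterministic {p : Prog} {s s₁ s₂ : Store} {t₁ t₂ : ℕ}
    (h₁ : p.Runs s t₁ s₁) (h₂ : p.Runs s t₂ s₂) : t₁ = t₂ ∧ s₁ = s₂ := by
  induction h₁ generalizing t₂ s₂ with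
  | skip s => cases h₂; exact ⟨rfl, rfl⟩
  | setNat s x i e => cases h₂; exact ⟨rfl, rfl⟩
  | setReal s x i e => cases h₂; exact ⟨rfl, rfl⟩
  | seq _ _ ih₁ ih₂ =>
    cases h₂ with
    | seq a b =>
      obtain ⟨rfl, rfl⟩ := ih₁ a
      obtain ⟨rfl, rfl⟩ := ih₂ b
      exact ⟨rfl, rfl⟩
  | iteTrue hb _ ih =>
    cases h₂ with
    | iteTrue _ a =>
      obtain ⟨rfl, rfl⟩ := ih a
      exact ⟨rfl, rfl⟩
    | iteFalse hb' _ => exact absurd hb hb'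
  | iteFalse hb _ ih =>
    cases h₂ with
    | iteTrue hb' _ => exact absurd hb' hb
    | iteFalse _ a =>
      obtain ⟨rfl, rfl⟩ := ih a
      exact ⟨rfl, rfl⟩
  | whileTrue hb _ _ ih₁ ih₂ =>
    cases h₂ with
    | whileTrue _ a b =>
      obtain ⟨rfl, rfl⟩ := ih₁ a
      obtain ⟨rfl, rfl⟩ := ih₂ b
      exact ⟨rfl, rfl⟩
    | whileFalse hb' => exact absurd hb hb'
  | whileFalse hb =>
    cases h₂ with
    | whileTrue hb' _ _ => exact absurd hb' hb
    | whileFalse _ => exact ⟨rfl, rfl⟩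

/-! ### Data structures -/

/-- The list of reals that holds the coordinates of the points of a curve, point after point. -/
def Curve.coords {m d : ℕ} (P : Curve m d) : List ℝ :=
  (List.ofFn fun j : Fin m => List.ofFn fun a : Fin d => P j a).flatten

/-- A data structure for curves: a preprocessing program, a query program, and the number `arrays`
of integer arrays and of real arrays in which the preprocessing leaves its result. -/
structure DataStructure where
  preprocess : Prog
  query : Prog
  arrays : ℕ

/-- The initial memory of the preprocessing: `n, m, d, k` in the integer array `0`, `ε, r` in the
real array `0`, and the coordinates of all curves, curve after curve, in the real array `1`.
All other cells contain `0`. -/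
def preprocessInput {n m d : ℕ} (C : Fin n → Curve m d) (k : ℕ) (ε r : ℝ) : Store where
  nat x i := if x = 0 then [n, m, d, k].getD i 0 else 0
  real x i :=
    if x = 0 then [ε, r].getD i 0
    else if x = 1 then (List.ofFn fun l : Fin n => (C l).coords).flatten.getD i 0
    else 0

namespace DataStructure

/-- The number of cells that the preprocessing keeps.  It announces in cell `0` of the integer
array `0` the common length of the `arrays` integer arrays and the `arrays` real arrays that form
the data structure. -/
def space (A : DataStructure) (s : Store) : ℕ := 2 * A.arrays * s.nat 0 0

/-- The initial memory of a query: the integer and real arrays `1, …, arrays` left by the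
preprocessing, cut off at the announced length; `d, k` in the integer array `0` and the coordinates
of the query curve in the real array `0`.  All other cells, in particular everything else that the
preprocessing has read or computed, contain `0`. -/
def queryInput (A : DataStructure) (s : Store) {k d : ℕ} (Q : Curve k d) : Store where
  nat x i :=
    if x = 0 then [d, k].getD i 0
    else if x ≤ A.arrays ∧ i < s.nat 0 0 then s.nat x i
    else 0
  real x i :=
    if x = 0 then Q.coords.getD i 0
    else if x ≤ A.arrays ∧ i < s.nat 0 0 then s.real x i
    else 0

/-- Asymmetric `(1 + ε, r)`-approximate near-neighbor for the curves `C 0, …, C (n - 1)` under the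
discrete Fréchet distance, with query curves of `k` points.  The preprocessing, given the curves and
the parameters, halts within `timeBound` steps and leaves at most `spaceBound` cells.  Every query
halts within `queryBound` steps, and if some curve is within distance `r` of the query curve, then
it returns, in cell `0` of the integer array `0`, the index of a curve within distance
`(1 + ε) * r`. -/
def SolvesANNC (A : DataStructure) {n m d : ℕ} (C : Fin n → Curve m d) (k : ℕ) (ε r : ℝ)
    (spaceBound timeBound queryBound : ℝ) : Prop :=
  ∃ (t : ℕ) (s : Store), A.preprocess.Runs (preprocessInput C k ε r) t s ∧
    (t : ℝ) ≤ timeBound ∧ (A.space s : ℝ) ≤ spaceBound ∧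
    ∀ Q : Curve k d, ∃ (t' : ℕ) (s' : Store), A.query.Runs (A.queryInput s Q) t' s' ∧
      (t' : ℝ) ≤ queryBound ∧
      ((∃ i : Fin n, dfd Q (C i) ≤ r) →
        ∃ j : Fin n, s'.nat 0 0 = j.val ∧ dfd Q (C j) ≤ (1 + ε) * r)

end DataStructure

end CurveANN

end

/-! Every coordinate of the query is rounded to a cell of one sorted table of breakpoints, and the
sequence of the `kd` cell numbers is the key of the query. For each curve `C i` the dictionary
stores cell sequences whose curve of cell corners is within `(1 + ε/2) r` of `C i`. The corners of
the query's cells are within `ε r / 2` of the query points whenever some curve is within `r` of the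
query. In that case the corner curve is within `(1 + ε/2) r` of that curve, so the key is present
(`Built.complete`). Any curve stored under the same key is within `(1 + ε/2) r + ε r / 2 = (1 + ε)
r` of the query (`Built.correct`). Alignments enter only through `Reach`, the dynamic program for
the decision problem (`dfd_le_iff`).

The main point is that `n · O(1/ε)^(kd)` sequences suffice. A greedy pass keeps at most `k` anchors
of each curve. If the query is within `r` of the curve, every point of the curve is within `2r` of
its anchor (`greedy_close`), so every query point is within `3r` of an anchor; as alignments are
monotone, the anchor numbers do not decrease along the query, which leaves `2^O(k)` assignments for
each length of query up to `kd`. Cells have width `δ = ε r / (2S)`, where `S` is the rounded-up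
square root of `d`. By Cauchy–Schwarz, the cells of a query point differ from those of its anchor by
at most `3rS/δ + d = 6S²/ε + d ≤ 25d/ε` in total over its coordinates (`Built.point`). Bounding this
sum, instead of each coordinate separately, avoids a factor `√d` in the base: with a common budget
`W` of about `25kd/ε` unit moves there are only `O(1/ε)^(kd)` displacements. The count is a
potential argument on the tree of partial candidates (`Ctx.pot_children`): a unit of budget weighs
`1 + ε`, the moves of one coordinate then form a geometric series of sum `O(1/ε)`, and `(1 + ε)^W`
is only exponential in `kd`.

The machine cannot round, so cells are found by binary search. A sweep over the sorted anchor
coordinates makes the table an exact grid of width `δ` around each anchor (`sweepProg_spec`), so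
that displacements in the table are controlled by distances (`Covered.cell`).

A node of the tree extends a row of the dynamic program by one coordinate in `O(m)` steps. Sorting
the dictionary costs a further factor `O(kd (1 + log (n/ε)))`, whose `kd` is absorbed by the base of
the exponential. A query makes `kd` searches in a table of polynomial length and one search in the
dictionary. -/

noncomputable section

namespace CurveANN

/-! ### Program notation and evaluation -/

instance (n : ℕ) : OfNat NatExp n := ⟨.lit n⟩
instance : Add NatExp := ⟨.add⟩
instance : Sub NatExp := ⟨.sub⟩
instance (n : ℕ) : OfNat RealExp n := ⟨.ofNat (.lit n)⟩
instance : Add RealExp := ⟨.add⟩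
instance : Sub RealExp := ⟨.sub⟩
instance : Mul RealExp := ⟨.mul⟩
instance : Div RealExp := ⟨.div⟩

/-- The integer variable stored at position `0` of the integer array `x`. -/
def nv (x : ℕ) : NatExp := .get x 0
/-- The real variable stored at position `0` of the real array `x`. -/
def rv (x : ℕ) : RealExp := .get x 0

infixr:30 " ;; " => Prog.seq

/-- Strict comparison of integers. -/
def Test.natLt (a b : NatExp) : Test := .neg (.natLe b a)
/-- Strict comparison of reals. -/
def Test.realLt (a b : RealExp) : Test := .neg (.realLe b a)

section Eval
variable (s : Store)

@[simp] theorem NatExp.eval_zero : (0 : NatExp).eval s = 0 := rfl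
@[simp] theorem NatExp.eval_one : (1 : NatExp).eval s = 1 := rfl
@[simp] theorem NatExp.eval_two : (2 : NatExp).eval s = 2 := rfl
@[simp] theorem NatExp.eval_three : (3 : NatExp).eval s = 3 := rfl
@[simp] theorem NatExp.eval_four : (4 : NatExp).eval s = 4 := rfl
@[simp] theorem NatExp.eval_lit (n : ℕ) : (NatExp.lit n).eval s = n := rfl
@[simp] theorem NatExp.eval_get (x : ℕ) (i : NatExp) :
    (NatExp.get x i).eval s = s.nat x (i.eval s) := rfl
@[simp] theorem NatExp.eval_nv (x : ℕ) : (nv x).eval s = s.nat x 0 := rfl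
@[simp] theorem NatExp.eval_add (a b : NatExp) : (a + b).eval s = a.eval s + b.eval s := rfl
@[simp] theorem NatExp.eval_sub (a b : NatExp) : (a - b).eval s = a.eval s - b.eval s := rfl
@[simp] theorem NatExp.eval_half (a : NatExp) : (NatExp.half a).eval s = a.eval s / 2 := rfl

@[simp] theorem RealExp.eval_zero : (0 : RealExp).eval s = 0 := Nat.cast_zero
@[simp] theorem RealExp.eval_two : (2 : RealExp).eval s = 2 := rfl
@[simp] theorem RealExp.eval_four : (4 : RealExp).eval s = 4 := rfl
@[simp] theorem RealExp.eval_twentyFive : (25 : RealExp).eval s = 25 := rfl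
@[simp] theorem RealExp.eval_ofNat (a : NatExp) : (RealExp.ofNat a).eval s = (a.eval s : ℝ) := rfl
@[simp] theorem RealExp.eval_get (x : ℕ) (i : NatExp) :
    (RealExp.get x i).eval s = s.real x (i.eval s) := rfl
@[simp] theorem RealExp.eval_rv (x : ℕ) : (rv x).eval s = s.real x 0 := rfl
@[simp] theorem RealExp.eval_add (a b : RealExp) : (a + b).eval s = a.eval s + b.eval s := rfl
@[simp] theorem RealExp.eval_sub (a b : RealExp) : (a - b).eval s = a.eval s - b.eval s := rfl
@[simp] theorem RealExp.eval_mul (a b : RealExp) : (a * b).eval s = a.eval s * b.eval s := rfl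
@[simp] theorem RealExp.eval_div (a b : RealExp) : (a / b).eval s = a.eval s / b.eval s := rfl

@[simp] theorem Test.holds_natLe (a b : NatExp) :
    (Test.natLe a b).Holds s ↔ a.eval s ≤ b.eval s := Iff.rfl
@[simp] theorem Test.holds_realLe (a b : RealExp) :
    (Test.realLe a b).Holds s ↔ a.eval s ≤ b.eval s := Iff.rfl
@[simp] theorem Test.holds_natLt (a b : NatExp) :
    (Test.natLt a b).Holds s ↔ a.eval s < b.eval s := not_le
@[simp] theorem Test.holds_realLt (a b : RealExp) :
    (Test.realLt a b).Holds s ↔ a.eval s < b.eval s := not_le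
@[simp] theorem Test.holds_neg (p : Test) : (Test.neg p).Holds s ↔ ¬ p.Holds s := Iff.rfl
@[simp] theorem Test.holds_conj (p q : Test) :
    (Test.conj p q).Holds s ↔ p.Holds s ∧ q.Holds s := Iff.rfl

@[simp] theorem Store.nat_putNat (x i v y j : ℕ) :
    (s.putNat x i v).nat y j = if y = x ∧ j = i then v else s.nat y j := by
  by_cases h : y = x
  · subst h; by_cases h' : j = i <;> simp [Store.putNat, Function.update, h']
  · simp [Store.putNat, Function.update, h]
@[simp] theorem Store.real_putNat (x i v : ℕ) : (s.putNat x i v).real = s.real := rfl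
@[simp] theorem Store.nat_putReal (x i : ℕ) (v : ℝ) : (s.putReal x i v).nat = s.nat := rfl
@[simp] theorem Store.real_putReal (x i : ℕ) (v : ℝ) (y j : ℕ) :
    (s.putReal x i v).real y j = if y = x ∧ j = i then v else s.real y j := by
  by_cases h : y = x
  · subst h; by_cases h' : j = i <;> simp [Store.putReal, Function.update, h']
  · simp [Store.putReal, Function.update, h]

@[simp] theorem Store.nat_putNat_of_ne {x y : ℕ} (h : y ≠ x) (i v : ℕ) :
    (s.putNat x i v).nat y = s.nat y := by
  simp [Store.putNat, Function.update, h]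
@[simp] theorem Store.real_putReal_of_ne {x y : ℕ} (h : y ≠ x) (i : ℕ) (v : ℝ) :
    (s.putReal x i v).real y = s.real y := by
  simp [Store.putReal, Function.update, h]

end Eval

/-! ### Reasoning about runs -/

/-- `p` started in `s` halts, and its number of steps and final memory satisfy `R`. -/
def Prog.wp (p : Prog) (s : Store) (R : ℕ → Store → Prop) : Prop :=
  ∃ t s', p.Runs s t s' ∧ R t s'

theorem Prog.Runs.wp {p : Prog} {s s' : Store} {t : ℕ} {R : ℕ → Store → Prop}
    (h : p.Runs s t s') (hR : R t s') : p.wp s R := ⟨t, s', h, hR⟩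

theorem Prog.wp.mono {p : Prog} {s : Store} {R R' : ℕ → Store → Prop}
    (h : p.wp s R) (hR : ∀ t s', R t s' → R' t s') : p.wp s R' := by
  obtain ⟨t, s', h, h'⟩ := h
  exact ⟨t, s', h, hR _ _ h'⟩

@[simp] theorem Prog.wp_skip {s : Store} {R : ℕ → Store → Prop} : Prog.skip.wp s R ↔ R 0 s :=
  ⟨fun ⟨_, _, h, hR⟩ => by cases h; exact hR, fun h => ⟨_, _, .skip s, h⟩⟩

@[simp] theorem Prog.wp_setNat {s : Store} {R : ℕ → Store → Prop} {x : ℕ} {i e : NatExp} :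
    (Prog.setNat x i e).wp s R ↔ R 1 (s.putNat x (i.eval s) (e.eval s)) :=
  ⟨fun ⟨_, _, h, hR⟩ => by cases h; exact hR, fun h => ⟨_, _, .setNat s x i e, h⟩⟩

@[simp] theorem Prog.wp_setReal {s : Store} {R : ℕ → Store → Prop} {x : ℕ} {i : NatExp}
    {e : RealExp} :
    (Prog.setReal x i e).wp s R ↔ R 1 (s.putReal x (i.eval s) (e.eval s)) :=
  ⟨fun ⟨_, _, h, hR⟩ => by cases h; exact hR, fun h => ⟨_, _, .setReal s x i e, h⟩⟩

@[simp] theorem Prog.wp_seq {p q : Prog} {s : Store} {R : ℕ → Store → Prop} :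
    (Prog.seq p q).wp s R ↔ p.wp s fun t₁ s₁ => q.wp s₁ fun t₂ s₂ => R (t₁ + t₂) s₂ :=
  ⟨fun ⟨_, _, h, hR⟩ => by cases h with | seq h₁ h₂ => exact ⟨_, _, h₁, _, _, h₂, hR⟩,
    fun ⟨_, _, h₁, _, _, h₂, hR⟩ => ⟨_, _, .seq h₁ h₂, hR⟩⟩

theorem Prog.wp_ite {b : Test} {p q : Prog} {s : Store} {R : ℕ → Store → Prop}
    (h₁ : b.Holds s → p.wp s fun t s' => R (t + 1) s')
    (h₂ : ¬ b.Holds s → q.wp s fun t s' => R (t + 1) s') : (Prog.ite b p q).wp s R := by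
  by_cases h : b.Holds s
  · obtain ⟨_, _, h', hR⟩ := h₁ h
    exact ⟨_, _, .iteTrue h h', hR⟩
  · obtain ⟨_, _, h', hR⟩ := h₂ h
    exact ⟨_, _, .iteFalse h h', hR⟩

/-- Does the program text assign to the integer array `x`? -/
def Prog.writesNat : Prog → ℕ → Bool
  | .skip, _ => false
  | .setNat x _ _, y => x == y
  | .setReal _ _ _, _ => false
  | .seq p q, y => p.writesNat y || q.writesNat y
  | .ite _ p q, y => p.writesNat y || q.writesNat y
  | .while _ p, y => p.writesNat y

/-- Does the program text assign to the real array `x`? -/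
def Prog.writesReal : Prog → ℕ → Bool
  | .skip, _ => false
  | .setNat _ _ _, _ => false
  | .setReal x _ _, y => x == y
  | .seq p q, y => p.writesReal y || q.writesReal y
  | .ite _ p q, y => p.writesReal y || q.writesReal y
  | .while _ p, y => p.writesReal y

/-- The memories `s` and `s'` agree on all arrays to which `p` does not assign. -/
structure Prog.Frame (p : Prog) (s s' : Store) : Prop where
  nat : ∀ x, p.writesNat x = false → s'.nat x = s.nat x
  real : ∀ x, p.writesReal x = false → s'.real x = s.real x

theorem Prog.Frame.refl (p : Prog) (s : Store) : p.Frame s s := ⟨fun _ _ => rfl, fun _ _ => rfl⟩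

theorem Prog.Frame.trans {p : Prog} {s₁ s₂ s₃ : Store} (h : p.Frame s₁ s₂) (h' : p.Frame s₂ s₃) :
    p.Frame s₁ s₃ :=
  ⟨fun x hx => (h'.nat x hx).trans (h.nat x hx), fun x hx => (h'.real x hx).trans (h.real x hx)⟩

/-- The side conditions of a frame are Boolean computations on the program text. Later proofs
discharge them by `rfl`, and loop invariants speak only of the arrays that the loop assigns to. -/
theorem Prog.Runs.frame {p : Prog} {s s' : Store} {t : ℕ} (h : p.Runs s t s') : p.Frame s s' := by
  induction h with
  | skip s => exact .refl _ _
  | setNat s x i e =>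
    refine ⟨fun y hy => ?_, fun _ _ => rfl⟩
    have : y ≠ x := by rintro rfl; simp [Prog.writesNat] at hy
    simp [Store.putNat, Function.update, this]
  | setReal s x i e =>
    refine ⟨fun _ _ => rfl, fun y hy => ?_⟩
    have : y ≠ x := by rintro rfl; simp [Prog.writesReal] at hy
    simp [Store.putReal, Function.update, this]
  | seq _ _ ih₁ ih₂ =>
    refine ⟨fun y hy => ?_, fun y hy => ?_⟩
    · simp only [Prog.writesNat, Bool.or_eq_false_iff] at hy
      rw [ih₂.nat y hy.2, ih₁.nat y hy.1]
    · simp only [Prog.writesReal, Bool.or_eq_false_iff] at hy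
      rw [ih₂.real y hy.2, ih₁.real y hy.1]
  | iteTrue _ _ ih =>
    refine ⟨fun y hy => ?_, fun y hy => ?_⟩
    · simp only [Prog.writesNat, Bool.or_eq_false_iff] at hy
      exact ih.nat y hy.1
    · simp only [Prog.writesReal, Bool.or_eq_false_iff] at hy
      exact ih.real y hy.1
  | iteFalse _ _ ih =>
    refine ⟨fun y hy => ?_, fun y hy => ?_⟩
    · simp only [Prog.writesNat, Bool.or_eq_false_iff] at hy
      exact ih.nat y hy.2
    · simp only [Prog.writesReal, Bool.or_eq_false_iff] at hy
      exact ih.real y hy.2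
  | whileTrue _ _ _ ih₁ ih₂ =>
    exact Prog.Frame.trans (p := .while _ _) ⟨ih₁.nat, ih₁.real⟩ ih₂
  | whileFalse _ => exact .refl _ _

/-- A loop whose body keeps an invariant that is indexed by the number of iterations. -/
theorem Prog.wp_while {b : Test} {p : Prog} {s₀ : Store} (I : ℕ → Store → Prop) (N T : ℕ)
    (h₀ : I 0 s₀)
    (hstep : ∀ i s, p.Frame s₀ s → I i s → b.Holds s →
      i < N ∧ p.wp s fun t s' => t ≤ T ∧ I (i + 1) s') :
    (Prog.while b p).wp s₀ fun t s' =>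
      t ≤ N * (T + 1) + 1 ∧ p.Frame s₀ s' ∧ ¬ b.Holds s' ∧ ∃ i ≤ N, I i s' := by
  suffices H : ∀ j i s, i + j = N → p.Frame s₀ s → I i s →
      (Prog.while b p).wp s fun t s' =>
        t ≤ j * (T + 1) + 1 ∧ p.Frame s₀ s' ∧ ¬ b.Holds s' ∧ ∃ i ≤ N, I i s' from
    H N 0 s₀ (by omega) (.refl _ _) h₀
  intro j
  induction j with
  | zero =>
    intro i s hij hf hI
    by_cases hb : b.Holds s
    · have := (hstep i s hf hI hb).1
      omega
    · exact ⟨1, s, .whileFalse hb, by omega, hf, hb, i, by omega, hI⟩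
  | succ j ih =>
    intro i s hij hf hI
    by_cases hb : b.Holds s
    · obtain ⟨-, t₁, s₁, hr₁, ht₁, hI₁⟩ := hstep i s hf hI hb
      obtain ⟨t₂, s₂, hr₂, ht₂, hp⟩ := ih (i + 1) s₁ (by omega) (hf.trans hr₁.frame) hI₁
      refine ⟨_, _, .whileTrue hb hr₁ hr₂, ?_, hp⟩
      rw [Nat.succ_mul]
      omega
    · exact ⟨1, s, .whileFalse hb, by omega, hf, hb, i, by omega, hI⟩

/-- A loop with an exactly known number of iterations. -/
theorem Prog.wp_for {b : Test} {p : Prog} {s₀ : Store} (I : ℕ → Store → Prop) (N T : ℕ)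
    (h₀ : I 0 s₀) (hb : ∀ i s, p.Frame s₀ s → i ≤ N → I i s → (b.Holds s ↔ i < N))
    (hstep : ∀ i s, p.Frame s₀ s → i < N → I i s → p.wp s fun t s' => t ≤ T ∧ I (i + 1) s') :
    (Prog.while b p).wp s₀ fun t s' => t ≤ N * (T + 1) + 1 ∧ p.Frame s₀ s' ∧ I N s' := by
  refine (Prog.wp_while (fun i s => i ≤ N ∧ I i s) N T ⟨N.zero_le, h₀⟩ ?_).mono ?_
  · rintro i s hf ⟨hi, hI⟩ hbs
    have hi' := (hb i s hf hi hI).1 hbs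
    exact ⟨hi', (hstep i s hf hi' hI).mono fun t s' h => ⟨h.1, hi', h.2⟩⟩
  · rintro t s' ⟨ht, hf, hbs, i, -, hi, hI⟩
    obtain rfl : i = N := by
      rw [hb i s' hf hi hI] at hbs
      omega
    exact ⟨ht, hf, hI⟩

/-- A loop whose running time is paid for by a potential. -/
theorem Prog.wp_while_potential {b : Test} {p : Prog} {s₀ : Store} (I : Store → Prop)
    (μ : Store → ℕ) (h₀ : I s₀)
    (hstep : ∀ s, p.Frame s₀ s → I s → b.Holds s →
      p.wp s fun t s' => t + 1 + μ s' ≤ μ s ∧ I s') :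
    (Prog.while b p).wp s₀ fun t s' =>
      t ≤ μ s₀ + 1 ∧ p.Frame s₀ s' ∧ ¬ b.Holds s' ∧ I s' := by
  suffices H : ∀ N s, μ s ≤ N → p.Frame s₀ s → I s → (Prog.while b p).wp s fun t s' =>
      t ≤ μ s + 1 ∧ p.Frame s₀ s' ∧ ¬ b.Holds s' ∧ I s' from
    H _ s₀ le_rfl (.refl _ _) h₀
  intro N
  induction N with
  | zero =>
    intro s hN hf hI
    by_cases hb : b.Holds s
    · obtain ⟨t, s', -, ht, -⟩ := hstep s hf hI hb
      omega
    · exact ⟨1, s, .whileFalse hb, by omega, hf, hb, hI⟩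
  | succ N ih =>
    intro s hN hf hI
    by_cases hb : b.Holds s
    · obtain ⟨t₁, s₁, hr₁, ht₁, hI₁⟩ := hstep s hf hI hb
      obtain ⟨t₂, s₂, hr₂, ht₂, hp⟩ := ih s₁ (by omega) (hf.trans hr₁.frame) hI₁
      exact ⟨_, _, .whileTrue hb hr₁ hr₂, by omega, hp⟩
    · exact ⟨1, s, .whileFalse hb, by omega, hf, hb, hI⟩

/-! ### Binary search -/

/-- The first `n` entries of `A` are sorted. -/
def SortedTo (A : ℕ → ℝ) (n : ℕ) : Prop := ∀ i j, i ≤ j → j < n → A i ≤ A j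

/-- `p` is the number of those of the first `n` entries of the sorted array `A` that are at
most `x`. -/
structure IsCut (A : ℕ → ℝ) (n : ℕ) (x : ℝ) (p : ℕ) : Prop where
  le : p ≤ n
  below : ∀ i < p, A i ≤ x
  above : ∀ i, p ≤ i → i < n → x < A i

theorem IsCut.unique {A : ℕ → ℝ} {n : ℕ} {x : ℝ} {p q : ℕ} (hp : IsCut A n x p)
    (hq : IsCut A n x q) : p = q := by
  by_contra h
  rcases Nat.lt_or_gt_of_ne h with h | h
  · exact absurd (hq.below p h) (not_le.2 (hp.above p le_rfl (h.trans_le hq.le)))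
  · exact absurd (hp.below q h) (not_le.2 (hq.above q le_rfl (h.trans_le hp.le)))

/-- Binary search for the real variable `6` in the real array `A`, whose length is stored at
position `c` of the integer array `2`. The result is left in the integer variable `8`. -/
def locateProg (A c : ℕ) : Prog :=
  .setNat 8 0 0 ;;
  .setNat 9 0 (.get 2 (.lit c)) ;;
  .while (.natLt (nv 8) (nv 9))
    (.setNat 10 0 (.half (nv 8 + nv 9)) ;;
    .ite (.realLe (.get A (nv 10)) (rv 6))
      (.setNat 8 0 (nv 10 + 1))
      (.setNat 9 0 (nv 10)))

/-- The entries before variable `8` are known to be at most the number sought and those from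
variable `9` on to exceed it. The gap between them is at most `n / 2 ^ i` after `i` rounds, hence
`log n + 1` rounds of four steps each. -/
theorem locateProg_spec {A c : ℕ} {s : Store} {n : ℕ} (hn : s.nat 2 c = n)
    (hs : SortedTo (s.real A) n) :
    (locateProg A c).wp s fun t s' => t ≤ 4 * Nat.log 2 n + 7 ∧ (locateProg A c).Frame s s' ∧
      IsCut (s.real A) n (s.real 6 0) (s'.nat 8 0) := by
  suffices H : (locateProg A c).wp s fun t s' => t ≤ 4 * Nat.log 2 n + 7 ∧
      IsCut (s.real A) n (s.real 6 0) (s'.nat 8 0) by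
    obtain ⟨t, s', hr, ht, h⟩ := H
    exact ⟨t, s', hr, ht, hr.frame, h⟩
  unfold locateProg
  simp only [Prog.wp_seq, Prog.wp_setNat]
  refine (Prog.wp_while (fun i s' => s'.real = s.real ∧ s'.nat 9 0 - s'.nat 8 0 ≤ n / 2 ^ i ∧
    s'.nat 8 0 ≤ s'.nat 9 0 ∧ s'.nat 9 0 ≤ n ∧ (∀ i < s'.nat 8 0, s.real A i ≤ s.real 6 0) ∧
    ∀ i, s'.nat 9 0 ≤ i → i < n → s.real 6 0 < s.real A i) (Nat.log 2 n + 1) 3 ?_ ?_).mono ?_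
  · simp [hn]
    omega
  · rintro i s' - ⟨hre, hd, hle, hhn, hbel, habo⟩ hb
    have hb' : s'.nat 8 0 < s'.nat 9 0 := by simpa using hb
    have hm : (s'.nat 8 0 + s'.nat 9 0) / 2 < s'.nat 9 0 := by omega
    refine ⟨?_, ?_⟩
    · have h1 : 1 ≤ n / 2 ^ i := by omega
      have h2 : 2 ^ i ≤ n := by
        by_contra hlt
        rw [Nat.div_eq_of_lt (by omega)] at h1
        omega
      have := Nat.le_log_of_pow_le (b := 2) (by norm_num) h2
      omega
    · have hdiv : n / 2 ^ (i + 1) = n / 2 ^ i / 2 := by rw [pow_succ, Nat.div_div_eq_div_mul]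
      simp only [Prog.wp_seq, Prog.wp_setNat]
      apply Prog.wp_ite
      · intro h
        simp [hre] at h
        simp [hre, hdiv]
        refine ⟨by omega, by omega, by omega, ?_, fun i h1 h2 => habo i h1 h2⟩
        intro i hi
        exact (hs i _ hi (by omega)).trans h
      · intro h
        simp [hre] at h
        simp [hre, hdiv]
        refine ⟨by omega, by omega, by omega, hbel, ?_⟩
        intro i hi hin
        exact h.trans_le (hs _ i hi hin)
  · rintro t s' ⟨ht, -, hb, i, -, -, -, hle, hhn, hbel, habo⟩
    have hb' : s'.nat 9 0 ≤ s'.nat 8 0 := by simpa using hb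
    refine ⟨by omega, by omega, hbel, fun i hi hin => habo i (by omega) hin⟩

/-! ### Merge sort -/

/-- The set of the pairs of entries of two arrays at the positions in `[lo, hi)`. -/
def pairsIn (A : ℕ → ℝ) (P : ℕ → ℕ) (lo hi : ℕ) : Set (ℝ × ℕ) :=
  {x | ∃ i, lo ≤ i ∧ i < hi ∧ x = (A i, P i)}

theorem pairsIn_self (A : ℕ → ℝ) (P : ℕ → ℕ) (lo : ℕ) : pairsIn A P lo lo = ∅ := by
  ext x
  simp only [pairsIn, Set.mem_ofPred_eq, Set.mem_empty_iff_false, iff_false]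
  rintro ⟨i, h, h', -⟩
  omega

theorem pairsIn_succ (A : ℕ → ℝ) (P : ℕ → ℕ) {lo hi : ℕ} (h : lo ≤ hi) :
    pairsIn A P lo (hi + 1) = insert (A hi, P hi) (pairsIn A P lo hi) := by
  ext x
  simp only [pairsIn, Set.mem_ofPred_eq, Set.mem_insert_iff]
  constructor
  · rintro ⟨i, h1, h2, rfl⟩
    rcases Nat.lt_succ_iff_lt_or_eq.1 h2 with h3 | rfl
    · exact .inr ⟨i, h1, h3, rfl⟩
    · exact .inl rfl
  · rintro (rfl | ⟨i, h1, h2, rfl⟩)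
    · exact ⟨hi, h, by omega, rfl⟩
    · exact ⟨i, h1, by omega, rfl⟩

theorem pairsIn_congr {A A' : ℕ → ℝ} {P P' : ℕ → ℕ} {lo hi : ℕ}
    (hA : ∀ i, lo ≤ i → i < hi → A i = A' i) (hP : ∀ i, lo ≤ i → i < hi → P i = P' i) :
    pairsIn A P lo hi = pairsIn A' P' lo hi := by
  ext x
  simp only [pairsIn, Set.mem_ofPred_eq]
  constructor
  · rintro ⟨i, h1, h2, rfl⟩
    exact ⟨i, h1, h2, by rw [hA i h1 h2, hP i h1 h2]⟩
  · rintro ⟨i, h1, h2, rfl⟩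
    exact ⟨i, h1, h2, by rw [hA i h1 h2, hP i h1 h2]⟩

theorem pairsIn_eq_insert {A A' : ℕ → ℝ} {P P' : ℕ → ℕ} {lo hi p : ℕ} {v : ℝ} (h : lo ≤ hi)
    (hv : A hi = v) (hp : P hi = p) (hA : ∀ i < hi, A i = A' i) (hP : ∀ i < hi, P i = P' i) :
    pairsIn A P lo (hi + 1) = insert (v, p) (pairsIn A' P' lo hi) := by
  rw [pairsIn_succ _ _ h, hv, hp, pairsIn_congr (fun i _ h => hA i h) fun i _ h => hP i h]

theorem pairsIn_union (A : ℕ → ℝ) (P : ℕ → ℕ) {lo mid hi : ℕ} (h : lo ≤ mid) (h' : mid ≤ hi) :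
    pairsIn A P lo mid ∪ pairsIn A P mid hi = pairsIn A P lo hi := by
  ext x
  simp only [pairsIn, Set.mem_ofPred_eq, Set.mem_union]
  constructor
  · rintro (⟨i, h1, h2, rfl⟩ | ⟨i, h1, h2, rfl⟩)
    · exact ⟨i, h1, by omega, rfl⟩
    · exact ⟨i, by omega, h2, rfl⟩
  · rintro ⟨i, h1, h2, rfl⟩
    rcases Nat.lt_or_ge i mid with h3 | h3
    · exact .inl ⟨i, h1, h3, rfl⟩
    · exact .inr ⟨i, h3, h2, rfl⟩

/-- Merge the positions `[i, mid)` and `[j, hi)` of the real array `3` and the integer array `1`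
into the real array `8` and the integer array `11`; the variables `i, j, mid, hi` and the output
position are the integer variables `14, 15, 16, 17, 18`. -/
def mergeBody : Prog :=
  .ite (.conj (.natLt (nv 14) (nv 16))
      (.neg (.conj (.natLt (nv 15) (nv 17)) (.realLt (.get 3 (nv 15)) (.get 3 (nv 14))))))
    (.setReal 8 (nv 18) (.get 3 (nv 14)) ;;
      .setNat 11 (nv 18) (.get 1 (nv 14)) ;;
      .setNat 14 0 (nv 14 + 1))
    (.setReal 8 (nv 18) (.get 3 (nv 15)) ;;
      .setNat 11 (nv 18) (.get 1 (nv 15)) ;;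
      .setNat 15 0 (nv 15 + 1)) ;;
  .setNat 18 0 (nv 18 + 1)

def mergeLoop : Prog := .while (.natLt (nv 18) (nv 17)) mergeBody

/-- After `c` outputs, `left` and `right` say that all outputs are at most all inputs still waiting,
which is what keeps the output sorted when the smaller head is appended. `real_eq` and `nat_eq`
protect the blocks merged before. -/
structure MergeInv (s : Store) (lo mid hi c : ℕ) (s' : Store) : Prop where
  out : s'.nat 18 0 = lo + c
  i_ge : lo ≤ s'.nat 14 0
  i_le : s'.nat 14 0 ≤ mid
  j_ge : mid ≤ s'.nat 15 0
  j_le : s'.nat 15 0 ≤ hi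
  sum : s'.nat 14 0 + s'.nat 15 0 = mid + lo + c
  real_eq : ∀ x < lo, s'.real 8 x = s.real 8 x
  nat_eq : ∀ x < lo, s'.nat 11 x = s.nat 11 x
  sorted : ∀ x y, lo ≤ x → x ≤ y → y < lo + c → s'.real 8 x ≤ s'.real 8 y
  left : ∀ x y, lo ≤ x → x < lo + c → s'.nat 14 0 ≤ y → y < mid → s'.real 8 x ≤ s.real 3 y
  right : ∀ x y, lo ≤ x → x < lo + c → s'.nat 15 0 ≤ y → y < hi → s'.real 8 x ≤ s.real 3 y
  pairs : pairsIn (s'.real 8) (s'.nat 11) lo (lo + c) =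
    pairsIn (s.real 3) (s.nat 1) lo (s'.nat 14 0) ∪ pairsIn (s.real 3) (s.nat 1) mid (s'.nat 15 0)

theorem mergeBody_spec {s s' : Store} {lo mid hi c : ℕ} (h16 : s.nat 16 0 = mid)
    (h17 : s.nat 17 0 = hi) (hf : mergeBody.Frame s s')
    (hl : ∀ x y, lo ≤ x → x ≤ y → y < mid → s.real 3 x ≤ s.real 3 y)
    (hr : ∀ x y, mid ≤ x → x ≤ y → y < hi → s.real 3 x ≤ s.real 3 y)
    (hc : lo + c < hi) (I : MergeInv s lo mid hi c s') :
    mergeBody.wp s' fun t s'' => t ≤ 5 ∧ MergeInv s lo mid hi (c + 1) s'' := by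
  have e16 : s'.nat 16 0 = mid := by rw [hf.nat 16 rfl, h16]
  have e17 : s'.nat 17 0 = hi := by rw [hf.nat 17 rfl, h17]
  have e3 : s'.real 3 = s.real 3 := hf.real 3 rfl
  have e1 : s'.nat 1 = s.nat 1 := hf.nat 1 rfl
  obtain ⟨hout, hi1, hi2, hj1, hj2, hsum, hre, hne, hso, hle, hri, hpa⟩ := I
  unfold mergeBody
  rw [Prog.wp_seq]
  apply Prog.wp_ite
  · intro h
    simp only [Test.holds_conj, Test.holds_natLt, NatExp.eval_nv, e16, Test.holds_neg, e17,
      Test.holds_realLt, RealExp.eval_get, e3, not_and, not_lt] at h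
    obtain ⟨h1, h2⟩ := h
    simp only [Prog.wp_seq, Prog.wp_setNat, Prog.wp_setReal]
    refine ⟨by norm_num, ?_⟩
    constructor <;> simp [hout, e3, e1]
    case out => omega
    case i_ge => omega
    case i_le => omega
    case j_ge => omega
    case j_le => omega
    case sum => omega
    case real_eq =>
      intro x hx
      rw [if_neg (by omega), hre x hx]
    case nat_eq =>
      intro x hx
      rw [if_neg (by omega), hne x hx]
    case sorted =>
      intro x y hx hxy hy
      by_cases hy' : y = lo + c
      · rw [if_pos hy']
        split_ifs with hx'
        · exact le_rfl
        · exact hle x _ hx (by omega) le_rfl h1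
      · rw [if_neg hy', if_neg (by omega)]
        exact hso x y hx hxy (by omega)
    case left =>
      intro x y hx hxc hy hym
      split_ifs with hx'
      · exact hl _ _ hi1 (by omega) hym
      · exact hle x y hx (by omega) (by omega) hym
    case right =>
      intro x y hx hxc hy hyh
      split_ifs with hx'
      · exact (h2 (by omega)).trans (hr _ _ hj1 hy hyh)
      · exact hri x y hx (by omega) hy hyh
    case pairs =>
      rw [← add_assoc, pairsIn_eq_insert (A' := s'.real 8) (P' := s'.nat 11) (by omega)
        (v := s.real 3 (s'.nat 14 0)) (p := s.nat 1 (s'.nat 14 0)) (by simp) (by simp)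
        (fun i hi => by simp; omega) (fun i hi => by simp; omega), hpa, pairsIn_succ _ _ hi1, Set.insert_union]
  · intro h
    simp only [Test.holds_conj, Test.holds_natLt, NatExp.eval_nv, e16, Test.holds_neg, e17,
      Test.holds_realLt, RealExp.eval_get, e3, not_and, Classical.not_imp, not_not] at h
    -- With the right run exhausted, the failed test would force the left run to be exhausted too,
    -- but fewer than `hi - lo` entries have been output.
    have h1 : s'.nat 15 0 < hi := by
      by_contra hge
      have := h (by omega)
      omega
    simp only [Prog.wp_seq, Prog.wp_setNat, Prog.wp_setReal]
    refine ⟨by norm_num, ?_⟩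
    constructor <;> simp [hout, e3, e1]
    case out => omega
    case i_ge => omega
    case i_le => omega
    case j_ge => omega
    case j_le => omega
    case sum => omega
    case real_eq =>
      intro x hx
      rw [if_neg (by omega), hre x hx]
    case nat_eq =>
      intro x hx
      rw [if_neg (by omega), hne x hx]
    case sorted =>
      intro x y hx hxy hy
      by_cases hy' : y = lo + c
      · rw [if_pos hy']
        split_ifs with hx'
        · exact le_rfl
        · exact hri x _ hx (by omega) le_rfl h1
      · rw [if_neg hy', if_neg (by omega)]
        exact hso x y hx hxy (by omega)
    case left =>
      intro x y hx hxc hy hym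
      split_ifs with hx'
      · exact (h (by omega)).2.le.trans (hl _ _ hi1 hy hym)
      · exact hle x y hx (by omega) hy hym
    case right =>
      intro x y hx hxc hy hyh
      split_ifs with hx'
      · exact hr _ _ hj1 (by omega) hyh
      · exact hri x y hx (by omega) (by omega) hyh
    case pairs =>
      rw [← add_assoc, pairsIn_eq_insert (A' := s'.real 8) (P' := s'.nat 11) (by omega)
        (v := s.real 3 (s'.nat 15 0)) (p := s.nat 1 (s'.nat 15 0)) (by simp) (by simp)
        (fun i hi => by simp; omega) (fun i hi => by simp; omega), hpa, pairsIn_succ _ _ hj1, Set.union_insert]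

theorem mergeLoop_spec {s : Store} {lo mid hi : ℕ} (h14 : s.nat 14 0 = lo)
    (h15 : s.nat 15 0 = mid) (h16 : s.nat 16 0 = mid) (h17 : s.nat 17 0 = hi)
    (h18 : s.nat 18 0 = lo) (hlm : lo ≤ mid) (hmh : mid ≤ hi)
    (hl : ∀ x y, lo ≤ x → x ≤ y → y < mid → s.real 3 x ≤ s.real 3 y)
    (hr : ∀ x y, mid ≤ x → x ≤ y → y < hi → s.real 3 x ≤ s.real 3 y) :
    mergeLoop.wp s fun t s' => t ≤ 6 * (hi - lo) + 1 ∧ mergeLoop.Frame s s' ∧ s'.nat 18 0 = hi ∧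
      (∀ x < lo, s'.real 8 x = s.real 8 x) ∧ (∀ x < lo, s'.nat 11 x = s.nat 11 x) ∧
      (∀ x y, lo ≤ x → x ≤ y → y < hi → s'.real 8 x ≤ s'.real 8 y) ∧
      pairsIn (s'.real 8) (s'.nat 11) lo hi = pairsIn (s.real 3) (s.nat 1) lo hi := by
  unfold mergeLoop
  refine (Prog.wp_for (MergeInv s lo mid hi) (hi - lo) 5 ?_ ?_ ?_).mono ?_
  · constructor <;> simp [h14, h15, h18, pairsIn_self] <;> omega
  · intro c s' hf hc I
    simp [hf.nat 17 rfl, h17, I.out]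
    omega
  · intro c s' hf hc I
    exact mergeBody_spec h16 h17 ⟨hf.nat, hf.real⟩ hl hr (by omega) I
  · rintro t s' ⟨ht, hf, I⟩
    have e : lo + (hi - lo) = hi := by omega
    obtain ⟨hout, hi1, hi2, hj1, hj2, hsum, hre, hne, hso, hle, hri, hpa⟩ := I
    rw [e] at hout hso hpa
    have a1 : s'.nat 14 0 = mid := by omega
    have a2 : s'.nat 15 0 = hi := by omega
    rw [a1, a2, pairsIn_union _ _ hlm hmh] at hpa
    exact ⟨by omega, ⟨hf.nat, hf.real⟩, hout, hre, hne, hso, hpa⟩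

/-- The blocks of length `w` among the first `n` positions are sorted. -/
def BlockSorted (A : ℕ → ℝ) (w n : ℕ) : Prop :=
  ∀ q i j, q * w ≤ i → i ≤ j → j < (q + 1) * w → j < n → A i ≤ A j

/-- Merge the blocks of length `w` (integer variable `12`) pairwise. -/
def mergePass : Prog :=
  .setNat 18 0 0 ;;
  .while (.natLt (nv 18) (.get 2 1))
    (.setNat 14 0 (nv 18) ;;
    -- With truncated subtraction `n - (n - a)` is the minimum of `n` and `a`, so the last blocks
    -- may be short or empty.
    .setNat 16 0 (.get 2 1 - (.get 2 1 - (nv 18 + nv 12))) ;;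
    .setNat 15 0 (nv 16) ;;
    .setNat 17 0 (.get 2 1 - (.get 2 1 - (nv 18 + nv 12 + nv 12))) ;;
    mergeLoop)

theorem mergePass_spec {s : Store} {w n : ℕ} (hw : s.nat 12 0 = w) (hw1 : 1 ≤ w)
    (hn : s.nat 2 1 = n) (hb : BlockSorted (s.real 3) w n) :
    mergePass.wp s fun t s' => t ≤ 12 * n + 2 ∧ mergePass.Frame s s' ∧
      BlockSorted (s'.real 8) (w + w) n ∧
      pairsIn (s'.real 8) (s'.nat 11) 0 n = pairsIn (s.real 3) (s.nat 1) 0 n := by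
  suffices H : mergePass.wp s fun t s' => t ≤ 12 * n + 2 ∧
      BlockSorted (s'.real 8) (w + w) n ∧
      pairsIn (s'.real 8) (s'.nat 11) 0 n = pairsIn (s.real 3) (s.nat 1) 0 n by
    obtain ⟨t, s', hr, ht, h⟩ := H
    exact ⟨t, s', hr, ht, hr.frame, h⟩
  unfold mergePass
  simp only [Prog.wp_seq, Prog.wp_setNat]
  -- Merging `h ≥ 1` positions costs `6h + 6 ≤ 12h` steps including the loop test, so twelve units
  -- per remaining position pay for the pass.
  refine (Prog.wp_while_potential (fun s' => s'.nat 18 0 ≤ n ∧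
    (s'.nat 18 0 = n ∨ ∃ q, s'.nat 18 0 = q * (w + w)) ∧
    BlockSorted (s'.real 8) (w + w) (s'.nat 18 0) ∧
    pairsIn (s'.real 8) (s'.nat 11) 0 (s'.nat 18 0) =
      pairsIn (s.real 3) (s.nat 1) 0 (s'.nat 18 0)) (fun s' => 12 * (n - s'.nat 18 0)) ?_ ?_).mono ?_
  · simp [pairsIn_self]
    intro q i j _ _ _ hj
    omega
  · rintro s' hf ⟨hle, hq, hbs, hpa⟩ hlt
    have e2 : s'.nat 2 1 = n := by rw [hf.nat 2 rfl]; simpa using hn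
    have e12 : s'.nat 12 0 = w := by rw [hf.nat 12 rfl]; simpa using hw
    have e3 : s'.real 3 = s.real 3 := by rw [hf.real 3 rfl]; rfl
    have e1 : s'.nat 1 = s.nat 1 := by rw [hf.nat 1 rfl]; funext i; simp
    have hlt' : s'.nat 18 0 < n := by simpa [e2] using hlt
    obtain ⟨q, hq⟩ : ∃ q, s'.nat 18 0 = q * (w + w) := hq.resolve_left (by omega)
    simp only [Prog.wp_seq, Prog.wp_setNat]
    set lo := s'.nat 18 0 with hlo
    refine (mergeLoop_spec (lo := lo) (mid := n - (n - (lo + w))) (hi := n - (n - (lo + w + w)))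
      (by simp [hlo]) (by simp [hlo, e2, e12]) (by simp [hlo, e2, e12]) (by simp [hlo, e2, e12])
      (by simp [hlo]) (by omega) (by omega) ?_ ?_).mono ?_
    · intro x y hx hxy hy
      simp only [Store.real_putNat, e3]
      refine hb (2 * q) x y ?_ hxy ?_ (by omega)
      · calc 2 * q * w = lo := by rw [hq]; ring
          _ ≤ x := hx
      · calc y < lo + w := by omega
          _ = (2 * q + 1) * w := by rw [hq]; ring
    · intro x y hx hxy hy
      simp only [Store.real_putNat, e3]
      refine hb (2 * q + 1) x y ?_ hxy ?_ (by omega)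
      · calc (2 * q + 1) * w = lo + w := by rw [hq]; ring
          _ ≤ x := by omega
      · calc y < lo + w + w := by omega
          _ = (2 * q + 1 + 1) * w := by rw [hq]; ring
    · rintro t s'' ⟨ht, hf', ho, hre, hne, hso, hpa'⟩
      simp only [Store.real_putNat, e3] at hre hpa'
      have e11 : ∀ x < lo, s''.nat 11 x = s'.nat 11 x := by
        intro x hx
        rw [hne x hx]
        simp
      have hpa'' : pairsIn (s''.real 8) (s''.nat 11) lo (n - (n - (lo + w + w))) =
          pairsIn (s.real 3) (s.nat 1) lo (n - (n - (lo + w + w))) := by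
        rw [hpa']
        exact pairsIn_congr (fun _ _ _ => rfl) fun i _ _ => by simp [e1]
      refine ⟨by omega, by omega, ?_, ?_, ?_⟩
      · rw [ho]
        rcases Nat.lt_or_ge n (lo + w + w) with h | h
        · left; omega
        · right
          refine ⟨q + 1, ?_⟩
          calc n - (n - (lo + w + w)) = lo + (w + w) := by omega
            _ = _ := by rw [hq]; ring
      · rw [ho]
        intro q' i j h1 h2 h3 h4
        rcases Nat.lt_or_ge j lo with hj | hj
        · rw [hre j hj, hre i (by omega)]
          exact hbs q' i j h1 h2 h3 hj
        · refine hso i j ?_ h2 h4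
          refine le_trans ?_ h1
          rw [hq] at hj ⊢
          apply Nat.mul_le_mul_right
          by_contra hlt
          have : (q' + 1) * (w + w) ≤ q * (w + w) := Nat.mul_le_mul_right _ (by omega)
          omega
      · rw [ho, ← pairsIn_union _ _ (Nat.zero_le lo) (by omega), hpa'',
          ← pairsIn_union (s.real 3) _ (Nat.zero_le lo) (by omega), ← hpa]
        congr 1
        exact pairsIn_congr (fun i _ h => hre i h) fun i _ h => e11 i h
  · rintro t s' ⟨ht, hf, hnb, hle, -, hbs, hpa⟩
    have e2 : s'.nat 2 1 = n := by rw [hf.nat 2 rfl]; simpa using hn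
    have e : s'.nat 18 0 = n := by
      have : n ≤ s'.nat 18 0 := by simpa [e2] using hnb
      omega
    rw [e] at hbs hpa
    refine ⟨?_, hbs, hpa⟩
    simp at ht
    omega

/-- Copy the merged arrays back. -/
def copyBack : Prog :=
  .setNat 18 0 0 ;;
  .while (.natLt (nv 18) (.get 2 1))
    (.setReal 3 (nv 18) (.get 8 (nv 18)) ;;
    .setNat 1 (nv 18) (.get 11 (nv 18)) ;;
    .setNat 18 0 (nv 18 + 1))

theorem copyBack_spec {s : Store} {n : ℕ} (hn : s.nat 2 1 = n) :
    copyBack.wp s fun t s' => t ≤ 4 * n + 2 ∧ copyBack.Frame s s' ∧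
      (∀ i < n, s'.real 3 i = s.real 8 i) ∧ ∀ i < n, s'.nat 1 i = s.nat 11 i := by
  suffices H : copyBack.wp s fun t s' => t ≤ 4 * n + 2 ∧
      (∀ i < n, s'.real 3 i = s.real 8 i) ∧ ∀ i < n, s'.nat 1 i = s.nat 11 i by
    obtain ⟨t, s', hr, ht, h⟩ := H
    exact ⟨t, s', hr, ht, hr.frame, h⟩
  unfold copyBack
  simp only [Prog.wp_seq, Prog.wp_setNat]
  refine (Prog.wp_for (fun c s' => s'.nat 18 0 = c ∧ (∀ i < c, s'.real 3 i = s.real 8 i) ∧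
    ∀ i < c, s'.nat 1 i = s.nat 11 i) n 3 (by simp) ?_ ?_).mono ?_
  · rintro i s' hf - ⟨h, -⟩
    simp [h, hf.nat 2 rfl, hn]
  · rintro i s' hf - ⟨h, h1, h2⟩
    have e8 : s'.real 8 = s.real 8 := by rw [hf.real 8 rfl]; rfl
    have e11 : s'.nat 11 = s.nat 11 := by rw [hf.nat 11 rfl]; funext; simp
    simp only [Prog.wp_seq, Prog.wp_setNat, Prog.wp_setReal]
    refine ⟨le_rfl, by simp [h], ?_, ?_⟩
    · intro j hj
      simp only [NatExp.eval_nv, RealExp.eval_get, e8, h]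
      simp
      split_ifs with h'
      · rw [h']
      · exact h1 j (by omega)
    · intro j hj
      simp [h, e11]
      split_ifs with h'
      · rw [h']
      · exact h2 j (by omega)
  · rintro t s' ⟨ht, -, -, h1, h2⟩
    exact ⟨by omega, h1, h2⟩

/-- Sort the real array `3` together with the integer array `1`; the length is stored at position
`1` of the integer array `2`. -/
def sortProg : Prog :=
  .setNat 12 0 1 ;;
  .while (.natLt (nv 12) (.get 2 1)) (mergePass ;; copyBack ;; .setNat 12 0 (nv 12 + nv 12))

/-- After `c` passes the blocks of length `2 ^ c` are sorted, so `log n + 1` passes suffice. The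
contents are tracked as a set of pairs without multiplicities, which is all that a dictionary lookup
needs. -/
theorem sortProg_spec {s : Store} {n : ℕ} (hn : s.nat 2 1 = n) :
    sortProg.wp s fun t s' => t ≤ (Nat.log 2 n + 1) * (16 * n + 6) + 2 ∧ sortProg.Frame s s' ∧
      SortedTo (s'.real 3) n ∧
      pairsIn (s'.real 3) (s'.nat 1) 0 n = pairsIn (s.real 3) (s.nat 1) 0 n := by
  suffices H : sortProg.wp s fun t s' => t ≤ (Nat.log 2 n + 1) * (16 * n + 6) + 2 ∧
      SortedTo (s'.real 3) n ∧
      pairsIn (s'.real 3) (s'.nat 1) 0 n = pairsIn (s.real 3) (s.nat 1) 0 n by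
    obtain ⟨t, s', hr, ht, h⟩ := H
    exact ⟨t, s', hr, ht, hr.frame, h⟩
  unfold sortProg
  simp only [Prog.wp_seq, Prog.wp_setNat]
  refine (Prog.wp_while (fun c s' => s'.nat 12 0 = 2 ^ c ∧ BlockSorted (s'.real 3) (2 ^ c) n ∧
    pairsIn (s'.real 3) (s'.nat 1) 0 n = pairsIn (s.real 3) (s.nat 1) 0 n) (Nat.log 2 n + 1)
    (16 * n + 5) ?_ ?_).mono ?_
  · refine ⟨by simp, ?_, ?_⟩
    · intro q i j h1 h2 h3 _
      have : i = j := by omega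
      rw [this]
    · exact pairsIn_congr (fun _ _ _ => rfl) fun i _ _ => by simp
  · rintro c s' hf ⟨h12, hbs, hpa⟩ hb
    have e2 : s'.nat 2 1 = n := by rw [hf.nat 2 rfl]; simpa using hn
    have hb' : 2 ^ c < n := by simpa [h12, e2] using hb
    refine ⟨by have := Nat.le_log_of_pow_le (b := 2) (by norm_num) hb'.le; omega, ?_⟩
    simp only [Prog.wp_seq, Prog.wp_setNat]
    refine (mergePass_spec h12 Nat.one_le_two_pow e2 hbs).mono ?_
    rintro t₁ s₁ ⟨ht₁, hf₁, hbs₁, hpa₁⟩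
    refine (copyBack_spec (n := n) (by rw [hf₁.nat 2 rfl, e2])).mono ?_
    rintro t₂ s₂ ⟨ht₂, hf₂, hc, hc'⟩
    refine ⟨by omega, ?_, ?_, ?_⟩
    · simp [hf₂.nat 12 rfl, hf₁.nat 12 rfl, h12, pow_succ]
      ring
    · simp only [Store.real_putNat]
      intro q i j h1 h2 h3 h4
      rw [hc j h4, hc i (by omega)]
      rw [pow_succ, mul_two] at h1 h3
      exact hbs₁ q i j h1 h2 h3 h4
    · rw [← hpa, ← hpa₁]
      exact pairsIn_congr (fun i _ h => by simp [hc i h]) fun i _ h => by simp [hc' i h]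
  · rintro t s' ⟨ht, hf, hb, c, -, h12, hbs, hpa⟩
    have e2 : s'.nat 2 1 = n := by rw [hf.nat 2 rfl]; simpa using hn
    have hb' : n ≤ 2 ^ c := by simpa [h12, e2] using hb
    refine ⟨by rw [show 16 * n + 5 + 1 = 16 * n + 6 from rfl] at ht; omega, ?_, hpa⟩
    intro i j hij hj
    exact hbs 0 i j (by omega) hij (by omega) hj

/-! ### The numerical parameters -/

/-- Compute the product `κ` of `k` and `d`, the rounded square root of `d`, the grid width, the
budget, and the thresholds. -/
def setupProg : Prog :=
  (.setNat 14 0 0 ;;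
    .while (.natLt (nv 14) (.get 0 3))
      (.setNat 2 2 (.get 2 2 + .get 0 2) ;; .setNat 14 0 (nv 14 + 1))) ;;
  .while (.realLt (.ofNat (nv 5) * .ofNat (nv 5)) (.ofNat (.get 0 2))) (.setNat 5 0 (nv 5 + 1)) ;;
  .while (.realLt (.ofNat (nv 6) * rv 0) (25 * .ofNat (.get 2 2))) (.setNat 6 0 (nv 6 + 1)) ;;
  .setReal 4 0 (rv 0 * .get 0 1 / (2 * .ofNat (nv 5))) ;;
  .setReal 9 0 ((.get 0 1 + rv 0 * .get 0 1 / 2) * (.get 0 1 + rv 0 * .get 0 1 / 2)) ;;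
  .setReal 9 1 (4 * .get 0 1 * .get 0 1) ;;
  .setReal 9 2 (4 * .get 0 1)

/-- The values computed by `setupProg`. -/
structure Setup (k d : ℕ) (ε r : ℝ) (s : Store) : Prop where
  card : s.nat 2 2 = k * d
  len : s.nat 2 0 = 0
  root_ge : d ≤ s.nat 5 0 * s.nat 5 0
  root_min : ∀ j < s.nat 5 0, j * j < d
  budget_ge : 25 * ((k * d : ℕ) : ℝ) ≤ s.nat 6 0 * ε
  budget_min : ∀ j < s.nat 6 0, j * ε < 25 * ((k * d : ℕ) : ℝ)
  width : s.real 4 0 = ε * r / (2 * s.nat 5 0)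
  close : s.real 9 0 = (r + ε * r / 2) * (r + ε * r / 2)
  far : s.real 9 1 = 4 * r * r
  reach : s.real 9 2 = 4 * r

/-- Without roots and rounding, the smallest `S` with `d ≤ S²` and the smallest `W` with `25kd ≤ Wε`
are found by counting upwards. This takes at most `d` and `⌈25kd/ε⌉` rounds, negligible against the
search. The minimality is recorded because it later bounds `S²` and `(1 + ε)^W` from above. -/
theorem setupProg_spec {s : Store} {k d : ℕ} {ε r : ℝ} (hk : s.nat 0 3 = k) (hd : s.nat 0 2 = d)
    (hε' : s.real 0 0 = ε) (hr : s.real 0 1 = r) (h22 : s.nat 2 2 = 0) (h20 : s.nat 2 0 = 0) (h5 : s.nat 5 0 = 0)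
    (h6 : s.nat 6 0 = 0) (hε : 0 < ε) :
    setupProg.wp s fun t s' => t ≤ 3 * k + 2 * d + 2 * ⌈25 * ((k * d : ℕ) : ℝ) / ε⌉₊ + 8 ∧
      setupProg.Frame s s' ∧ Setup k d ε r s' := by
  suffices H : setupProg.wp s fun t s' => t ≤ 3 * k + 2 * d + 2 * ⌈25 * ((k * d : ℕ) : ℝ) / ε⌉₊ + 8 ∧
      Setup k d ε r s' by
    obtain ⟨t, s', hr, ht, h⟩ := H
    exact ⟨t, s', hr, ht, hr.frame, h⟩
  unfold setupProg
  simp only [Prog.wp_seq, Prog.wp_setNat]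
  refine (Prog.wp_for (fun c s' => s'.nat 14 0 = c ∧ s'.nat 2 2 = c * d ∧
    s'.nat 2 0 = 0) k 2 ?_ ?_ ?_).mono ?_
  · simp [h22, h20]
  · rintro i s' hf - ⟨h, -⟩
    simp [h, hf.nat 0 rfl, hk]
  · rintro i s' hf - ⟨h, h', h''⟩
    simp [h, h', h'', hf.nat 0 rfl, hd, add_mul]
  rintro t₁ s₁ ⟨ht₁, hf₁, -, h22, h20⟩
  have a0 : s₁.nat 0 = s.nat 0 := by rw [hf₁.nat 0 rfl]; funext; simp
  have b0 : s₁.real 0 = s.real 0 := by rw [hf₁.real 0 rfl]; rfl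
  have a5 : s₁.nat 5 0 = 0 := by rw [hf₁.nat 5 rfl]; simp [h5]
  have a6 : s₁.nat 6 0 = 0 := by rw [hf₁.nat 6 rfl]; simp [h6]
  refine (Prog.wp_while (fun c s' => s'.nat 5 0 = c ∧ ∀ j < c, j * j < d) d 1 ?_ ?_).mono ?_
  · simp [a5]
  · rintro i s' hf ⟨h, h'⟩ hb
    have hb' : i * i < d := by
      have : (i : ℝ) * i < d := by simpa [h, hf.nat 0 rfl, a0, hd] using hb
      exact_mod_cast this
    refine ⟨by nlinarith, ?_⟩
    simp only [Prog.wp_setNat]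
    refine ⟨le_rfl, by simp [h], ?_⟩
    intro j hj
    rcases Nat.lt_succ_iff_lt_or_eq.1 hj with hj | rfl
    · exact h' j hj
    · exact hb'
  rintro t₂ s₂ ⟨ht₂, hf₂, hb, c, -, hc, hcm⟩
  have a0' : s₂.nat 0 = s.nat 0 := by rw [hf₂.nat 0 rfl, a0]
  have b0' : s₂.real 0 = s.real 0 := by rw [hf₂.real 0 rfl, b0]
  have a2' : s₂.nat 2 2 = k * d := by rw [hf₂.nat 2 rfl, h22]
  have a20' : s₂.nat 2 0 = 0 := by rw [hf₂.nat 2 rfl, h20]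
  have a6' : s₂.nat 6 0 = 0 := by rw [hf₂.nat 6 rfl, a6]
  have hcd : d ≤ c * c := by
    have : (d : ℝ) ≤ c * c := by simpa [hc, a0', hd] using hb
    exact_mod_cast this
  refine (Prog.wp_while (fun c s' => s'.nat 6 0 = c ∧
    ∀ j < c, j * ε < 25 * ((k * d : ℕ) : ℝ)) ⌈25 * ((k * d : ℕ) : ℝ) / ε⌉₊ 1 ?_ ?_).mono ?_
  · simp [a6']
  · rintro i s' hf ⟨h, h'⟩ hb
    have hb' : i * ε < 25 * ((k * d : ℕ) : ℝ) := by
      simpa [h, hf.nat 2 rfl, a2', hf.real 0 rfl, b0', hε'] using hb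
    refine ⟨Nat.lt_ceil.2 ((lt_div_iff₀ hε).2 hb'), ?_⟩
    simp only [Prog.wp_setNat]
    refine ⟨le_rfl, by simp [h], ?_⟩
    intro j hj
    rcases Nat.lt_succ_iff_lt_or_eq.1 hj with hj | rfl
    · exact h' j hj
    · exact hb'
  rintro t₃ s₃ ⟨ht₃, hf₃, hb₃, W, -, hW, hWm⟩
  have b0'' : s₃.real 0 = s.real 0 := by rw [hf₃.real 0 rfl, b0']
  have a2'' : s₃.nat 2 2 = k * d := by rw [hf₃.nat 2 rfl, a2']
  have a20'' : s₃.nat 2 0 = 0 := by rw [hf₃.nat 2 rfl, a20']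
  have a5'' : s₃.nat 5 0 = c := by rw [hf₃.nat 5 rfl, hc]
  have hW' : 25 * ((k * d : ℕ) : ℝ) ≤ W * ε := by
    simpa [hW, a2'', b0'', hε'] using hb₃
  simp only [Prog.wp_setReal]
  refine ⟨by omega, ?_⟩
  constructor <;> simp [b0'', a2'', a20'', a5'', hW, hε', hr]
  · exact hcd
  · exact hcm
  · simpa using hW'
  · simpa using hWm

/-! ### The greedy simplification -/

/-- The squared distance of the first `d` coordinates. -/
def sqd (d : ℕ) (x y : ℕ → ℝ) : ℝ := ∑ a ∈ Finset.range d, (x a - y a) * (x a - y a)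

/-- The greedy simplification after the first `l` points of a curve: the number of the current
anchor, and the index of the point of the curve that is this anchor. A point whose squared distance
to the current anchor exceeds `ρ` becomes a new anchor, as long as there are at most `k`. -/
def greedy (d k : ℕ) (ρ : ℝ) (c : ℕ → ℕ → ℝ) : ℕ → ℕ × ℕ
  | 0 => (0, 0)
  | l + 1 =>
    open Classical in
    if ρ < sqd d (c l) (c (greedy d k ρ c l).2) ∧ (greedy d k ρ c l).1 + 1 < k then
      ((greedy d k ρ c l).1 + 1, l)
    else greedy d k ρ c l

theorem greedy_fst_mono (d k : ℕ) (ρ : ℝ) (c : ℕ → ℕ → ℝ) :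
    Monotone fun l => (greedy d k ρ c l).1 := by
  refine monotone_nat_of_le_succ fun l => ?_
  simp only [greedy]
  split_ifs <;> simp

theorem greedy_fst_lt {d k : ℕ} (hk : 1 ≤ k) (ρ : ℝ) (c : ℕ → ℕ → ℝ) (l : ℕ) :
    (greedy d k ρ c l).1 < k := by
  induction l with
  | zero => exact hk
  | succ l ih =>
    simp only [greedy]
    split_ifs with h
    · exact h.2
    · exact ih

/-- Variable `16` is the address of an input point, variable `18` the address of an anchor slot in
the real array `5`. -/
def copyPoint : Prog :=
  .setNat 19 0 0 ;;
  .while (.natLt (nv 19) (.get 0 2))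
    (.setReal 5 (nv 18 + nv 19) (.get 1 (nv 16 + nv 19)) ;; .setNat 19 0 (nv 19 + 1))

theorem copyPoint_spec {s : Store} {d x b : ℕ} (hd : s.nat 0 2 = d) (hx : s.nat 18 0 = x)
    (hb : s.nat 16 0 = b) :
    copyPoint.wp s fun t s' => t ≤ 3 * d + 2 ∧ copyPoint.Frame s s' ∧
      (∀ a < d, s'.real 5 (x + a) = s.real 1 (b + a)) ∧
      ∀ p, (p < x ∨ x + d ≤ p) → s'.real 5 p = s.real 5 p := by
  suffices H : copyPoint.wp s fun t s' => t ≤ 3 * d + 2 ∧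
      (∀ a < d, s'.real 5 (x + a) = s.real 1 (b + a)) ∧
      ∀ p, (p < x ∨ x + d ≤ p) → s'.real 5 p = s.real 5 p by
    obtain ⟨t, s', hr, ht, h⟩ := H
    exact ⟨t, s', hr, ht, hr.frame, h⟩
  unfold copyPoint
  simp only [Prog.wp_seq, Prog.wp_setNat]
  refine (Prog.wp_for (fun c s' => s'.nat 19 0 = c ∧
      (∀ a < c, s'.real 5 (x + a) = s.real 1 (b + a)) ∧
      ∀ p, (p < x ∨ x + d ≤ p) → s'.real 5 p = s.real 5 p) d 2 ?_ ?_ ?_).mono ?_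
  · simp
  · rintro i s' hf - ⟨h, -⟩
    simp [h, hf.nat 0 rfl, hd]
  · rintro i s' hf hi ⟨h, h1, h2⟩
    have e18 : s'.nat 18 0 = x := by rw [hf.nat 18 rfl]; simp [hx]
    have e16 : s'.nat 16 0 = b := by rw [hf.nat 16 rfl]; simp [hb]
    have e1 : s'.real 1 = s.real 1 := by rw [hf.real 1 rfl]; simp
    simp only [Prog.wp_seq, Prog.wp_setReal, Prog.wp_setNat]
    refine ⟨le_rfl, by simp [h], ?_, ?_⟩
    · intro a ha
      simp [h, e18, e16, e1]
      split_ifs with h'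
      · rw [h']
      · exact h1 a (by omega)
    · intro p hp
      simp [h, e18]
      rw [if_neg (by omega), h2 p hp]
  · rintro t s' ⟨ht, -, -, h1, h2⟩
    exact ⟨by omega, h1, h2⟩

def distPoint : Prog :=
  .setReal 10 0 0 ;;
  .setNat 19 0 0 ;;
  .while (.natLt (nv 19) (.get 0 2))
    (.setReal 10 0 (rv 10 + (.get 1 (nv 16 + nv 19) - .get 5 (nv 18 + nv 19)) *
      (.get 1 (nv 16 + nv 19) - .get 5 (nv 18 + nv 19))) ;; .setNat 19 0 (nv 19 + 1))

theorem distPoint_spec {s : Store} {d x b : ℕ} (hd : s.nat 0 2 = d) (hx : s.nat 18 0 = x)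
    (hb : s.nat 16 0 = b) :
    distPoint.wp s fun t s' => t ≤ 3 * d + 3 ∧ distPoint.Frame s s' ∧
      s'.real 10 0 = sqd d (fun a => s.real 1 (b + a)) fun a => s.real 5 (x + a) := by
  suffices H : distPoint.wp s fun t s' => t ≤ 3 * d + 3 ∧
      s'.real 10 0 = sqd d (fun a => s.real 1 (b + a)) fun a => s.real 5 (x + a) by
    obtain ⟨t, s', hr, ht, h⟩ := H
    exact ⟨t, s', hr, ht, hr.frame, h⟩
  unfold distPoint
  simp only [Prog.wp_seq, Prog.wp_setNat, Prog.wp_setReal]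
  refine (Prog.wp_for (fun c s' => s'.nat 19 0 = c ∧
      s'.real 10 0 = sqd c (fun a => s.real 1 (b + a)) fun a => s.real 5 (x + a)) d 2
      ?_ ?_ ?_).mono ?_
  · simp [sqd]
  · rintro i s' hf - ⟨h, -⟩
    simp [h, hf.nat 0 rfl, hd]
  · rintro i s' hf hi ⟨h, h1⟩
    have e18 : s'.nat 18 0 = x := by rw [hf.nat 18 rfl]; simp [hx]
    have e16 : s'.nat 16 0 = b := by rw [hf.nat 16 rfl]; simp [hb]
    have e1 : s'.real 1 = s.real 1 := by rw [hf.real 1 rfl]; funext; simp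
    have e5 : s'.real 5 = s.real 5 := by rw [hf.real 5 rfl]; funext; simp
    simp only [Prog.wp_seq, Prog.wp_setReal, Prog.wp_setNat]
    refine ⟨le_rfl, by simp [h], ?_⟩
    simp [h, h1, e18, e16, e1, e5, sqd, Finset.sum_range_succ]
  · rintro t s' ⟨ht, -, -, h1⟩
    exact ⟨by omega, h1⟩

/-- Process one point: number `15`, at address `16`, with the current anchor number `17` at
address `18`. -/
def greedyPoint : Prog :=
  distPoint ;;
  .ite (.conj (.realLt (.get 9 1) (rv 10)) (.natLt (nv 17 + 1) (.get 0 3)))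
    (.setNat 17 0 (nv 17 + 1) ;; .setNat 18 0 (nv 18 + .get 0 2) ;; copyPoint) .skip ;;
  .setNat 16 0 (nv 16 + .get 0 2) ;;
  .setNat 15 0 (nv 15 + 1)

/-- `pts` covers all anchors that were current at some earlier time, not only the latest one: a
query point is later assigned to the anchor that was current at the curve point matched with it. -/
structure GreedyInv (s : Store) (c : ℕ → ℕ → ℝ) (d k : ℕ) (ρ : ℝ) (b x : ℕ) (l : ℕ) (s' : Store) : Prop where
  idx : s'.nat 15 0 = l
  pt : s'.nat 16 0 = b + l * d
  num : s'.nat 17 0 = (greedy d k ρ c l).1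
  anchor : s'.nat 18 0 = x + (greedy d k ρ c l).1 * d
  old : ∀ p < x, s'.real 5 p = s.real 5 p
  pts : ∀ l' ≤ l, ∀ a < d,
    s'.real 5 (x + (greedy d k ρ c l').1 * d + a) =
      c (greedy d k ρ c l').2 a

theorem greedyPoint_spec {s s' : Store} {c : ℕ → ℕ → ℝ} {d k : ℕ} {ρ : ℝ} {b x l : ℕ} (hd : s'.nat 0 2 = d)
    (hk : s'.nat 0 3 = k) (hρ : s'.real 9 1 = ρ) (hc : ∀ l a, s'.real 1 (b + l * d + a) = c l a)
    (I : GreedyInv s c d k ρ b x l s') :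
    greedyPoint.wp s' fun t s'' => t ≤ 6 * d + 10 ∧ GreedyInv s c d k ρ b x (l + 1) s'' := by
  obtain ⟨hidx, hpt, hnum, hanc, hold, hpts⟩ := I
  unfold greedyPoint
  rw [Prog.wp_seq]
  refine (distPoint_spec hd hanc hpt).mono ?_
  rintro t₁ s₁ ⟨ht₁, hf₁, h10⟩
  rw [Prog.wp_seq]
  have hdist : s₁.real 10 0 = sqd d (c l) (c (greedy d k ρ c l).2) := by
    rw [h10]
    simp only [sqd, hc]
    refine Finset.sum_congr rfl fun a ha => ?_
    rw [hpts l le_rfl a (Finset.mem_range.1 ha)]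
  have f15 : s₁.nat 15 = s'.nat 15 := hf₁.nat 15 rfl
  have f16 : s₁.nat 16 = s'.nat 16 := hf₁.nat 16 rfl
  have f17 : s₁.nat 17 = s'.nat 17 := hf₁.nat 17 rfl
  have f18 : s₁.nat 18 = s'.nat 18 := hf₁.nat 18 rfl
  have f0 : s₁.nat 0 = s'.nat 0 := hf₁.nat 0 rfl
  have f9 : s₁.real 9 = s'.real 9 := hf₁.real 9 rfl
  have f5 : s₁.real 5 = s'.real 5 := hf₁.real 5 rfl
  have f1 : s₁.real 1 = s'.real 1 := hf₁.real 1 rfl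
  apply Prog.wp_ite
  · intro h
    have h' : ρ < sqd d (c l) (c (greedy d k ρ c l).2) ∧ (greedy d k ρ c l).1 + 1 < k := by
      simpa [f9, hρ, hdist, f17, hnum, f0, hk] using h
    have hg : greedy d k ρ c (l + 1) = ((greedy d k ρ c l).1 + 1, l) := by
      rw [greedy, if_pos h']
    simp only [Prog.wp_seq, Prog.wp_setNat]
    refine (copyPoint_spec (d := d) (x := x + (greedy d k ρ c (l + 1)).1 * d) (b := b + l * d)
      (by simp [f0, hd]) (by simp [f18, hanc, hg, f0, hd]; ring) (by simp [f16, hpt])).mono ?_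
    rintro t₂ s₂ ⟨ht₂, hf₂, hnew, hkeep⟩
    simp only [Store.real_putNat, f1, f5, hc] at hnew hkeep
    refine ⟨by omega, ?_⟩
    constructor
    · simp [hf₂.nat 15 rfl, f15, hidx]
    · simp [hf₂.nat 16 rfl, hf₂.nat 0 rfl, f16, hpt, f0, hd]
      ring
    · simp [hf₂.nat 17 rfl, hg, f17, hnum]
    · simp [hf₂.nat 18 rfl, hg, f18, hanc, f0, hd]
      ring
    · intro p hp
      simp only [Store.real_putNat]
      rw [hkeep p (.inl (by omega)), hold p hp]
    · intro l' hl' a ha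
      simp only [Store.real_putNat]
      rcases Nat.le_succ_iff.1 hl' with hl' | rfl
      · rw [hkeep, hpts l' hl' a ha]
        left
        -- An earlier anchor has a smaller number, so its slot ends before the slot just written.
        have h1 : (greedy d k ρ c l').1 ≤ (greedy d k ρ c l).1 := greedy_fst_mono d k ρ c hl'
        rw [hg]
        have h2 := Nat.mul_le_mul_right d h1
        rw [add_mul]
        omega
      · rw [hnew a ha, hg]
  · intro h
    have h' : ¬ (ρ < sqd d (c l) (c (greedy d k ρ c l).2) ∧ (greedy d k ρ c l).1 + 1 < k) := by
      simpa [f9, hρ, hdist, f17, hnum, f0, hk] using h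
    have hg : greedy d k ρ c (l + 1) = greedy d k ρ c l := by
      rw [greedy, if_neg h']
    simp only [Prog.wp_seq, Prog.wp_setNat, Prog.wp_skip]
    refine ⟨by omega, ?_⟩
    constructor
    · simp [f15, hidx]
    · simp [f16, hpt, f0, hd]
      ring
    · simp [hg, f17, hnum]
    · simp [hg, f18, hanc]
    · intro p hp
      simp only [Store.real_putNat]
      rw [f5, hold p hp]
    · intro l' hl' a ha
      simp only [Store.real_putNat]
      rw [f5]
      rcases Nat.le_succ_iff.1 hl' with hl' | rfl
      · exact hpts l' hl' a ha
      · rw [hg]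
        exact hpts l le_rfl a ha

/-- Each curve receives `k` anchor slots, even if it has fewer anchors. Unused slots can only add
candidates, which are checked like all others. Variable `16` is not reset, as it runs through the
points of all curves consecutively. -/
def greedyCurve : Prog :=
  .setNat 18 0 (nv 20) ;;
  .setNat 17 0 0 ;;
  copyPoint ;;
  .setNat 15 0 0 ;;
  .while (.natLt (nv 15) (.get 0 1)) greedyPoint ;;
  .setNat 20 0 (nv 20 + .get 2 2) ;;
  .setNat 14 0 (nv 14 + 1)

theorem greedyCurve_spec {s : Store} {m d k : ℕ} {ρ : ℝ} {b x : ℕ} (hm : s.nat 0 1 = m)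
    (hd : s.nat 0 2 = d) (hk : s.nat 0 3 = k) (hρ : s.real 9 1 = ρ)
    (hb : s.nat 16 0 = b) (hx : s.nat 20 0 = x) :
    greedyCurve.wp s fun t s' => t ≤ m * (6 * d + 11) + 3 * d + 8 ∧ greedyCurve.Frame s s' ∧
      s'.nat 14 0 = s.nat 14 0 + 1 ∧ s'.nat 16 0 = b + m * d ∧ s'.nat 20 0 = x + s.nat 2 2 ∧
      (∀ p < x, s'.real 5 p = s.real 5 p) ∧ ∀ l ≤ m, ∀ a < d,
        s'.real 5 (x + (greedy d k ρ (fun l a => s.real 1 (b + l * d + a)) l).1 * d + a) =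
        s.real 1 (b + (greedy d k ρ (fun l a => s.real 1 (b + l * d + a)) l).2 * d + a) := by
  suffices H : greedyCurve.wp s fun t s' => t ≤ m * (6 * d + 11) + 3 * d + 8 ∧
      s'.nat 14 0 = s.nat 14 0 + 1 ∧ s'.nat 16 0 = b + m * d ∧ s'.nat 20 0 = x + s.nat 2 2 ∧
      (∀ p < x, s'.real 5 p = s.real 5 p) ∧ ∀ l ≤ m, ∀ a < d,
        s'.real 5 (x + (greedy d k ρ (fun l a => s.real 1 (b + l * d + a)) l).1 * d + a) =
        s.real 1 (b + (greedy d k ρ (fun l a => s.real 1 (b + l * d + a)) l).2 * d + a) by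
    obtain ⟨t, s', hr, ht, h⟩ := H
    exact ⟨t, s', hr, ht, hr.frame, h⟩
  unfold greedyCurve
  simp only [Prog.wp_seq, Prog.wp_setNat]
  refine (copyPoint_spec (d := d) (x := x) (b := b) (by simp [hd]) (by simp [hx])
    (by simp [hb])).mono ?_
  rintro t₁ s₁ ⟨ht₁, hf₁, hnew, hkeep⟩
  simp only [Store.real_putNat] at hnew hkeep
  have f0 : s₁.nat 0 = s.nat 0 := by rw [hf₁.nat 0 rfl]; funext; simp
  have f1 : s₁.real 1 = s.real 1 := by rw [hf₁.real 1 rfl]; funext; simp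
  have f9 : s₁.real 9 = s.real 9 := by rw [hf₁.real 9 rfl]; funext; simp
  refine (Prog.wp_for (GreedyInv s (fun l a => s.real 1 (b + l * d + a)) d k ρ b x) m (6 * d + 10) ?_ ?_ ?_).mono ?_
  · constructor
    · simp
    · simp [hf₁.nat 16 rfl, hb]
    · simp [hf₁.nat 17 rfl, greedy]
    · simp [hf₁.nat 18 rfl, greedy, hx]
    · intro p hp
      simp only [Store.real_putNat]
      exact hkeep p (.inl hp)
    · intro l' hl' a ha
      obtain rfl : l' = 0 := by omega
      simpa [greedy] using hnew a ha
  · intro l s' hf hl I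
    simp [I.idx, hf.nat 0 rfl, f0, hm]
  · intro l s' hf hl I
    refine greedyPoint_spec ?_ ?_ ?_ ?_ I
    · simp [hf.nat 0 rfl, f0, hd]
    · simp [hf.nat 0 rfl, f0, hk]
    · simp [hf.real 9 rfl, f9, hρ]
    · simp [hf.real 1 rfl, f1]
  · rintro t₂ s₂ ⟨ht₂, hf₂, I⟩
    refine ⟨?_, ?_, ?_, ?_, ?_, ?_⟩
    · rw [show 6 * d + 10 + 1 = 6 * d + 11 from rfl] at ht₂
      omega
    · simp [hf₂.nat 14 rfl, hf₁.nat 14 rfl]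
    · simp [I.pt]
    · simp [hf₂.nat 20 rfl, hf₂.nat 2 rfl, hf₁.nat 2 rfl, hf₁.nat 20 rfl, hx]
    · simpa using I.old
    · simpa using I.pts

/-- Write the anchors of all curves to the real array `5`. -/
def greedyProg : Prog :=
  .setNat 14 0 0 ;; .setNat 16 0 0 ;; .setNat 20 0 0 ;;
  .while (.natLt (nv 14) (.get 0 0)) greedyCurve

theorem greedyProg_spec {s : Store} {n m d k : ℕ} {ρ : ℝ} (hn : s.nat 0 0 = n)
    (hm : s.nat 0 1 = m) (hd : s.nat 0 2 = d) (hk : s.nat 0 3 = k) (h22 : s.nat 2 2 = k * d)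
    (hρ : s.real 9 1 = ρ) (hk1 : 1 ≤ k) :
    greedyProg.wp s fun t s' => t ≤ n * (m * (6 * d + 11) + 3 * d + 9) + 4 ∧
      greedyProg.Frame s s' ∧ s'.nat 20 0 = n * (k * d) ∧
      ∀ i < n, ∀ l ≤ m, ∀ a < d,
        s'.real 5 (i * (k * d) +
          (greedy d k ρ (fun l a => s.real 1 (i * (m * d) + l * d + a)) l).1 * d + a) =
        s.real 1 (i * (m * d) +
          (greedy d k ρ (fun l a => s.real 1 (i * (m * d) + l * d + a)) l).2 * d + a) := by
  suffices H : greedyProg.wp s fun t s' => t ≤ n * (m * (6 * d + 11) + 3 * d + 9) + 4 ∧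
      s'.nat 20 0 = n * (k * d) ∧
      ∀ i < n, ∀ l ≤ m, ∀ a < d,
        s'.real 5 (i * (k * d) +
          (greedy d k ρ (fun l a => s.real 1 (i * (m * d) + l * d + a)) l).1 * d + a) =
        s.real 1 (i * (m * d) +
          (greedy d k ρ (fun l a => s.real 1 (i * (m * d) + l * d + a)) l).2 * d + a) by
    obtain ⟨t, s', hr, ht, h⟩ := H
    exact ⟨t, s', hr, ht, hr.frame, h⟩
  unfold greedyProg
  simp only [Prog.wp_seq, Prog.wp_setNat]
  refine (Prog.wp_for (fun i s' => s'.nat 14 0 = i ∧ s'.nat 16 0 = i * (m * d) ∧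
    s'.nat 20 0 = i * (k * d) ∧ ∀ i' < i, ∀ l ≤ m, ∀ a < d,
        s'.real 5 (i' * (k * d) +
          (greedy d k ρ (fun l a => s.real 1 (i' * (m * d) + l * d + a)) l).1 * d + a) =
        s.real 1 (i' * (m * d) +
          (greedy d k ρ (fun l a => s.real 1 (i' * (m * d) + l * d + a)) l).2 * d + a)) n
      (m * (6 * d + 11) + 3 * d + 8) ?_ ?_ ?_).mono ?_
  · simp
  · rintro i s' hf - ⟨h, -⟩
    simp [h, hf.nat 0 rfl, hn]
  · rintro i s' hf hi ⟨h14, h16, h20, hX⟩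
    have f1 : s'.real 1 = s.real 1 := by rw [hf.real 1 rfl]; funext; simp
    have f2 : s'.nat 2 2 = k * d := by rw [hf.nat 2 rfl]; simp [h22]
    refine (greedyCurve_spec (m := m) (d := d) (k := k) (ρ := ρ) ?_ ?_ ?_ ?_ h16 h20).mono ?_
    · simp [hf.nat 0 rfl, hm]
    · simp [hf.nat 0 rfl, hd]
    · simp [hf.nat 0 rfl, hk]
    · simp [hf.real 9 rfl, hρ]
    rintro t s'' ⟨ht, -, g14, g16, g20, hold, hnew⟩
    rw [f1] at hnew
    refine ⟨ht, by omega, by rw [g16]; ring, by rw [g20, f2]; ring, ?_⟩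
    intro i' hi' l hl a ha
    rcases Nat.lt_succ_iff_lt_or_eq.1 hi' with hi' | rfl
    · rw [hold, hX i' hi' l hl a ha]
      have h1 := greedy_fst_lt (d := d) hk1 ρ
        (fun l a => s.real 1 (i' * (m * d) + l * d + a)) l
      have h2 := Nat.mul_le_mul_right d (Nat.succ_le_of_lt h1)
      have h3 := Nat.mul_le_mul_right (k * d) (Nat.succ_le_of_lt hi')
      rw [Nat.succ_mul] at h2 h3
      omega
    · exact hnew l hl a ha
  · rintro t s' ⟨ht, -, -, -, h20, hX⟩
    refine ⟨?_, h20, hX⟩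
    rw [show m * (6 * d + 11) + 3 * d + 8 + 1 = m * (6 * d + 11) + 3 * d + 9 from rfl] at ht
    omega

/-! ### The grid -/

/-- Copy the anchors from the real array `5` to the real array `3`. -/
def copyAnchors : Prog :=
  .setNat 2 1 (nv 20) ;;
  .setNat 18 0 0 ;;
  .while (.natLt (nv 18) (.get 2 1))
    (.setReal 3 (nv 18) (.get 5 (nv 18)) ;; .setNat 18 0 (nv 18 + 1))

/-- The copy gets sorted. The original order is still needed to find the cell of a given anchor
coordinate by its address. -/
theorem copyAnchors_spec {s : Store} {N : ℕ} (hN : s.nat 20 0 = N) :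
    copyAnchors.wp s fun t s' => t ≤ 3 * N + 3 ∧ copyAnchors.Frame s s' ∧
      s'.nat 2 1 = N ∧ (∀ i, i ≠ 1 → s'.nat 2 i = s.nat 2 i) ∧
      ∀ p < N, s'.real 3 p = s.real 5 p := by
  suffices H : copyAnchors.wp s fun t s' => t ≤ 3 * N + 3 ∧
      s'.nat 2 1 = N ∧ (∀ i, i ≠ 1 → s'.nat 2 i = s.nat 2 i) ∧
      ∀ p < N, s'.real 3 p = s.real 5 p by
    obtain ⟨t, s', hr, ht, h⟩ := H
    exact ⟨t, s', hr, ht, hr.frame, h⟩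
  unfold copyAnchors
  simp only [Prog.wp_seq, Prog.wp_setNat]
  refine (Prog.wp_for (fun c s' => s'.nat 18 0 = c ∧ ∀ p < c, s'.real 3 p = s.real 5 p) N 2
    ?_ ?_ ?_).mono ?_
  · simp
  · rintro i s' hf - ⟨h, -⟩
    simp [h, hf.nat 2 rfl, hN]
  · rintro i s' hf hi ⟨h, h1⟩
    have e5 : s'.real 5 = s.real 5 := by rw [hf.real 5 rfl]; funext; simp
    simp only [Prog.wp_seq, Prog.wp_setReal, Prog.wp_setNat]
    refine ⟨le_rfl, by simp [h], ?_⟩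
    intro p hp
    simp [h, e5]
    split_ifs with h'
    · rw [h']
    · exact h1 p (by omega)
  · rintro t s' ⟨ht, hf, -, h1⟩
    refine ⟨by omega, by simp [hf.nat 2 rfl, hN], ?_, h1⟩
    intro i hi
    simp [hf.nat 2 rfl, hi]

/-- The interval `[a, b]` is covered by consecutive cells of width `δ`. -/
def Covered (T : ℕ → ℝ) (len : ℕ) (δ a b : ℝ) : Prop :=
  ∃ u v, u ≤ v ∧ v < len ∧ T u ≤ a ∧ b ≤ T v ∧ ∀ i, u ≤ i → i < v → T (i + 1) = T i + δ

theorem Covered.mono {T T' : ℕ → ℝ} {len len' : ℕ} {δ a b : ℝ} (h : Covered T len δ a b)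
    (hl : len ≤ len') (hT : ∀ i < len, T' i = T i) : Covered T' len' δ a b := by
  obtain ⟨u, v, huv, hv, ha, hb, hc⟩ := h
  refine ⟨u, v, huv, by omega, by rwa [hT u (by omega)], by rwa [hT v hv], fun i h1 h2 => ?_⟩
  rw [hT _ (by omega), hT i (by omega), hc i h1 h2]

theorem SortedTo.push {T : ℕ → ℝ} {len : ℕ} {v : ℝ} (h : SortedTo T len)
    (hv : len ≠ 0 → T (len - 1) ≤ v) : SortedTo (fun i => if i = len then v else T i) (len + 1) := by
  intro i j hij hj
  dsimp only
  rcases Nat.lt_succ_iff_lt_or_eq.1 hj with hj | rfl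
  · rw [if_neg (by omega), if_neg (by omega)]
    exact h i j hij hj
  · rw [if_pos rfl]
    split_ifs with hi
    · exact le_rfl
    · exact (h i (j - 1) (by omega) (by omega)).trans (hv (by omega))

/-! ### Sweeping over the sorted anchor coordinates -/

def sweepRun : Prog :=
  .while (.realLt (.get 2 (nv 2 - 1)) (.get 3 (nv 18) + .get 9 2))
    (.setReal 2 (nv 2) (.get 2 (nv 2 - 1) + rv 4) ;; .setNat 2 0 (nv 2 + 1))

/-- The last breakpoint starts at or above `x - R` and rises by `δ` in each round, and rounds take
place only while it is below `x + R`. With `2R ≤ Sδ` there are thus at most `S` rounds. -/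
structure RunInv (s : Store) (δ R x : ℝ) (u j : ℕ) (s' : Store) : Prop where
  len : s'.nat 2 0 = s.nat 2 0 + j
  other : ∀ i, i ≠ 0 → s'.nat 2 i = s.nat 2 i
  sorted : SortedTo (s'.real 2) (s'.nat 2 0)
  last : x - R + j * δ ≤ s'.real 2 (s'.nat 2 0 - 1)
  chain : ∀ i, u ≤ i → i < s'.nat 2 0 - 1 → s'.real 2 (i + 1) = s'.real 2 i + δ
  old : ∀ i < s.nat 2 0, s'.real 2 i = s.real 2 i

theorem sweepRun_spec {s : Store} {δ R x : ℝ} {u S : ℕ} (hx : s.real 3 (s.nat 18 0) = x)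
    (hR : s.real 9 2 = R) (hδ : s.real 4 0 = δ) (hδ0 : 0 < δ) (hS : 2 * R ≤ S * δ)
    (hso : SortedTo (s.real 2) (s.nat 2 0)) (hu : u < s.nat 2 0) (hux : s.real 2 u ≤ x - R)
    (hlast : x - R ≤ s.real 2 (s.nat 2 0 - 1))
    (hch : ∀ i, u ≤ i → i < s.nat 2 0 - 1 → s.real 2 (i + 1) = s.real 2 i + δ) :
    sweepRun.wp s fun t s' => t ≤ 3 * S + 1 ∧ sweepRun.Frame s s' ∧
      s.nat 2 0 ≤ s'.nat 2 0 ∧ s'.nat 2 0 ≤ s.nat 2 0 + S ∧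
      (∀ i, i ≠ 0 → s'.nat 2 i = s.nat 2 i) ∧ SortedTo (s'.real 2) (s'.nat 2 0) ∧
      Covered (s'.real 2) (s'.nat 2 0) δ (x - R) (x + R) ∧
      (∀ i, u ≤ i → i < s'.nat 2 0 - 1 → s'.real 2 (i + 1) = s'.real 2 i + δ) ∧
      ∀ i < s.nat 2 0, s'.real 2 i = s.real 2 i := by
  unfold sweepRun
  refine (Prog.wp_while (RunInv s δ R x u) S 2 ?_ ?_).mono ?_
  · exact ⟨rfl, fun _ _ => rfl, hso, by simpa using hlast, hch, fun _ _ => rfl⟩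
  · rintro j s' hf I hb
    obtain ⟨hlen, hoth, hso', hla, hch', hold⟩ := I
    have e3 : s'.real 3 = s.real 3 := hf.real 3 rfl
    have e4 : s'.real 4 = s.real 4 := hf.real 4 rfl
    have e9 : s'.real 9 = s.real 9 := hf.real 9 rfl
    have e18 : s'.nat 18 = s.nat 18 := hf.nat 18 rfl
    have hb' : s'.real 2 (s'.nat 2 0 - 1) < x + R := by
      simpa [e3, e9, e18, hx, hR] using hb
    constructor
    · have h1 : (j : ℝ) * δ < S * δ := by linarith
      exact_mod_cast lt_of_mul_lt_mul_right h1 hδ0.le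
    simp only [Prog.wp_seq, Prog.wp_setNat, Prog.wp_setReal]
    refine ⟨le_rfl, ?_⟩
    have hne : s'.nat 2 0 ≠ 0 := by omega
    have h2 : (fun i => if i = s'.nat 2 0 then s'.real 2 (s'.nat 2 0 - 1) + δ else s'.real 2 i) =
      (s'.putReal 2 (s'.nat 2 0) (s'.real 2 (s'.nat 2 0 - 1) + δ)).real 2 := by
      funext i; simp
    constructor <;> simp [e4, hδ]
    · omega
    · intro i hi
      rw [if_neg hi, hoth i hi]
    · rw [← h2]
      exact hso'.push fun _ => by linarith
    · linarith
    · intro i hi hil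
      rw [if_neg (show i ≠ s'.nat 2 0 by omega)]
      split_ifs with h
      · rw [← h]
        rfl
      · exact hch' i hi (by omega)
    · intro i hi
      rw [if_neg (by omega), hold i hi]
  · rintro t s' ⟨ht, hf, hb, j, hj, I⟩
    obtain ⟨hlen, hoth, hso', hla, hch', hold⟩ := I
    have hb' : x + R ≤ s'.real 2 (s'.nat 2 0 - 1) := by
      simpa [hf.real 3 rfl, hf.real 9 rfl, hf.nat 18 rfl, hx, hR] using hb
    refine ⟨by omega, ⟨hf.nat, hf.real⟩, by omega, by omega, hoth, hso', ?_, hch', hold⟩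
    exact ⟨u, s'.nat 2 0 - 1, by omega, by omega, by rw [hold u hu]; exact hux, hb', hch'⟩

/-- Compute the sorted table of breakpoints from the sorted anchor coordinates. -/
def sweepProg : Prog :=
  .setNat 18 0 0 ;;
  .while (.natLt (nv 18) (.get 2 1))
    (.ite (.conj (.natLt 0 (nv 2)) (.realLe (.get 3 (nv 18) - .get 9 2) (.get 2 (nv 2 - 1)))) .skip
      (.setReal 2 (nv 2) (.get 3 (nv 18) - .get 9 2) ;; .setNat 2 0 (nv 2 + 1)) ;;
    sweepRun ;;
    .setNat 18 0 (nv 18 + 1))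

/-- `run` says that the current stretch of equidistant breakpoints began at or before the left end
of the last interval treated. Since the anchors are sorted, it also began before the left end of the
next one, which can therefore continue the same stretch whenever the stretch reaches it. -/
structure SweepInv (s : Store) (δ R : ℝ) (S p : ℕ) (s' : Store) : Prop where
  idx : s'.nat 18 0 = p
  other : ∀ i, i ≠ 0 → s'.nat 2 i = s.nat 2 i
  sorted : SortedTo (s'.real 2) (s'.nat 2 0)
  len : s'.nat 2 0 ≤ p * (S + 1)
  covered : ∀ p' < p, Covered (s'.real 2) (s'.nat 2 0) δ (s.real 3 p' - R) (s.real 3 p' + R)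
  run : s'.nat 2 0 ≠ 0 → ∃ u < s'.nat 2 0, p ≠ 0 ∧ s'.real 2 u ≤ s.real 3 (p - 1) - R ∧
    ∀ i, u ≤ i → i < s'.nat 2 0 - 1 → s'.real 2 (i + 1) = s'.real 2 i + δ

/-- Overlapping intervals share one stretch of grid, and a new stretch begins only at a gap.
Superposing a separate grid for each anchor would create cells narrower than `δ`, and the number of
cells between two numbers would no longer be controlled by their distance. Each anchor contributes
at most one starting point and `S` steps. -/
theorem sweepProg_spec {s : Store} {δ R : ℝ} {N S : ℕ} (h0 : s.nat 2 0 = 0) (hN : s.nat 2 1 = N)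
    (hR : s.real 9 2 = R) (hδ : s.real 4 0 = δ) (hδ0 : 0 < δ)
    (hS : 2 * R ≤ S * δ) (hso : SortedTo (s.real 3) N) :
    sweepProg.wp s fun t s' => t ≤ N * (3 * S + 6) + 2 ∧ sweepProg.Frame s s' ∧
      (∀ i, i ≠ 0 → s'.nat 2 i = s.nat 2 i) ∧ SortedTo (s'.real 2) (s'.nat 2 0) ∧
      s'.nat 2 0 ≤ N * (S + 1) ∧
      ∀ p < N, Covered (s'.real 2) (s'.nat 2 0) δ (s.real 3 p - R) (s.real 3 p + R) := by
  suffices H : sweepProg.wp s fun t s' => t ≤ N * (3 * S + 6) + 2 ∧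
      (∀ i, i ≠ 0 → s'.nat 2 i = s.nat 2 i) ∧ SortedTo (s'.real 2) (s'.nat 2 0) ∧
      s'.nat 2 0 ≤ N * (S + 1) ∧
      ∀ p < N, Covered (s'.real 2) (s'.nat 2 0) δ (s.real 3 p - R) (s.real 3 p + R) by
    obtain ⟨t, s', hr, ht, h⟩ := H
    exact ⟨t, s', hr, ht, hr.frame, h⟩
  unfold sweepProg
  simp only [Prog.wp_seq, Prog.wp_setNat]
  refine (Prog.wp_for (SweepInv s δ R S) N (3 * S + 5) ?_ ?_ ?_).mono ?_
  · constructor <;> simp [h0]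
    intro i j _ hj
    omega
  · rintro p s' hf - I
    simp [I.idx, I.other, hN]
  · rintro p s' hf hp I
    obtain ⟨hidx, hoth, hso', hlen, hcov, hrun⟩ := I
    have e3 : s'.real 3 = s.real 3 := by rw [hf.real 3 rfl]; rfl
    have e4 : s'.real 4 0 = δ := by rw [hf.real 4 rfl]; exact hδ
    have e9 : s'.real 9 2 = R := by rw [hf.real 9 rfl]; exact hR
    simp only [Prog.wp_seq]
    apply Prog.wp_ite
    · intro hb
      have hb' : s'.nat 2 0 ≠ 0 ∧ s.real 3 p - R ≤ s'.real 2 (s'.nat 2 0 - 1) := by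
        simpa [e3, e9, hidx, Nat.pos_iff_ne_zero] using hb
      obtain ⟨hne, hge⟩ := hb'
      obtain ⟨u, hu, hp0, hux, hch⟩ := hrun hne
      -- Sortedness of the anchors moves the bound from the previous left end to this one.
      have hux' : s'.real 2 u ≤ s.real 3 p - R := by
        have := hso (p - 1) p (by omega) hp
        linarith
      simp only [Prog.wp_skip]
      refine (sweepRun_spec (x := s.real 3 p) (by rw [hidx, e3]) e9 e4 hδ0 hS hso' hu hux' hge
        hch).mono ?_
      rintro t s'' ⟨ht, hf', hl1, hl2, ho, hs'', hc'', hch'', hold⟩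
      simp only [Prog.wp_setNat]
      refine ⟨by omega, ?_⟩
      constructor <;> simp
      · rw [hf'.nat 18 rfl, hidx]
      · intro i hi
        rw [ho i hi, hoth i hi]
      · exact hs''
      · rw [add_mul]
        omega
      · intro p' hp'
        rcases Nat.lt_or_eq_of_le hp' with hp' | rfl
        · exact (hcov p' hp').mono hl1 hold
        · exact hc''
      · intro _
        exact ⟨u, by omega, by rw [hold u hu]; exact hux', hch''⟩
    · intro hb
      have hb' : s'.nat 2 0 ≠ 0 → s'.real 2 (s'.nat 2 0 - 1) < s.real 3 p - R := by
        simpa [e3, e9, hidx, Nat.pos_iff_ne_zero, lt_sub_iff_add_lt] using hb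
      simp only [Prog.wp_seq, Prog.wp_setNat, Prog.wp_setReal]
      have h2 : (fun i => if i = s'.nat 2 0 then s.real 3 p - R else s'.real 2 i) =
          (s'.putReal 2 (s'.nat 2 0) (s.real 3 p - R)).real 2 := by
        funext i; simp
      refine (sweepRun_spec (x := s.real 3 p) (δ := δ) (R := R) (u := s'.nat 2 0) (S := S)
        ?_ ?_ ?_ hδ0 hS ?_ ?_ ?_ ?_ ?_).mono ?_
      · simp [e3, hidx]
      · simp [e9]
      · simp [e4]
      · simp only [Store.real_putNat, NatExp.eval_nv, RealExp.eval_sub, RealExp.eval_get, e3, hidx,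
          e9, NatExp.eval_two, ← h2]
        simpa using hso'.push fun h => (hb' h).le
      · simp
      · simp [e3, e9, hidx]
      · simp [e3, e9, hidx]
      · intro i h1 h3
        simp at h3
        omega
      rintro t s'' ⟨ht, hf', hl1, hl2, ho, hs'', hc'', hch'', hold⟩
      simp at hl1 hl2 ho hold
      refine ⟨by omega, ?_⟩
      constructor <;> simp
      · rw [hf'.nat 18 rfl]
        simp [hidx]
      · intro i hi
        rw [ho i hi, if_neg hi, hoth i hi]
      · exact hs''
      · rw [add_mul]
        omega
      · intro p' hp'
        rcases Nat.lt_or_eq_of_le hp' with hp' | rfl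
        · refine (hcov p' hp').mono (by omega) fun i hi => ?_
          rw [hold i (by omega), if_neg (by omega)]
        · exact hc''
      · intro _
        refine ⟨s'.nat 2 0, by omega, ?_, hch''⟩
        rw [hold _ (by omega), if_pos rfl, hidx, e3, e9]
  · rintro t s' ⟨ht, hf, I⟩
    refine ⟨?_, I.other, I.sorted, I.len, I.covered⟩
    rw [show 3 * S + 5 + 1 = 3 * S + 6 from rfl] at ht
    omega

/-- Locate every anchor coordinate in the table of breakpoints. -/
def locateAll : Prog :=
  .setNat 18 0 0 ;;
  .while (.natLt (nv 18) (.get 2 1))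
    (.setReal 6 0 (.get 5 (nv 18)) ;;
    locateProg 2 0 ;;
    .setNat 7 (nv 18) (nv 8) ;;
    .setNat 18 0 (nv 18 + 1))

theorem locateAll_spec {s : Store} {N : ℕ} (hN : s.nat 2 1 = N)
    (hso : SortedTo (s.real 2) (s.nat 2 0)) :
    locateAll.wp s fun t s' => t ≤ N * (4 * Nat.log 2 (s.nat 2 0) + 11) + 2 ∧ locateAll.Frame s s' ∧
      ∀ p < N, IsCut (s.real 2) (s.nat 2 0) (s.real 5 p) (s'.nat 7 p) := by
  suffices H : locateAll.wp s fun t s' => t ≤ N * (4 * Nat.log 2 (s.nat 2 0) + 11) + 2 ∧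
      ∀ p < N, IsCut (s.real 2) (s.nat 2 0) (s.real 5 p) (s'.nat 7 p) by
    obtain ⟨t, s', hr, ht, h⟩ := H
    exact ⟨t, s', hr, ht, hr.frame, h⟩
  unfold locateAll
  simp only [Prog.wp_seq, Prog.wp_setNat]
  refine (Prog.wp_for (fun c s' => s'.nat 18 0 = c ∧
    ∀ p < c, IsCut (s.real 2) (s.nat 2 0) (s.real 5 p) (s'.nat 7 p)) N
    (4 * Nat.log 2 (s.nat 2 0) + 10) ?_ ?_ ?_).mono ?_
  · simp
  · rintro i s' hf - ⟨h, -⟩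
    simp [h, hf.nat 2 rfl, hN]
  · rintro i s' hf hi ⟨h, h1⟩
    have e5 : s'.real 5 = s.real 5 := by rw [hf.real 5 rfl]; rfl
    have e2 : s'.real 2 = s.real 2 := by rw [hf.real 2 rfl]; rfl
    have e20 : s'.nat 2 0 = s.nat 2 0 := by rw [hf.nat 2 rfl]; simp
    simp only [Prog.wp_seq, Prog.wp_setReal, Prog.wp_setNat]
    refine (locateProg_spec (n := s.nat 2 0) (by simp [e20]) ?_).mono ?_
    · intro a b
      simpa [e2] using hso a b
    rintro t s'' ⟨ht, hf', hcut⟩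
    have f18 : s''.nat 18 0 = i := by rw [hf'.nat 18 rfl]; simp [h]
    have f7 : s''.nat 7 = s'.nat 7 := by rw [hf'.nat 7 rfl]; simp
    have hcut' : IsCut (s.real 2) (s.nat 2 0) (s.real 5 i) (s''.nat 8 0) := by
      have e : (s'.putReal 6 (NatExp.eval s' 0) (RealExp.eval s' (.get 5 (nv 18)))).real 2 =
        s.real 2 := by funext; simp [e2]
      rw [e] at hcut
      simpa [h, e5] using hcut
    refine ⟨by omega, by simp [f18], ?_⟩
    intro p hp
    simp [f18, f7]
    split_ifs with h'
    · rw [h']; exact hcut'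
    · exact h1 p (by omega)
  · rintro t s' ⟨ht, -, -, h1⟩
    refine ⟨?_, h1⟩
    rw [show 4 * Nat.log 2 (s.nat 2 0) + 10 + 1 = 4 * Nat.log 2 (s.nat 2 0) + 11 from rfl] at ht
    omega

/-! ### The search tree of candidate cells -/

/-- The data on which the search for candidates depends: the numbers of the input, the sorted table
`T` of `len` breakpoints, the positions `Z` of the anchor coordinates in it, the coordinates `C` of
the input curves, the squared distance threshold `ρ`, and the budget `W`. -/
structure Ctx where
  (n m d k len W : ℕ)
  T : ℕ → ℝ
  Z : ℕ → ℕ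
  C : ℕ → ℝ
  ρ : ℝ

namespace Ctx
variable (G : Ctx)

/-- Coordinate `a` of point `l` of curve `i`. -/
def pt (i l a : ℕ) : ℝ := G.C (i * (G.m * G.d) + l * G.d + a)

/-- The base of the positional system in which sequences of cells are encoded. -/
def base : ℕ := G.len + G.W + 1

/-- The key of a sequence of cells (latest cell first). -/
def key : List ℕ → ℝ
  | [] => 0
  | z :: zs => key zs * (G.base : ℝ) + z

/-- The squared distances, accumulated over the coordinates of the current point of the candidate,
to the points of the curve `i`. -/
def rowD (i : ℕ) : List ℕ → ℕ → ℝ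
  | [], _ => 0
  | z :: zs, l =>
    if zs.length % G.d + 1 = G.d then 0
    else rowD i zs l + (G.T (z - 1) - G.pt i l (zs.length % G.d)) *
      (G.T (z - 1) - G.pt i l (zs.length % G.d))

end Ctx

/-- A row of the dynamic program for the decision problem of the discrete Fréchet distance, shifted
by one, from the previous row `H` and the closeness predicate `P`. -/
def nextRow (P H : ℕ → Prop) : ℕ → Prop
  | 0 => False
  | l + 1 => P l ∧ (H (l + 1) ∨ H l ∨ nextRow P H l)

namespace Ctx
variable (G : Ctx)

/-- The row of the dynamic program after the completed points of the candidate. -/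
def rowH (i : ℕ) : List ℕ → ℕ → Prop
  | [], l => l = 0
  | z :: zs, l =>
    if zs.length % G.d + 1 = G.d then
      nextRow (fun l => G.rowD i zs l + (G.T (z - 1) - G.pt i l (zs.length % G.d)) *
        (G.T (z - 1) - G.pt i l (zs.length % G.d)) ≤ G.ρ) (rowH i zs) l
    else rowH i zs l

end Ctx

/-- A node of the search tree. The candidate belongs to curve `cur`; the cells of its first
coordinates are `zs` (latest first), its current point is assigned to anchor `e`, and `b` is the
remaining budget. The kind is `0` between two coordinates, and `1` or `3` while the cell `z` of the
next coordinate moves up or down. -/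
structure Node where
  kind : ℕ
  cur : ℕ
  zs : List ℕ
  e : ℕ
  b : ℕ
  z : ℕ

namespace Ctx
variable (G : Ctx)

/-- The position in the table of the next coordinate of the current anchor. -/
def anchorCell (x : Node) : ℕ := G.Z (x.cur * (G.k * G.d) + x.e * G.d + x.zs.length % G.d)

/-- The children of a node. -/
def children (x : Node) : List Node :=
  if x.kind = 0 then
    if x.zs.length = G.k * G.d then []
    else [{ x with kind := 1, z := G.anchorCell x }, { x with kind := 3, z := G.anchorCell x }] ++
      if x.e + 1 < G.k then [{ x with e := x.e + 1, z := G.anchorCell x }] else []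
  else
    -- The difference `2 - kind` is `1` for kind `1` and `-1` for kind `3`. Truncation keeps a
    -- downward move at cell `0`, which does no harm.
    (if 0 < x.b then [{ x with b := x.b - 1, z := x.z + 2 - x.kind }] else []) ++
      [{ x with kind := 0, zs := x.z :: x.zs }]

open Classical in
/-- The entries of the dictionary that a node contributes. -/
def output (x : Node) : List (ℝ × ℕ) :=
  if x.kind = 0 ∧ x.zs.length = G.k * G.d ∧ G.rowH x.cur x.zs G.m then [(G.key x.zs, x.cur)] else []

/-- The root for curve `i`. -/
def root (i : ℕ) : Node := ⟨0, i, [], 0, G.W, 0⟩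

/-- A child made by a move does not increase `z + b` unless the cell is already `0` and moves down,
in which case the cell stays put and the budget drops. An upward move raises `z` by one and spends
one unit. So committed cells never exceed `len + W`, as the uniqueness of keys requires. -/
structure Valid (x : Node) : Prop where
  cur_lt : x.cur < G.n
  e_lt : x.e < G.k
  len_le : x.zs.length ≤ G.k * G.d
  digits : ∀ z ∈ x.zs, z ≤ G.len + G.W
  b_le : x.b ≤ G.W
  dir : x.kind = 0 ∨
    (x.kind = 1 ∨ x.kind = 3) ∧ x.zs.length < G.k * G.d ∧ x.z + x.b ≤ G.len + G.W

variable {G}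

theorem valid_root {i : ℕ} (hi : i < G.n) (hk : 1 ≤ G.k) : G.Valid (G.root i) :=
  ⟨hi, hk, by simp [root], by simp [root], le_rfl, .inl rfl⟩

theorem Valid.anchor_lt {x : Node} (h : G.Valid x) (hd : 1 ≤ G.d) :
    x.cur * (G.k * G.d) + x.e * G.d + x.zs.length % G.d < G.n * (G.k * G.d) := by
  have h1 := Nat.mul_le_mul_right G.d (Nat.succ_le_of_lt h.e_lt)
  have h2 := Nat.mul_le_mul_right (G.k * G.d) (Nat.succ_le_of_lt h.cur_lt)
  have h3 := Nat.mod_lt x.zs.length hd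
  rw [Nat.succ_mul] at h1 h2
  omega

theorem Valid.children {x y : Node} (h : G.Valid x) (hd : 1 ≤ G.d)
    (hZ : ∀ p < G.n * (G.k * G.d), G.Z p ≤ G.len) (hy : y ∈ G.children x) : G.Valid y := by
  have hz := hZ _ (h.anchor_lt hd)
  obtain ⟨h1, h2, h3, h4, h5, h6⟩ := h
  unfold Ctx.children at hy
  split_ifs at hy with hk hl he hb
  · simp at hy
  · simp only [List.cons_append, List.nil_append, List.mem_cons, List.not_mem_nil, or_false] at hy
    rcases hy with rfl | rfl | rfl
    · exact ⟨h1, h2, h3, h4, h5, .inr ⟨.inl rfl, lt_of_le_of_ne h3 hl, add_le_add hz h5⟩⟩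
    · exact ⟨h1, h2, h3, h4, h5, .inr ⟨.inr rfl, lt_of_le_of_ne h3 hl, add_le_add hz h5⟩⟩
    · exact ⟨h1, he, h3, h4, h5, .inl hk⟩
  · simp only [List.cons_append, List.nil_append, List.mem_cons, List.not_mem_nil, or_false] at hy
    rcases hy with rfl | rfl
    · exact ⟨h1, h2, h3, h4, h5, .inr ⟨.inl rfl, lt_of_le_of_ne h3 hl, add_le_add hz h5⟩⟩
    · exact ⟨h1, h2, h3, h4, h5, .inr ⟨.inr rfl, lt_of_le_of_ne h3 hl, add_le_add hz h5⟩⟩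
  · obtain ⟨h7, h8, h9⟩ := h6.resolve_left hk
    simp only [List.cons_append, List.nil_append, List.mem_cons, List.not_mem_nil, or_false] at hy
    rcases hy with rfl | rfl
    · refine ⟨h1, h2, h3, h4, (Nat.sub_le _ _).trans h5, .inr ⟨h7, h8, ?_⟩⟩
      dsimp only
      omega
    · refine ⟨h1, h2, h8, ?_, h5, .inl rfl⟩
      intro z hz
      rcases List.mem_cons.1 hz with rfl | hz
      · omega
      · exact h4 z hz
  · obtain ⟨h7, h8, h9⟩ := h6.resolve_left hk
    simp only [List.nil_append, List.mem_cons, List.not_mem_nil, or_false] at hy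
    subst hy
    refine ⟨h1, h2, h8, ?_, h5, .inl rfl⟩
    intro z hz
    rcases List.mem_cons.1 hz with rfl | hz
    · omega
    · exact h4 z hz

/-! ### The size of the search tree -/

variable (G)

/-- A bound for the number of descendants of a node. -/
def pot (ε : ℝ) (x : Node) : ℝ :=
  if x.kind = 0 then 2 ^ (G.k - 1 - x.e) * (18 / ε) ^ (G.k * G.d - x.zs.length) * (1 + ε) ^ x.b
  else 2 ^ (G.k - 1 - x.e) * (18 / ε) ^ (G.k * G.d - x.zs.length - 1) * (1 + ε) ^ x.b * (4 / ε)

variable {G}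

theorem pot_nonneg {ε : ℝ} (hε : 0 < ε) (x : Node) : 0 ≤ G.pot ε x := by
  unfold pot
  split_ifs <;> positivity

/-- Each factor of the potential is at least one, so a unit can be set aside for the node itself.
Between coordinates, in units of `1/ε` times the value with one coordinate less, the two directions
take `4` each and the next anchor `9`, together `17` out of `18`. For a moving cell, one unit of
budget lowers `(1 + ε)^b · 4/ε` by `4 (1 + ε)^(b-1)`; this pays for the committed child, of weight
at most `2 (1 + ε)^(b-1)`, and for the node. -/
theorem pot_children {ε : ℝ} (hε : 0 < ε) (hε1 : ε ≤ 1) {x : Node} (h : G.Valid x) :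
    1 + ((G.children x).map (G.pot ε)).sum ≤ G.pot ε x := by
  obtain ⟨h1, h2, h3, h4, h5, h6⟩ := h
  have hinv : 1 ≤ 1 / ε := by rw [le_div_iff₀ hε]; linarith
  have hK : 1 ≤ 18 / ε := by
    rw [le_div_iff₀ hε]; linarith
  have hA : ∀ a b c : ℕ, (1 : ℝ) ≤ 2 ^ a * (18 / ε) ^ b * (1 + ε) ^ c := by
    intro a b c
    have i1 : (1 : ℝ) ≤ 2 ^ a := one_le_pow₀ (by norm_num)
    have i2 : (1 : ℝ) ≤ (18 / ε) ^ b := one_le_pow₀ hK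
    have i3 : (1 : ℝ) ≤ (1 + ε) ^ c := one_le_pow₀ (by linarith)
    calc (1 : ℝ) = 1 * 1 * 1 := by norm_num
      _ ≤ _ := by gcongr
  unfold children
  split_ifs with hk hl he hb
  · simp only [List.map_nil, List.sum_nil, add_zero, pot, hk, if_true]
    exact hA _ _ _
  · obtain ⟨q, hq⟩ : ∃ q, G.k * G.d - x.zs.length = q + 1 := ⟨G.k * G.d - x.zs.length - 1, by omega⟩
    obtain ⟨a, ha⟩ : ∃ a, G.k - 1 - x.e = a + 1 := ⟨G.k - 1 - x.e - 1, by omega⟩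
    have ha' : G.k - 1 - (x.e + 1) = a := by omega
    simp [pot, hk, hq, ha, ha']
    have := hA a q x.b
    set Y := (2 : ℝ) ^ a * (18 / ε) ^ q * (1 + ε) ^ x.b with hY
    have e1 : (2 : ℝ) ^ (a + 1) * (18 / ε) ^ q * (1 + ε) ^ x.b * (4 / ε) = Y * (8 * (1 / ε)) := by
      rw [hY]; ring
    have e2 : (2 : ℝ) ^ (a + 1) * (18 / ε) ^ (q + 1) * (1 + ε) ^ x.b = Y * (36 * (1 / ε)) := by
      rw [hY]; ring
    have e3 : (2 : ℝ) ^ a * (18 / ε) ^ (q + 1) * (1 + ε) ^ x.b = Y * (18 * (1 / ε)) := by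
      rw [hY]; ring
    rw [e1, e2, e3]
    nlinarith [mul_nonneg (by linarith : (0 : ℝ) ≤ Y) (by linarith : (0 : ℝ) ≤ 1 / ε - 1)]
  · obtain ⟨q, hq⟩ : ∃ q, G.k * G.d - x.zs.length = q + 1 := ⟨G.k * G.d - x.zs.length - 1, by omega⟩
    simp [pot, hk, hq]
    have := hA (G.k - 1 - x.e) q x.b
    set Y := (2 : ℝ) ^ (G.k - 1 - x.e) * (18 / ε) ^ q * (1 + ε) ^ x.b with hY
    have e2 : (2 : ℝ) ^ (G.k - 1 - x.e) * (18 / ε) ^ (q + 1) * (1 + ε) ^ x.b =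
      Y * (18 * (1 / ε)) := by
      rw [hY]; ring
    have e1 : Y * (4 / ε) = Y * (4 * (1 / ε)) := by ring
    rw [e1, e2]
    nlinarith [mul_nonneg (by linarith : (0 : ℝ) ≤ Y) (by linarith : (0 : ℝ) ≤ 1 / ε - 1)]
  · obtain ⟨h7, h8, h9⟩ := h6.resolve_left hk
    have hq : G.k * G.d - (x.zs.length + 1) = G.k * G.d - x.zs.length - 1 := by omega
    obtain ⟨b, hb'⟩ : ∃ b, x.b = b + 1 := ⟨x.b - 1, by omega⟩
    simp [pot, hk, hq, hb']
    set q := G.k * G.d - x.zs.length - 1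
    have h0 := hA (G.k - 1 - x.e) q b
    set Y := (2 : ℝ) ^ (G.k - 1 - x.e) * (18 / ε) ^ q * (1 + ε) ^ b with hY
    have e1 : (2 : ℝ) ^ (G.k - 1 - x.e) * (18 / ε) ^ q * (1 + ε) ^ (b + 1) = Y * (1 + ε) := by
      rw [hY]; ring
    -- The first summand is the potential of the child that moves on; `4Y` covers the committed
    -- child `Y (1 + ε) ≤ 2Y` and the node itself.
    have e2 : Y * (1 + ε) * (4 / ε) = Y * (4 / ε) + 4 * Y := by
      field_simp
    rw [e1, e2]
    nlinarith
  · obtain ⟨h7, h8, h9⟩ := h6.resolve_left hk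
    have hq : G.k * G.d - (x.zs.length + 1) = G.k * G.d - x.zs.length - 1 := by omega
    simp [pot, hk, hq]
    have h0 := hA (G.k - 1 - x.e) (G.k * G.d - x.zs.length - 1) x.b
    set Y := (2 : ℝ) ^ (G.k - 1 - x.e) * (18 / ε) ^ (G.k * G.d - x.zs.length - 1) *
      (1 + ε) ^ x.b with hY
    have e1 : Y * (4 / ε) = Y * (4 * (1 / ε)) := by ring
    rw [e1]
    nlinarith [mul_nonneg (by linarith : (0 : ℝ) ≤ Y) (by linarith : (0 : ℝ) ≤ 1 / ε - 1)]

/-- Positional notation is unique when all digits are below the base. The base exceeds `len + W` and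
not merely `len`, because a moving cell can leave the table at the top by as much as the budget
allows. -/
theorem key_injective {zs zs' : List ℕ} (hl : zs.length = zs'.length)
    (hz : ∀ z ∈ zs, z ≤ G.len + G.W) (hz' : ∀ z ∈ zs', z ≤ G.len + G.W)
    (h : G.key zs = G.key zs') : zs = zs' := by
  let f : List ℕ → ℕ := fun l => l.foldr (fun z y => y * G.base + z) 0
  have hf : ∀ l, G.key l = f l := by
    intro l
    induction l with
    | nil => simp [key, f]
    | cons z l ih => simp [key, f, ih]
  rw [hf, hf, Nat.cast_inj] at h
  induction zs generalizing zs' with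
  | nil =>
    cases zs' with
    | nil => rfl
    | cons _ _ => simp at hl
  | cons z zs ih =>
    cases zs' with
    | nil => simp at hl
    | cons z' zs' =>
      have b1 : z < G.base := Nat.lt_succ_of_le (hz z (by simp))
      have b2 : z' < G.base := Nat.lt_succ_of_le (hz' z' (by simp))
      have h' : f zs * G.base + z = f zs' * G.base + z' := h
      have hpos : 0 < G.base := by omega
      have e1 : z = z' := by
        have := congrArg (· % G.base) h'
        simpa [Nat.add_mod, Nat.mod_eq_of_lt, b1, b2] using this
      have e2 : f zs = f zs' := by
        rw [e1] at h'
        exact Nat.eq_of_mul_eq_mul_right hpos (Nat.add_right_cancel h')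
      rw [e1, ih (by simpa using hl) (fun z h => hz z (List.mem_cons_of_mem _ h))
        (fun z h => hz' z (List.mem_cons_of_mem _ h)) e2]

end Ctx

/-! ### The search program -/

/-- The machine representation of a node. -/
structure Item where
  (kind cur cb zp adv b rem a row z : ℕ)
  key : ℝ

/-- Entry `u` of the queue. -/
def Store.item (s : Store) (u : ℕ) : Item :=
  ⟨s.nat 30 u, s.nat 31 u, s.nat 32 u, s.nat 33 u, s.nat 34 u, s.nat 35 u, s.nat 36 u, s.nat 37 u,
    s.nat 38 u, s.nat 39 u, s.real 11 u⟩

/-- The node held in the registers. -/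
def Store.regs (s : Store) : Item :=
  ⟨s.nat 50 0, s.nat 51 0, s.nat 52 0, s.nat 53 0, s.nat 54 0, s.nat 55 0, s.nat 56 0, s.nat 57 0,
    s.nat 58 0, s.nat 59 0, s.real 14 0⟩

namespace Ctx
variable (G : Ctx)

/-- The item `it` represents the node `x`; `D` and `H` are the arrays of rows, filled up to `rt`. -/
structure Rep (D : ℕ → ℝ) (H : ℕ → ℕ) (rt : ℕ) (it : Item) (x : Node) : Prop where
  kind : it.kind = x.kind
  cur : it.cur = x.cur
  cb : it.cb = x.cur * (G.m * G.d)
  zp : it.zp = x.cur * (G.k * G.d) + x.e * G.d + x.zs.length % G.d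
  adv : it.adv = G.k - 1 - x.e
  b : it.b = x.b
  rem : it.rem = G.k * G.d - x.zs.length
  a : it.a = x.zs.length % G.d
  z : it.z = x.z
  key : it.key = G.key x.zs
  row_le : it.row + G.m + 1 ≤ rt
  rowD : ∀ l < G.m, D (it.row + l) = G.rowD x.cur x.zs l
  rowH : ∀ l ≤ G.m, 0 < H (it.row + l) ↔ G.rowH x.cur x.zs l

variable {G}

/-- Rows are only ever appended, so queue entries remain meaningful while the search proceeds, and
several nodes can refer to the same row. -/
theorem Rep.mono {D D' : ℕ → ℝ} {H H' : ℕ → ℕ} {rt rt' : ℕ} {it : Item} {x : Node}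
    (h : G.Rep D H rt it x) (hrt : rt ≤ rt') (hD : ∀ p < rt, D' p = D p)
    (hH : ∀ p < rt, H' p = H p) : G.Rep D' H' rt' it x := by
  have hr := h.row_le
  refine ⟨h.kind, h.cur, h.cb, h.zp, h.adv, h.b, h.rem, h.a, h.z, h.key, by omega, ?_, ?_⟩
  · intro l hl
    rw [hD _ (by omega), h.rowD l hl]
  · intro l hl
    rw [hH _ (by omega), h.rowH l hl]

variable (G)

/-- The memory holds the data of the search. -/
structure Holds (s : Store) : Prop where
  m : s.nat 0 1 = G.m
  d : s.nat 0 2 = G.d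
  base : s.nat 2 3 = G.base
  T : s.real 2 = G.T
  Z : s.nat 7 = G.Z
  C : s.real 1 = G.C
  ρ : s.real 9 0 = G.ρ

variable {G}

theorem Holds.congr {s s' : Store} (h : G.Holds s) (h0 : s'.nat 0 = s.nat 0)
    (h2 : s'.nat 2 = s.nat 2) (h7 : s'.nat 7 = s.nat 7) (r1 : s'.real 1 = s.real 1)
    (r2 : s'.real 2 = s.real 2) (r9 : s'.real 9 = s.real 9) : G.Holds s' :=
  ⟨by rw [h0, h.m], by rw [h0, h.d], by rw [h2, h.base], by rw [r2, h.T], by rw [h7, h.Z],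
    by rw [r1, h.C], by rw [r9, h.ρ]⟩

end Ctx

/-- Load the node at the head of the queue into the registers. -/
def loadProg : Prog :=
  .setNat 50 0 (.get 30 (nv 21)) ;; .setNat 51 0 (.get 31 (nv 21)) ;;
  .setNat 52 0 (.get 32 (nv 21)) ;; .setNat 53 0 (.get 33 (nv 21)) ;;
  .setNat 54 0 (.get 34 (nv 21)) ;; .setNat 55 0 (.get 35 (nv 21)) ;;
  .setNat 56 0 (.get 36 (nv 21)) ;; .setNat 57 0 (.get 37 (nv 21)) ;;
  .setNat 58 0 (.get 38 (nv 21)) ;; .setNat 59 0 (.get 39 (nv 21)) ;;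
  .setReal 14 0 (.get 11 (nv 21))

theorem loadProg_spec {s : Store} {u : ℕ} (hu : s.nat 21 0 = u) :
    loadProg.wp s fun t s' => t = 11 ∧ loadProg.Frame s s' ∧ s'.regs = s.item u := by
  suffices H : loadProg.wp s fun t s' => t = 11 ∧ s'.regs = s.item u by
    obtain ⟨t, s', hr, ht, h⟩ := H
    exact ⟨t, s', hr, ht, hr.frame, h⟩
  simp [loadProg, Store.regs, Store.item, hu]

/-- Append the node in the registers to the queue. -/
def pushProg : Prog :=
  .setNat 30 (nv 22) (nv 50) ;; .setNat 31 (nv 22) (nv 51) ;; .setNat 32 (nv 22) (nv 52) ;;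
  .setNat 33 (nv 22) (nv 53) ;; .setNat 34 (nv 22) (nv 54) ;; .setNat 35 (nv 22) (nv 55) ;;
  .setNat 36 (nv 22) (nv 56) ;; .setNat 37 (nv 22) (nv 57) ;; .setNat 38 (nv 22) (nv 58) ;;
  .setNat 39 (nv 22) (nv 59) ;; .setReal 11 (nv 22) (rv 14) ;; .setNat 22 0 (nv 22 + 1)

theorem pushProg_spec {s : Store} {q : ℕ} (hq : s.nat 22 0 = q) :
    pushProg.wp s fun t s' => t = 12 ∧ pushProg.Frame s s' ∧ s'.nat 22 0 = q + 1 ∧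
      s'.item q = s.regs ∧ ∀ u, u ≠ q → s'.item u = s.item u := by
  suffices H : pushProg.wp s fun t s' => t = 12 ∧ s'.nat 22 0 = q + 1 ∧
      s'.item q = s.regs ∧ ∀ u, u ≠ q → s'.item u = s.item u by
    obtain ⟨t, s', hr, ht, h⟩ := H
    exact ⟨t, s', hr, ht, hr.frame, h⟩
  simp [pushProg, Store.regs, Store.item, hq]
  intro u hu
  simp [hu]

/-- Starting from the memory `s₀`, the nodes `ys` have been appended to the queue. -/
structure Pushed (G : Ctx) (s₀ : Store) (ys : List Node) (s : Store) : Prop where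
  tail : s.nat 22 0 = s₀.nat 22 0 + ys.length
  old : ∀ u < s₀.nat 22 0, s.item u = s₀.item u
  new : ∀ (q : ℕ) (h : q < ys.length),
    G.Rep (s.real 12) (s.nat 40) (s.nat 23 0) (s.item (s₀.nat 22 0 + q)) ys[q]
  rows : s₀.nat 23 0 ≤ s.nat 23 0
  oldD : ∀ p < s₀.nat 23 0, s.real 12 p = s₀.real 12 p
  oldH : ∀ p < s₀.nat 23 0, s.nat 40 p = s₀.nat 40 p

theorem Pushed.nil (G : Ctx) (s₀ : Store) : Pushed G s₀ [] s₀ :=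
  ⟨rfl, fun _ _ => rfl, fun _ h => absurd h (Nat.not_lt_zero _), le_rfl, fun _ _ => rfl,
    fun _ _ => rfl⟩

theorem Pushed.grow {G : Ctx} {s₀ s s' : Store} {ys : List Node} (h : Pushed G s₀ ys s)
    (ht : s'.nat 22 0 = s.nat 22 0) (hi : s'.item = s.item) (hr : s.nat 23 0 ≤ s'.nat 23 0)
    (hD : ∀ p < s.nat 23 0, s'.real 12 p = s.real 12 p)
    (hH : ∀ p < s.nat 23 0, s'.nat 40 p = s.nat 40 p) : Pushed G s₀ ys s' := by
  refine ⟨by rw [ht, h.tail], fun u hu => by rw [hi, h.old u hu], fun q hq => ?_,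
    h.rows.trans hr, fun p hp => ?_, fun p hp => ?_⟩
  · rw [hi]
    exact (h.new q hq).mono hr hD hH
  · rw [hD p (hp.trans_le h.rows), h.oldD p hp]
  · rw [hH p (hp.trans_le h.rows), h.oldH p hp]

theorem Store.item_congr {s s' : Store} (h30 : s'.nat 30 = s.nat 30) (h31 : s'.nat 31 = s.nat 31)
    (h32 : s'.nat 32 = s.nat 32) (h33 : s'.nat 33 = s.nat 33) (h34 : s'.nat 34 = s.nat 34)
    (h35 : s'.nat 35 = s.nat 35) (h36 : s'.nat 36 = s.nat 36) (h37 : s'.nat 37 = s.nat 37)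
    (h38 : s'.nat 38 = s.nat 38) (h39 : s'.nat 39 = s.nat 39) (h11 : s'.real 11 = s.real 11) :
    s'.item = s.item := by
  funext u
  simp [Store.item, *]

theorem pushProg_pushed {G : Ctx} {s₀ s : Store} {ys : List Node} {y : Node}
    (h : Pushed G s₀ ys s) (hy : G.Rep (s.real 12) (s.nat 40) (s.nat 23 0) s.regs y) :
    pushProg.wp s fun t s' => t = 12 ∧ pushProg.Frame s s' ∧ Pushed G s₀ (ys ++ [y]) s' := by
  refine (pushProg_spec h.tail).mono ?_
  rintro t s' ⟨ht, hf, htail, hnew, hold⟩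
  have f12 : s'.real 12 = s.real 12 := hf.real 12 rfl
  have f40 : s'.nat 40 = s.nat 40 := hf.nat 40 rfl
  have f23 : s'.nat 23 = s.nat 23 := hf.nat 23 rfl
  refine ⟨ht, hf, ⟨by simp [htail, add_assoc], fun u hu => ?_, fun q hq => ?_, ?_, ?_, ?_⟩⟩
  · rw [hold u (by omega), h.old u hu]
  · rw [f12, f40, f23]
    rcases Nat.lt_or_ge q ys.length with hq' | hq'
    · rw [hold _ (by omega), List.getElem_append_left hq']
      exact h.new q hq'
    · obtain rfl : q = ys.length := by
        simp at hq
        omega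
      rw [hnew]
      simpa using hy
  · rw [f23]; exact h.rows
  · rw [f12]; exact h.oldD
  · rw [f40]; exact h.oldH

/-! #### Extending the rows by one coordinate -/

/-- The old row starts at address `58`, the new one at the free address `23`. Reachability rows are
shifted by one, so point `l` owns entry `l + 1`, and its three predecessors in the dynamic program
are the entries `58 + l + 1`, `58 + l` and `23 + l`. Testing that their sum is positive expresses
the disjunction. -/
def rowBody : Prog :=
  .setReal 13 0 (.get 12 (nv 58 + nv 24) + (.get 2 (nv 59 - 1) - .get 1 (nv 25)) *
    (.get 2 (nv 59 - 1) - .get 1 (nv 25))) ;;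
  .ite (.natLe (.get 0 2) (nv 57 + 1))
    (.setReal 12 (nv 23 + nv 24) 0 ;;
    .ite (.conj (.realLe (rv 13) (rv 9)) (.natLe 1 (.get 40 (nv 58 + nv 24 + 1) +
        .get 40 (nv 58 + nv 24) + .get 40 (nv 23 + nv 24))))
      (.setNat 40 (nv 23 + nv 24 + 1) 1) (.setNat 40 (nv 23 + nv 24 + 1) 0))
    (.setReal 12 (nv 23 + nv 24) (rv 13) ;;
    .setNat 40 (nv 23 + nv 24 + 1) (.get 40 (nv 58 + nv 24 + 1))) ;;
  .setNat 25 0 (nv 25 + .get 0 2) ;;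
  .setNat 24 0 (nv 24 + 1)

def rowProg : Prog :=
  .setNat 24 0 0 ;;
  .setNat 25 0 (nv 52 + nv 57) ;;
  .ite (.natLe (.get 0 2) (nv 57 + 1)) (.setNat 40 (nv 23) 0)
    (.setNat 40 (nv 23) (.get 40 (nv 58))) ;;
  .while (.natLt (nv 24) (.get 0 1)) rowBody

structure RowInv (G : Ctx) (s : Store) (x : Node) (l : ℕ) (s' : Store) : Prop where
  idx : s'.nat 24 0 = l
  pt : s'.nat 25 0 = x.cur * (G.m * G.d) + l * G.d + x.zs.length % G.d
  oldD : ∀ p < s.nat 23 0, s'.real 12 p = s.real 12 p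
  oldH : ∀ p < s.nat 23 0, s'.nat 40 p = s.nat 40 p
  rowD : ∀ l' < l, s'.real 12 (s.nat 23 0 + l') = G.rowD x.cur (x.z :: x.zs) l'
  rowH : ∀ l' ≤ l, 0 < s'.nat 40 (s.nat 23 0 + l') ↔ G.rowH x.cur (x.z :: x.zs) l'

theorem rowBody_spec {G : Ctx} {s s' : Store} {x : Node} {l : ℕ} (hG : G.Holds s)
    (hd : 1 ≤ G.d) (hx : G.Rep (s.real 12) (s.nat 40) (s.nat 23 0) s.regs x)
    (hf : rowBody.Frame s s') (hl : l < G.m) (I : RowInv G s x l s') :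
    rowBody.wp s' fun t s'' => t ≤ 7 ∧ RowInv G s x (l + 1) s'' := by
  obtain ⟨hidx, hpt, hoD, hoH, hrD, hrH⟩ := I
  have hmod := Nat.mod_lt x.zs.length hd
  have f0 : s'.nat 0 2 = G.d := by rw [hf.nat 0 rfl, hG.d]
  have f23 : s'.nat 23 = s.nat 23 := hf.nat 23 rfl
  have f57 : s'.nat 57 0 = x.zs.length % G.d := by rw [hf.nat 57 rfl]; exact hx.a
  have f59 : s'.nat 59 0 = x.z := by rw [hf.nat 59 rfl]; exact hx.z
  have f58 : s'.nat 58 0 = s.nat 58 0 := by rw [hf.nat 58 rfl]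
  have f1 : s'.real 1 = G.C := by rw [hf.real 1 rfl, hG.C]
  have f2 : s'.real 2 = G.T := by rw [hf.real 2 rfl, hG.T]
  have f9 : s'.real 9 0 = G.ρ := by rw [hf.real 9 rfl, hG.ρ]
  have hrow : s.nat 58 0 + G.m + 1 ≤ s.nat 23 0 := hx.row_le
  have hD : s'.real 12 (s.nat 58 0 + l) = G.rowD x.cur x.zs l := by
    rw [hoD _ (by omega)]
    exact hx.rowD l hl
  have hH : ∀ l ≤ G.m, 0 < s'.nat 40 (s.nat 58 0 + l) ↔ G.rowH x.cur x.zs l := by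
    intro l hl
    rw [hoH _ (by omega)]
    exact hx.rowH l hl
  have hH1 := hH (l + 1) hl
  have hH0 := hH l hl.le
  rw [← add_assoc] at hH1
  have hN := hrH l le_rfl
  set v := G.rowD x.cur x.zs l + (G.T (x.z - 1) - G.pt x.cur l (x.zs.length % G.d)) *
      (G.T (x.z - 1) - G.pt x.cur l (x.zs.length % G.d)) with hv
  have hpt' : G.C (x.cur * (G.m * G.d) + l * G.d + x.zs.length % G.d) =
    G.pt x.cur l (x.zs.length % G.d) := rfl
  -- All three branches write one entry of each row; only the value of the new entry has to be
  -- checked for each branch.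
  have key : ∀ (s'' : Store), s''.nat 24 0 = l + 1 → s''.nat 25 0 = s'.nat 25 0 + G.d →
      (∀ p, p ≠ s.nat 23 0 + l → s''.real 12 p = s'.real 12 p) →
      (∀ p, p ≠ s.nat 23 0 + l + 1 → s''.nat 40 p = s'.nat 40 p) →
      s''.real 12 (s.nat 23 0 + l) = G.rowD x.cur (x.z :: x.zs) l →
      (0 < s''.nat 40 (s.nat 23 0 + l + 1) ↔ G.rowH x.cur (x.z :: x.zs) (l + 1)) →
      RowInv G s x (l + 1) s'' := by
    intro s'' k1 k2 k3 k4 k5 k6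
    refine ⟨k1, by rw [k2, hpt]; ring, ?_, ?_, ?_, ?_⟩
    · intro p hp
      rw [k3 p (by omega), hoD p hp]
    · intro p hp
      rw [k4 p (by omega), hoH p hp]
    · intro l' hl'
      rcases Nat.lt_succ_iff_lt_or_eq.1 hl' with hl' | rfl
      · rw [k3 _ (by omega), hrD l' hl']
      · exact k5
    · intro l' hl'
      rcases Nat.le_succ_iff.1 hl' with hl' | rfl
      · rw [k4 _ (by omega), hrH l' hl']
      · exact k6
  unfold rowBody
  simp only [Prog.wp_seq, Prog.wp_setReal]
  apply Prog.wp_ite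
  · intro h
    have h' : x.zs.length % G.d + 1 = G.d := by
      have : G.d ≤ x.zs.length % G.d + 1 := by simpa [f0, f57] using h
      omega
    simp only [Prog.wp_seq, Prog.wp_setReal]
    apply Prog.wp_ite
    · intro hc
      have hc' : v ≤ G.ρ ∧ 1 ≤ s'.nat 40 (s.nat 58 0 + l + 1) + s'.nat 40 (s.nat 58 0 + l) +
          s'.nat 40 (s.nat 23 0 + l) := by
        simpa [f9, f58, f23, hidx, f2, f1, f59, hpt, hpt', hD, hv] using hc
      simp only [Prog.wp_setNat]
      refine ⟨by norm_num, key _ ?_ ?_ ?_ ?_ ?_ ?_⟩ <;> simp [hidx, f23, f0]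
      · intro p hp1 hp2
        exact absurd hp2 hp1
      · intro p hp1 hp2
        exact absurd hp2 hp1
      · simp [Ctx.rowD, h']
      · rw [Ctx.rowH, if_pos h', nextRow]
        refine ⟨hc'.1, ?_⟩
        rw [Ctx.rowH, if_pos h'] at hN
        rw [← hH1, ← hH0, ← hN]
        omega
    · intro hc
      have hc' : ¬ (v ≤ G.ρ ∧ 1 ≤ s'.nat 40 (s.nat 58 0 + l + 1) + s'.nat 40 (s.nat 58 0 + l) +
          s'.nat 40 (s.nat 23 0 + l)) := by
        simpa [f9, f58, f23, hidx, f2, f1, f59, hpt, hpt', hD, hv] using hc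
      simp only [Prog.wp_setNat]
      refine ⟨by norm_num, key _ ?_ ?_ ?_ ?_ ?_ ?_⟩ <;> simp [hidx, f23, f0]
      · intro p hp1 hp2
        exact absurd hp2 hp1
      · intro p hp1 hp2
        exact absurd hp2 hp1
      · simp [Ctx.rowD, h']
      · rw [Ctx.rowH, if_pos h', nextRow]
        rw [Ctx.rowH, if_pos h'] at hN
        rw [← hH1, ← hH0, ← hN]
        intro hh
        apply hc'
        exact ⟨hh.1, by omega⟩
  · intro h
    have h' : ¬ x.zs.length % G.d + 1 = G.d := by
      have : x.zs.length % G.d + 1 < G.d := by simpa [f0, f57] using h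
      omega
    simp only [Prog.wp_seq, Prog.wp_setNat, Prog.wp_setReal]
    refine ⟨by norm_num, key _ ?_ ?_ ?_ ?_ ?_ ?_⟩ <;> simp [hidx, f23, f0]
    · intro p hp1 hp2
      exact absurd hp2 hp1
    · intro p hp1 hp2
      exact absurd hp2 hp1
    · simp [Ctx.rowD, h', f58, f2, f1, f59, hpt, hpt', hD]
    · rw [Ctx.rowH, if_neg h', f58, hH1]

theorem rowProg_spec {G : Ctx} {s : Store} {x : Node} (hG : G.Holds s)
    (hd : 1 ≤ G.d) (hx : G.Rep (s.real 12) (s.nat 40) (s.nat 23 0) s.regs x) :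
    rowProg.wp s fun t s' => t ≤ 8 * G.m + 5 ∧ rowProg.Frame s s' ∧
      (∀ p < s.nat 23 0, s'.real 12 p = s.real 12 p) ∧
      (∀ p < s.nat 23 0, s'.nat 40 p = s.nat 40 p) ∧
      (∀ l < G.m, s'.real 12 (s.nat 23 0 + l) = G.rowD x.cur (x.z :: x.zs) l) ∧
      ∀ l ≤ G.m, 0 < s'.nat 40 (s.nat 23 0 + l) ↔ G.rowH x.cur (x.z :: x.zs) l := by
  suffices H : rowProg.wp s fun t s' => t ≤ 8 * G.m + 5 ∧
      (∀ p < s.nat 23 0, s'.real 12 p = s.real 12 p) ∧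
      (∀ p < s.nat 23 0, s'.nat 40 p = s.nat 40 p) ∧
      (∀ l < G.m, s'.real 12 (s.nat 23 0 + l) = G.rowD x.cur (x.z :: x.zs) l) ∧
      ∀ l ≤ G.m, 0 < s'.nat 40 (s.nat 23 0 + l) ↔ G.rowH x.cur (x.z :: x.zs) l by
    obtain ⟨t, s', hr, ht, h⟩ := H
    exact ⟨t, s', hr, ht, hr.frame, h⟩
  have hmod := Nat.mod_lt x.zs.length hd
  have h52 : s.nat 52 0 = x.cur * (G.m * G.d) := hx.cb
  have h57 : s.nat 57 0 = x.zs.length % G.d := hx.a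
  have hrow : s.nat 58 0 + G.m + 1 ≤ s.nat 23 0 := hx.row_le
  have hloop : ∀ s₁ : Store, rowProg.Frame s s₁ → RowInv G s x 0 s₁ →
      (Prog.while (.natLt (nv 24) (.get 0 1)) rowBody).wp s₁ fun t s' => t ≤ G.m * 8 + 1 ∧
        RowInv G s x G.m s' := by
    intro s₁ hf₁ I₁
    refine (Prog.wp_for (RowInv G s x) G.m 7 I₁ ?_ ?_).mono ?_
    · intro l s' hf _ I
      simp [I.idx, hf.nat 0 rfl, hf₁.nat 0 rfl, hG.m]
    · intro l s' hf hl I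
      refine rowBody_spec hG hd hx ⟨fun y hy => ?_, fun y hy => ?_⟩ hl I
      · rw [hf.nat y hy, hf₁.nat y]
        simp only [rowBody, Prog.writesNat, Bool.or_eq_false_iff, beq_eq_false_iff_ne, rowProg] at hy ⊢
        tauto
      · rw [hf.real y hy, hf₁.real y]
        simp only [rowBody, Prog.writesReal, Bool.or_eq_false_iff, beq_eq_false_iff_ne,
          rowProg] at hy ⊢
        tauto
    · rintro t s' ⟨ht, -, I⟩
      exact ⟨ht, I⟩
  have hfr : ∀ v w u : ℕ, rowProg.Frame s (((s.putNat 24 0 v).putNat 25 0 w).putNat 40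
      (s.nat 23 0) u) := by
    intro v w u
    refine ⟨fun y hy => ?_, fun y hy => rfl⟩
    simp only [rowBody, Prog.writesNat, Bool.or_eq_false_iff, beq_eq_false_iff_ne, rowProg] at hy
    rw [Store.nat_putNat_of_ne _ (by tauto), Store.nat_putNat_of_ne _ (by tauto),
      Store.nat_putNat_of_ne _ (by tauto)]
  unfold rowProg
  simp only [Prog.wp_seq, Prog.wp_setNat]
  apply Prog.wp_ite
  · intro h
    have h' : x.zs.length % G.d + 1 = G.d := by
      have : G.d ≤ x.zs.length % G.d + 1 := by simpa [hG.d, h57] using h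
      omega
    simp only [Prog.wp_setNat]
    refine (hloop _ (hfr _ _ _) ?_).mono ?_
    · constructor <;> simp [h52, h57]
      · intro p hp hp'
        omega
      · simp [Ctx.rowH, h', nextRow]
    · rintro t s' ⟨ht, I⟩
      exact ⟨by omega, I.oldD, I.oldH, I.rowD, I.rowH⟩
  · intro h
    have h' : ¬ x.zs.length % G.d + 1 = G.d := by
      have : x.zs.length % G.d + 1 < G.d := by simpa [hG.d, h57] using h
      omega
    simp only [Prog.wp_setNat]
    refine (hloop _ (hfr _ _ _) ?_).mono ?_
    · constructor <;> simp [h52, h57]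
      · intro p hp hp'
        omega
      · rw [Ctx.rowH, if_neg h']
        exact hx.rowH 0 (Nat.zero_le _)
    · rintro t s' ⟨ht, I⟩
      exact ⟨by omega, I.oldD, I.oldH, I.rowD, I.rowH⟩

/-! #### Processing one node -/

/-- Integers on the machine have neither products nor remainders, so coordinate numbers and
addresses are updated incrementally. The two remainder lemmas justify the reset at the end of a
point and the increment otherwise. -/
theorem succ_mod_of_eq {a d : ℕ} (h : a % d + 1 = d) : (a + 1) % d = 0 := by
  have h1 := Nat.mod_add_div a d
  have h2 : a + 1 = d * (a / d + 1) := by rw [mul_add]; omega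
  rw [h2, Nat.mul_mod_right]

theorem succ_mod_of_ne {a d : ℕ} (hd : 0 < d) (h : a % d + 1 ≠ d) : (a + 1) % d = a % d + 1 := by
  have h1 := Nat.mod_add_div a d
  have h3 := Nat.mod_lt a hd
  conv_lhs => rw [← h1, show a % d + d * (a / d) + 1 = d * (a / d) + (a % d + 1) by ring]
  rw [Nat.mul_add_mod, Nat.mod_eq_of_lt (by omega)]

def commitProg : Prog :=
  rowProg ;;
  .setNat 58 0 (nv 23) ;;
  .setNat 23 0 (nv 23 + .get 0 1 + 1) ;;
  .setNat 50 0 0 ;;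
  .setReal 14 0 (rv 14 * .ofNat (.get 2 3) + .ofNat (nv 59)) ;;
  .setNat 56 0 (nv 56 - 1) ;;
  .ite (.natLe (.get 0 2) (nv 57 + 1))
    -- The address returns to the first coordinate of the same anchor, since the next point may use
    -- this anchor again. Adding before subtracting avoids truncation.
    (.setNat 57 0 0 ;; .setNat 53 0 (nv 53 + 1 - .get 0 2))
    (.setNat 57 0 (nv 57 + 1) ;; .setNat 53 0 (nv 53 + 1)) ;;
  pushProg

theorem commitProg_spec {G : Ctx} {s₀ s : Store} {ys : List Node} {x : Node} (hG : G.Holds s)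
    (hd : 1 ≤ G.d) (hP : Pushed G s₀ ys s)
    (hx : G.Rep (s.real 12) (s.nat 40) (s.nat 23 0) s.regs x) :
    commitProg.wp s fun t s' => t ≤ 8 * G.m + 25 ∧ commitProg.Frame s s' ∧
      Pushed G s₀ (ys ++ [{ x with kind := 0, zs := x.z :: x.zs }]) s' := by
  suffices H : commitProg.wp s fun t s' => t ≤ 8 * G.m + 25 ∧
      Pushed G s₀ (ys ++ [{ x with kind := 0, zs := x.z :: x.zs }]) s' by
    obtain ⟨t, s', hr, ht, h⟩ := H
    exact ⟨t, s', hr, ht, hr.frame, h⟩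
  have hmod := Nat.mod_lt x.zs.length hd
  unfold commitProg
  rw [Prog.wp_seq]
  refine (rowProg_spec hG hd hx).mono ?_
  rintro t₁ s₁ ⟨ht₁, hf₁, hoD, hoH, hrD, hrH⟩
  obtain ⟨hkind, hcur, hcb, hzp, hadv, hb, hrem, ha, hz, hkey, hrow, -, -⟩ := hx
  simp only [Store.regs] at hkind hcur hcb hzp hadv hb hrem ha hz hkey hrow
  have hP₁ : Pushed G s₀ ys s₁ := by
    refine hP.grow (by rw [hf₁.nat 22 rfl]) ?_ (by rw [hf₁.nat 23 rfl]) hoD hoH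
    apply Store.item_congr <;> first | exact hf₁.nat _ rfl | exact hf₁.real _ rfl
  have f0 : s₁.nat 0 = s.nat 0 := hf₁.nat 0 rfl
  have f2 : s₁.nat 2 = s.nat 2 := hf₁.nat 2 rfl
  have f23 : s₁.nat 23 = s.nat 23 := hf₁.nat 23 rfl
  have f51 : s₁.nat 51 = s.nat 51 := hf₁.nat 51 rfl
  have f52 : s₁.nat 52 = s.nat 52 := hf₁.nat 52 rfl
  have f53 : s₁.nat 53 = s.nat 53 := hf₁.nat 53 rfl
  have f54 : s₁.nat 54 = s.nat 54 := hf₁.nat 54 rfl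
  have f55 : s₁.nat 55 = s.nat 55 := hf₁.nat 55 rfl
  have f56 : s₁.nat 56 = s.nat 56 := hf₁.nat 56 rfl
  have f57 : s₁.nat 57 = s.nat 57 := hf₁.nat 57 rfl
  have f59 : s₁.nat 59 = s.nat 59 := hf₁.nat 59 rfl
  have f14 : s₁.real 14 = s.real 14 := hf₁.real 14 rfl
  simp only [Prog.wp_seq, Prog.wp_setNat, Prog.wp_setReal]
  apply Prog.wp_ite
  · intro h
    have h' : x.zs.length % G.d + 1 = G.d := by
      have : G.d ≤ x.zs.length % G.d + 1 := by simpa [f0, hG.d, f57, ha] using h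
      omega
    simp only [Prog.wp_seq, Prog.wp_setNat]
    refine (pushProg_pushed (G := G) (s₀ := s₀) (ys := ys)
      (y := { x with kind := 0, zs := x.z :: x.zs }) (hP₁.grow ?_ ?_ ?_ ?_ ?_) ?_).mono ?_
    · simp
    · apply Store.item_congr <;> simp
    · simp [f0, hG.m]
      omega
    · simp
    · simp
    · constructor <;> simp [Store.regs, f0, f2, f23, f51, f52, f53, f54, f55, f56, f59, f14,
        hG.m, hG.base, hcur, hcb, hadv, hb, hrem, hz, hkey, hzp, succ_mod_of_eq h', Ctx.key,
        hG.d]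
      · omega
      · omega
      · exact hrD
      · exact hrH
    · rintro t₂ s₂ ⟨ht₂, -, hh⟩
      exact ⟨by omega, hh⟩
  · intro h
    have h' : ¬ x.zs.length % G.d + 1 = G.d := by
      have : x.zs.length % G.d + 1 < G.d := by simpa [f0, hG.d, f57, ha] using h
      omega
    simp only [Prog.wp_seq, Prog.wp_setNat]
    refine (pushProg_pushed (G := G) (s₀ := s₀) (ys := ys)
      (y := { x with kind := 0, zs := x.z :: x.zs }) (hP₁.grow ?_ ?_ ?_ ?_ ?_) ?_).mono ?_
    · simp
    · apply Store.item_congr <;> simp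
    · simp [f0, hG.m]
      omega
    · simp
    · simp
    · constructor <;> simp [Store.regs, f0, f2, f23, f51, f52, f53, f54, f55, f56, f57, f59, f14,
        hG.m, hG.base, hcur, hcb, hadv, hb, hrem, hz, hkey, hzp, succ_mod_of_ne hd h', Ctx.key,
        ha]
      · omega
      · omega
      · exact hrD
      · exact hrH
    · rintro t₂ s₂ ⟨ht₂, -, hh⟩
      exact ⟨by omega, hh⟩

/-- Expand a node whose current cell is moving. -/
def moveProg : Prog :=
  .ite (.natLe 1 (nv 55))
    -- The registers are altered for the child that moves on and then reloaded, because the other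
    -- child commits the cell before the move.
    (.setNat 55 0 (nv 55 - 1) ;; .setNat 59 0 (nv 59 + 2 - nv 50) ;; pushProg ;; loadProg) .skip ;;
  commitProg

theorem moveProg_spec {G : Ctx} {s : Store} {x : Node} (hG : G.Holds s) (hd : 1 ≤ G.d)
    (hk : x.kind ≠ 0) (hx : G.Rep (s.real 12) (s.nat 40) (s.nat 23 0) s.regs x)
    (hreg : s.regs = s.item (s.nat 21 0)) (hlt : s.nat 21 0 < s.nat 22 0) :
    moveProg.wp s fun t s' => t ≤ 8 * G.m + 51 ∧ moveProg.Frame s s' ∧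
      Pushed G s (G.children x) s' := by
  suffices H : moveProg.wp s fun t s' => t ≤ 8 * G.m + 51 ∧ Pushed G s (G.children x) s' by
    obtain ⟨t, s', hr, ht, h⟩ := H
    exact ⟨t, s', hr, ht, hr.frame, h⟩
  have hb : s.nat 55 0 = x.b := hx.b
  unfold moveProg
  rw [Prog.wp_seq]
  apply Prog.wp_ite
  · intro h
    have h' : 0 < x.b := Nat.lt_of_lt_of_le one_pos (by simpa [hb] using h)
    simp only [Prog.wp_seq, Prog.wp_setNat]
    refine (pushProg_pushed (G := G) (s₀ := s) (ys := [])
      (y := { x with b := x.b - 1, z := x.z + 2 - x.kind })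
      ((Pushed.nil G s).grow ?_ ?_ ?_ ?_ ?_) ?_).mono ?_
    · simp
    · apply Store.item_congr <;> simp
    · simp
    · simp
    · simp
    · have hz : s.nat 59 0 = x.z := hx.z
      have hkd : s.nat 50 0 = x.kind := hx.kind
      refine ⟨?_, ?_, ?_, ?_, ?_, ?_, ?_, ?_, ?_, ?_, ?_, ?_, ?_⟩ <;>
        simp [Store.regs, hb, hz, hkd]
      · exact hx.cur
      · exact hx.cb
      · exact hx.zp
      · exact hx.adv
      · exact hx.rem
      · exact hx.a
      · exact hx.key
      · exact hx.row_le
      · exact hx.rowD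
      · exact hx.rowH
    rintro t₁ s₁ ⟨ht₁, hf₁, hP₁⟩
    have f21 : s₁.nat 21 0 = s.nat 21 0 := by rw [hf₁.nat 21 rfl]; simp
    refine (loadProg_spec f21).mono ?_
    rintro t₂ s₂ ⟨ht₂, hf₂, hreg₂⟩
    -- The push wrote at the tail, strictly beyond the head, so reloading restores the original
    -- registers.
    rw [hP₁.old _ hlt, ← hreg] at hreg₂
    have g : ∀ y ∈ [0, 2, 7, 22, 23, 30, 31, 32, 33, 34, 35, 36, 37, 38, 39, 40],
        s₂.nat y = s₁.nat y := fun y hy => hf₂.nat y (by revert y; decide)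
    have g' : ∀ y ∈ [1, 2, 9, 11, 12], s₂.real y = s₁.real y :=
      fun y hy => hf₂.real y (by revert y; decide)
    have e : ∀ y ∈ [0, 2, 7, 23, 40], s₂.nat y = s.nat y := by
      intro y hy
      rw [hf₂.nat y (by revert y; decide), hf₁.nat y (by revert y; decide),
        Store.nat_putNat_of_ne, Store.nat_putNat_of_ne] <;> revert y <;> decide
    have e' : ∀ y ∈ [1, 2, 9, 12], s₂.real y = s.real y := by
      intro y hy
      rw [hf₂.real y (by revert y; decide), hf₁.real y (by revert y; decide)]
      rfl
    have hP₂ : Pushed G s ([] ++ [{ x with b := x.b - 1, z := x.z + 2 - x.kind }]) s₂ := by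
      refine hP₁.grow (by rw [g 22 (by simp)]) ?_ (by rw [g 23 (by simp)])
        (by rw [g' 12 (by simp)]; simp) (by rw [g 40 (by simp)]; simp)
      apply Store.item_congr <;> first | exact g _ (by simp) | exact g' _ (by simp)
    refine (commitProg_spec (x := x) (hG.congr ?_ ?_ ?_ ?_ ?_ ?_) hd hP₂ ?_).mono ?_
    · exact e _ (by simp)
    · exact e _ (by simp)
    · exact e _ (by simp)
    · exact e' _ (by simp)
    · exact e' _ (by simp)
    · exact e' _ (by simp)
    · rw [e' 12 (by simp), e 40 (by simp), e 23 (by simp), hreg₂]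
      exact hx
    · rintro t₃ s₃ ⟨ht₃, -, hP₃⟩
      refine ⟨by omega, ?_⟩
      simpa [Ctx.children, hk, h'] using hP₃
  · intro h
    have h' : ¬ 0 < x.b := by simpa [hb] using h
    simp only [Prog.wp_skip]
    refine (commitProg_spec hG hd (Pushed.nil G s) hx).mono ?_
    rintro t₃ s₃ ⟨ht₃, -, hP₃⟩
    refine ⟨by omega, ?_⟩
    simpa [Ctx.children, hk, h'] using hP₃

/-- Expand a node between two coordinates. -/
def expandProg : Prog :=
  .setNat 59 0 (.get 7 (nv 53)) ;;
  .setNat 50 0 1 ;; pushProg ;;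
  .setNat 50 0 3 ;; pushProg ;;
  .ite (.natLe 1 (nv 54))
    (.setNat 50 0 0 ;; .setNat 54 0 (nv 54 - 1) ;; .setNat 53 0 (nv 53 + .get 0 2) ;; pushProg)
    .skip

/-- The cells are unchanged in all these children, so they share the row of their parent and the
step takes constant time. Only a commit writes a row. -/
theorem expandProg_spec {G : Ctx} {s : Store} {x : Node} (hG : G.Holds s)
    (hk : x.kind = 0) (hx : G.Rep (s.real 12) (s.nat 40) (s.nat 23 0) s.regs x)
    (he : x.e < G.k) (hl : x.zs.length ≠ G.k * G.d) :
    expandProg.wp s fun t s' => t ≤ 43 ∧ expandProg.Frame s s' ∧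
      Pushed G s (G.children x) s' := by
  suffices H : expandProg.wp s fun t s' => t ≤ 43 ∧ Pushed G s (G.children x) s' by
    obtain ⟨t, s', hr, ht, h⟩ := H
    exact ⟨t, s', hr, ht, hr.frame, h⟩
  have hx' := hx
  obtain ⟨hkind, hcur, hcb, hzp, hadv, hb, hrem, ha, hz, hkey, hrow, hrD, hrH⟩ := hx
  simp only [Store.regs] at hkind hcur hcb hzp hadv hb hrem ha hz hkey hrow hrD hrH
  have hcell : s.nat 7 (s.nat 53 0) = G.anchorCell x := by rw [hG.Z, hzp]; rfl
  unfold expandProg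
  simp only [Prog.wp_seq, Prog.wp_setNat]
  refine (pushProg_pushed (G := G) (s₀ := s) (ys := [])
    (y := { x with kind := 1, z := G.anchorCell x }) ((Pushed.nil G s).grow ?_ ?_ ?_ ?_ ?_) ?_).mono ?_
  · simp
  · apply Store.item_congr <;> simp
  · simp
  · simp
  · simp
  · constructor <;> simp [Store.regs, hcell] <;> assumption
  rintro t₁ s₁ ⟨ht₁, hf₁, hP₁⟩
  have g : ∀ y ∈ [7, 0, 23, 40, 51, 52, 53, 54, 55, 56, 57, 58], s₁.nat y = s.nat y := by
    intro y hy
    rw [hf₁.nat y (by revert y; decide), Store.nat_putNat_of_ne, Store.nat_putNat_of_ne] <;>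
      revert y <;> decide
  have g' : ∀ y ∈ [12, 14], s₁.real y = s.real y := by
    intro y hy
    rw [hf₁.real y (by revert y; decide)]
    rfl
  have g59 : s₁.nat 59 0 = G.anchorCell x := by rw [hf₁.nat 59 rfl]; simp [hcell]
  refine (pushProg_pushed (G := G) (s₀ := s) (ys := _)
    (y := { x with kind := 3, z := G.anchorCell x }) (hP₁.grow ?_ ?_ ?_ ?_ ?_) ?_).mono ?_
  · simp
  · apply Store.item_congr <;> simp
  · simp
  · simp
  · simp
  · constructor <;> simp [Store.regs, g, g', g59] <;> assumption
  rintro t₂ s₂ ⟨ht₂, hf₂, hP₂⟩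
  have i : ∀ y ∈ [7, 0, 23, 40, 51, 52, 53, 54, 55, 56, 57, 58], s₂.nat y = s.nat y := by
    intro y hy
    rw [← g y hy, hf₂.nat y (by revert y; decide), Store.nat_putNat_of_ne] <;>
      revert y <;> decide
  have i' : ∀ y ∈ [12, 14], s₂.real y = s.real y := by
    intro y hy
    rw [← g' y hy, hf₂.real y (by revert y; decide)]
    rfl
  have i59 : s₂.nat 59 0 = G.anchorCell x := by rw [hf₂.nat 59 rfl]; simp [g59]
  apply Prog.wp_ite
  · intro h
    have h' : x.e + 1 < G.k := by
      have : 1 ≤ G.k - 1 - x.e := by simpa [i 54 (by simp), hadv] using h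
      omega
    simp only [Prog.wp_seq, Prog.wp_setNat]
    refine (pushProg_pushed (G := G) (s₀ := s) (ys := _)
      (y := { x with e := x.e + 1, z := G.anchorCell x }) (hP₂.grow ?_ ?_ ?_ ?_ ?_) ?_).mono ?_
    · simp
    · apply Store.item_congr <;> simp
    · simp
    · simp
    · simp
    · constructor <;> simp [Store.regs, i, i', i59, hG.d, hk] <;> try assumption
      · rw [hzp]; ring
      · rw [hadv]; omega
    rintro t₃ s₃ ⟨ht₃, -, hP₃⟩
    refine ⟨by omega, ?_⟩
    simpa [Ctx.children, hk, h', hl] using hP₃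
  · intro h
    have h' : ¬ x.e + 1 < G.k := by
      have : ¬ 1 ≤ G.k - 1 - x.e := by simpa [i 54 (by simp), hadv] using h
      omega
    simp only [Prog.wp_skip]
    refine ⟨by omega, ?_⟩
    simpa [Ctx.children, hk, h', hl] using hP₂

/-- Output a completed candidate if its row accepts. -/
def outputProg : Prog :=
  .ite (.natLe 1 (.get 40 (nv 58 + .get 0 1)))
    (.setReal 3 (nv 26) (rv 14) ;; .setNat 1 (nv 26) (nv 51) ;; .setNat 26 0 (nv 26 + 1)) .skip

/-- The real array `3` and the integer array `1` hold the list `l`, whose length is the integer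
variable `26`. -/
structure HoldsList (l : List (ℝ × ℕ)) (s : Store) : Prop where
  len : s.nat 26 0 = l.length
  get : ∀ (q : ℕ) (h : q < l.length), (s.real 3 q, s.nat 1 q) = l[q]

theorem HoldsList.congr {l : List (ℝ × ℕ)} {s s' : Store} (h : HoldsList l s)
    (h26 : s'.nat 26 = s.nat 26) (h1 : s'.nat 1 = s.nat 1) (h3 : s'.real 3 = s.real 3) :
    HoldsList l s' :=
  ⟨by rw [h26, h.len], fun q hq => by rw [h1, h3, h.get q hq]⟩

theorem HoldsList.push {l : List (ℝ × ℕ)} {s : Store} (h : HoldsList l s) (v : ℝ) (p : ℕ) :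
    HoldsList (l ++ [(v, p)]) (((s.putReal 3 (s.nat 26 0) v).putNat 1 (s.nat 26 0) p).putNat 26 0
      (s.nat 26 0 + 1)) := by
  refine ⟨by simp [h.len], fun q hq => ?_⟩
  rcases Nat.lt_or_ge q l.length with hq' | hq'
  · rw [List.getElem_append_left hq', ← h.get q hq']
    simp [h.len, hq'.ne]
  · obtain rfl : q = l.length := by
      simp at hq
      omega
    simp [h.len]

/-- Process the node at the head of the queue. -/
def searchBody : Prog :=
  loadProg ;;
  .ite (.natLe (nv 50) 0) (.ite (.natLe (nv 56) 0) outputProg expandProg) moveProg ;;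
  .setNat 21 0 (nv 21 + 1)

theorem searchBody_spec {G : Ctx} {s : Store} {x : Node} {outs : List (ℝ × ℕ)} (hG : G.Holds s)
    (hd : 1 ≤ G.d) (hv : G.Valid x)
    (hx : G.Rep (s.real 12) (s.nat 40) (s.nat 23 0) (s.item (s.nat 21 0)) x)
    (hlt : s.nat 21 0 < s.nat 22 0) (ho : HoldsList outs s) :
    searchBody.wp s fun t s' => t ≤ 8 * G.m + 64 ∧ s'.nat 21 0 = s.nat 21 0 + 1 ∧
      Pushed G s (G.children x) s' ∧ HoldsList (outs ++ G.output x) s' := by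
  unfold searchBody
  rw [Prog.wp_seq]
  refine (loadProg_spec rfl).mono ?_
  rintro t₁ s₁ ⟨ht₁, hf₁, hreg⟩
  have f : ∀ y ∈ [0, 1, 2, 7, 21, 22, 23, 26, 30, 31, 32, 33, 34, 35, 36, 37, 38, 39, 40],
      s₁.nat y = s.nat y := fun y hy => hf₁.nat y (by revert y; decide)
  have f' : ∀ y ∈ [1, 2, 3, 9, 11, 12], s₁.real y = s.real y :=
    fun y hy => hf₁.real y (by revert y; decide)
  have hitem : s₁.item = s.item := by
    apply Store.item_congr <;> first | exact f _ (by simp) | exact f' _ (by simp)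
  have hG₁ : G.Holds s₁ := hG.congr (f _ (by simp)) (f _ (by simp)) (f _ (by simp))
    (f' _ (by simp)) (f' _ (by simp)) (f' _ (by simp))
  have ho₁ : HoldsList outs s₁ := ho.congr (f _ (by simp)) (f _ (by simp)) (f' _ (by simp))
  have hx₁ : G.Rep (s₁.real 12) (s₁.nat 40) (s₁.nat 23 0) s₁.regs x := by
    rw [f' 12 (by simp), f 40 (by simp), f 23 (by simp), hreg]
    exact hx
  have f21 : s₁.nat 21 0 = s.nat 21 0 := by rw [f 21 (by simp)]
  have f22 : s₁.nat 22 0 = s.nat 22 0 := by rw [f 22 (by simp)]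
  -- Loading changes only registers, so the memory before loading is an equally good reference
  -- point.
  have hback : ∀ ys s', Pushed G s₁ ys s' → Pushed G s ys s' := by
    intro ys s' h
    obtain ⟨h1, h2, h3, h4, h5, h6⟩ := h
    rw [f 22 (by simp)] at h1 h2 h3
    rw [f 23 (by simp)] at h4 h5 h6
    rw [f' 12 (by simp)] at h5
    rw [f 40 (by simp)] at h6
    rw [hitem] at h2
    exact ⟨h1, h2, h3, h4, h5, h6⟩
  have hkind : s₁.nat 50 0 = x.kind := hx₁.kind
  have hrem : s₁.nat 56 0 = G.k * G.d - x.zs.length := hx₁.rem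
  have hfin : ∀ ys s', Pushed G s₁ ys s' → ∀ v, Pushed G s ys (s'.putNat 21 0 v) := by
    intro ys s' h v
    refine (hback _ _ h).grow (by simp) ?_ (by simp) (by simp) (by simp)
    apply Store.item_congr <;> simp
  have hlen := hv.len_le
  rw [Prog.wp_seq]
  apply Prog.wp_ite
  · intro h
    have hk : x.kind = 0 := by simpa [hkind] using h
    apply Prog.wp_ite
    · intro h
      have hl : x.zs.length = G.k * G.d := by
        have : G.k * G.d - x.zs.length = 0 := by simpa [hrem] using h
        omega
      have hch : G.children x = [] := by simp [Ctx.children, hk, hl]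
      rw [hch]
      have hacc := hx₁.rowH G.m le_rfl
      unfold outputProg
      apply Prog.wp_ite
      · intro h
        have hout : G.output x = [(G.key x.zs, x.cur)] := by
          have hpos : 0 < s₁.nat 40 (s₁.nat 58 0 + G.m) := by
            rw [← hG₁.m]
            exact h
          rw [Ctx.output, if_pos ⟨hk, hl, hacc.1 hpos⟩]
        simp only [Prog.wp_seq, Prog.wp_setNat, Prog.wp_setReal]
        refine ⟨by omega, ?_, ?_, ?_⟩
        · simp [f21]
        · refine hfin [] _ ((Pushed.nil G s₁).grow ?_ ?_ ?_ ?_ ?_) _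
          · simp
          · apply Store.item_congr <;> simp
          · simp
          · simp
          · simp
        · rw [hout]
          refine (ho₁.push (G.key x.zs) x.cur).congr ?_ ?_ ?_
          · simp
            rfl
          · have hc : s₁.nat 51 0 = x.cur := hx₁.cur
            simp [hc]
            rfl
          · have hc : s₁.real 14 0 = G.key x.zs := hx₁.key
            simp [hc]
      · intro h
        have hout : G.output x = [] := by
          rw [Ctx.output, if_neg]
          rintro ⟨-, -, h3⟩
          apply h
          simp only [Test.holds_natLe, NatExp.eval_one, NatExp.eval_get, NatExp.eval_add,
            NatExp.eval_nv, hG₁.m]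
          exact hacc.2 h3
        simp only [Prog.wp_skip, Prog.wp_setNat]
        refine ⟨by omega, ?_, ?_, ?_⟩
        · simp [f21]
        · exact hfin [] _ (Pushed.nil G s₁) _
        · rw [hout, List.append_nil]
          exact ho₁.congr (by simp) (by simp) (by simp)
    · intro h
      have hl : x.zs.length ≠ G.k * G.d := by
        have : G.k * G.d - x.zs.length ≠ 0 := by simpa [hrem] using h
        omega
      have hout : G.output x = [] := by simp [Ctx.output, hl]
      refine (expandProg_spec hG₁ hk hx₁ hv.e_lt hl).mono ?_
      rintro t₂ s₂ ⟨ht₂, hf₂, hP₂⟩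
      simp only [Prog.wp_setNat]
      refine ⟨by omega, ?_, hfin _ _ hP₂ _, ?_⟩
      · simp [hf₂.nat 21 rfl, f21]
      · rw [hout, List.append_nil]
        refine ho₁.congr ?_ ?_ ?_
        · simp [hf₂.nat 26 rfl]
        · simp [hf₂.nat 1 rfl]
        · simp [hf₂.real 3 rfl]
  · intro h
    have hk : x.kind ≠ 0 := by simpa [hkind] using h
    have hout : G.output x = [] := by simp [Ctx.output, hk]
    refine (moveProg_spec hG₁ hd hk hx₁ (by rw [hreg, hitem, f21]) (by omega)).mono ?_
    rintro t₂ s₂ ⟨ht₂, hf₂, hP₂⟩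
    simp only [Prog.wp_setNat]
    refine ⟨by omega, ?_, hfin _ _ hP₂ _, ?_⟩
    · simp [hf₂.nat 21 rfl, f21]
    · rw [hout, List.append_nil]
      refine ho₁.congr ?_ ?_ ?_
      · simp [hf₂.nat 26 rfl]
      · simp [hf₂.nat 1 rfl]
      · simp [hf₂.real 3 rfl]

/-! #### The search -/

/-- Compute the number of coordinates of a curve. -/
def curveLength : Prog :=
  .setNat 27 0 0 ;; .setNat 14 0 0 ;;
  .while (.natLt (nv 14) (.get 0 1)) (.setNat 27 0 (nv 27 + .get 0 2) ;; .setNat 14 0 (nv 14 + 1))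

theorem curveLength_spec {s : Store} {m d : ℕ} (hm : s.nat 0 1 = m) (hd : s.nat 0 2 = d) :
    curveLength.wp s fun t s' => t ≤ 3 * m + 3 ∧ curveLength.Frame s s' ∧ s'.nat 27 0 = m * d := by
  suffices H : curveLength.wp s fun t s' => t ≤ 3 * m + 3 ∧ s'.nat 27 0 = m * d by
    obtain ⟨t, s', hr, ht, h⟩ := H
    exact ⟨t, s', hr, ht, hr.frame, h⟩
  unfold curveLength
  simp only [Prog.wp_seq, Prog.wp_setNat]
  refine (Prog.wp_for (fun c s' => s'.nat 14 0 = c ∧ s'.nat 27 0 = c * d) m 2 ?_ ?_ ?_).mono ?_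
  · simp
  · rintro i s' hf - ⟨h, -⟩
    simp [h, hf.nat 0 rfl, hm]
  · rintro i s' hf - ⟨h, h'⟩
    simp [h, h', hf.nat 0 rfl, hd, add_mul]
  · rintro t s' ⟨ht, -, -, h⟩
    exact ⟨by omega, h⟩

/-- Prepare the registers for the root of the first search tree, and the first row. -/
def initSearch : Prog :=
  .setNat 40 0 1 ;; .setNat 23 0 (.get 0 1 + 1) ;;
  .setNat 50 0 0 ;; .setNat 51 0 0 ;; .setNat 52 0 0 ;; .setNat 53 0 0 ;;
  .setNat 54 0 (.get 0 3 - 1) ;; .setNat 55 0 (nv 6) ;; .setNat 56 0 (.get 2 2) ;;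
  .setNat 57 0 0 ;; .setNat 58 0 0 ;; .setNat 59 0 0 ;; .setReal 14 0 0 ;;
  .setNat 21 0 0 ;; .setNat 22 0 0 ;; .setNat 26 0 0

/-- For the empty candidate the reachability row is `1, 0, …, 0` and all accumulated distances
vanish, whatever the curve. One row at address `0` thus serves all roots; it relies on the memory
being zero initially. -/
theorem initSearch_spec {G : Ctx} {s : Store} (hm : s.nat 0 1 = G.m) (hk : s.nat 0 3 = G.k)
    (hκ : s.nat 2 2 = G.k * G.d) (hW : s.nat 6 0 = G.W) (hH : ∀ p, s.nat 40 p = 0) :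
    initSearch.wp s fun t s' => t ≤ 16 ∧ initSearch.Frame s s' ∧
      s'.nat 21 0 = 0 ∧ s'.nat 22 0 = 0 ∧ s'.nat 26 0 = 0 ∧ s'.nat 23 0 = G.m + 1 ∧
      (∀ p, s'.nat 40 p = if p = 0 then 1 else 0) ∧
      s'.regs = ⟨0, 0, 0, 0, G.k - 1, G.W, G.k * G.d, 0, 0, 0, 0⟩ := by
  suffices H : initSearch.wp s fun t s' => t ≤ 16 ∧
      s'.nat 21 0 = 0 ∧ s'.nat 22 0 = 0 ∧ s'.nat 26 0 = 0 ∧ s'.nat 23 0 = G.m + 1 ∧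
      (∀ p, s'.nat 40 p = if p = 0 then 1 else 0) ∧
      s'.regs = ⟨0, 0, 0, 0, G.k - 1, G.W, G.k * G.d, 0, 0, 0, 0⟩ by
    obtain ⟨t, s', hr, ht, h⟩ := H
    exact ⟨t, s', hr, ht, hr.frame, h⟩
  simp [initSearch, Store.regs, hm, hk, hκ, hW, hH]

/-- Put the roots of all search trees into the queue. -/
def rootsLoop : Prog :=
  .while (.natLt (nv 51) (.get 0 0))
    (pushProg ;; .setNat 51 0 (nv 51 + 1) ;; .setNat 52 0 (nv 52 + nv 27) ;;
      .setNat 53 0 (nv 53 + .get 2 2))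

theorem rootsLoop_spec {G : Ctx} {s : Store} (hn : s.nat 0 0 = G.n) (hκ : s.nat 2 2 = G.k * G.d)
    (h27 : s.nat 27 0 = G.m * G.d) (h22 : s.nat 22 0 = 0) (h23 : s.nat 23 0 = G.m + 1)
    (hH : ∀ p, s.nat 40 p = if p = 0 then 1 else 0) (hD : ∀ p, s.real 12 p = 0)
    (hreg : s.regs = ⟨0, 0, 0, 0, G.k - 1, G.W, G.k * G.d, 0, 0, 0, 0⟩) :
    rootsLoop.wp s fun t s' => t ≤ 16 * G.n + 1 ∧ rootsLoop.Frame s s' ∧ s'.nat 22 0 = G.n ∧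
      ∀ i < G.n, G.Rep (s'.real 12) (s'.nat 40) (s'.nat 23 0) (s'.item i) (G.root i) := by
  unfold rootsLoop
  refine (Prog.wp_for (fun c s' => Pushed G s ((List.range c).map G.root) s' ∧
    s'.regs = ⟨0, c, c * (G.m * G.d), c * (G.k * G.d), G.k - 1, G.W, G.k * G.d, 0, 0, 0, 0⟩) G.n 15
    ?_ ?_ ?_).mono ?_
  · refine ⟨Pushed.nil G s, by simpa using hreg⟩
  · rintro i s' hf - ⟨-, h⟩
    have h51 : s'.nat 51 0 = i := congrArg Item.cur h
    simp [h51, hf.nat 0 rfl, hn]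
  · rintro i s' hf - ⟨hP, h⟩
    have e12 : s'.real 12 = s.real 12 := hf.real 12 rfl
    have e40 : s'.nat 40 = s.nat 40 := hf.nat 40 rfl
    have e23 : s'.nat 23 = s.nat 23 := hf.nat 23 rfl
    simp only [Prog.wp_seq, Prog.wp_setNat]
    refine (pushProg_pushed hP (y := G.root i) ?_).mono ?_
    · rw [h]
      constructor <;> simp [Ctx.root, Ctx.key, e23, h23, Ctx.rowD, Ctx.rowH, e12, hD, e40, hH]
      intro l _
      split_ifs with hl <;> simp [hl]
    rintro t s'' ⟨ht, hf', hP'⟩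
    refine ⟨by omega, ?_, ?_⟩
    · rw [List.range_succ, List.map_append]
      refine hP'.grow ?_ ?_ ?_ ?_ ?_
      · simp
      · apply Store.item_congr <;> simp
      · simp
      · simp
      · simp
    · simp only [Store.regs, Item.mk.injEq] at h
      simp [Store.regs, hf'.nat 50 rfl, hf'.nat 51 rfl, hf'.nat 52 rfl, hf'.nat 53 rfl,
        hf'.nat 54 rfl, hf'.nat 55 rfl, hf'.nat 56 rfl, hf'.nat 57 rfl, hf'.nat 58 rfl,
        hf'.nat 59 rfl, hf'.real 14 rfl, hf'.nat 27 rfl, hf'.nat 2 rfl, h, hf.nat 27 rfl,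
        hf.nat 2 rfl, h27, hκ]
      constructor <;> ring
  · rintro t s' ⟨ht, hf, hP, -⟩
    have ht' := hP.tail
    simp only [List.length_map, List.length_range, h22, zero_add] at ht'
    refine ⟨by omega, ⟨hf.nat, hf.real⟩, ht', ?_⟩
    intro i hi
    have := hP.new i (by simpa using hi)
    rw [List.getElem_map, List.getElem_range, h22, zero_add] at this
    exact this

namespace Ctx
variable (G : Ctx)

/-- A bound for the size of each search tree. -/
def total (ε : ℝ) : ℝ := 2 ^ (G.k - 1) * (18 / ε) ^ (G.k * G.d) * (1 + ε) ^ G.W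

variable {G}

theorem pot_root (ε : ℝ) (i : ℕ) : G.pot ε (G.root i) = G.total ε := by
  simp [pot, root, total]

end Ctx

def searchLoop : Prog := .while (.natLt (nv 21) (nv 22)) searchBody

/-- The first `done` nodes of the queue have been processed, the nodes `pending` have not. -/
structure SearchInv (G : Ctx) (ε : ℝ) (done pending : List Node) (s : Store) : Prop where
  head : s.nat 21 0 = done.length
  tail : s.nat 22 0 = done.length + pending.length
  rep : ∀ (u : ℕ) (h : u < (done ++ pending).length),
    G.Rep (s.real 12) (s.nat 40) (s.nat 23 0) (s.item u) (done ++ pending)[u]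
  valid : ∀ x ∈ done ++ pending, G.Valid x
  closed : ∀ x ∈ done, ∀ y ∈ G.children x, y ∈ done ++ pending
  roots : ∀ i < G.n, G.root i ∈ done ++ pending
  outs : HoldsList (done.flatMap G.output) s
  pot : done.length + (pending.map (G.pot ε)).sum ≤ G.n * G.total ε

/-- Processing a node moves it to `done` and replaces it by its children among the pending nodes. By
`pot_children` the number of processed nodes plus the potential of the pending ones does not
increase. -/
theorem SearchInv.step {G : Ctx} {ε : ℝ} {done pending : List Node} {x : Node} {s : Store}
    (h : SearchInv G ε done (x :: pending) s) (hG : G.Holds s) (hd : 1 ≤ G.d) (hε : 0 < ε)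
    (hε1 : ε ≤ 1) (hZ : ∀ p < G.n * (G.k * G.d), G.Z p ≤ G.len) :
    searchBody.wp s fun t s' => t ≤ 8 * G.m + 64 ∧
      SearchInv G ε (done ++ [x]) (pending ++ G.children x) s' := by
  obtain ⟨hhead, htail, hrep, hval, hclo, hroo, hout, hpot⟩ := h
  have hvx : G.Valid x := hval x (by simp)
  have hx : G.Rep (s.real 12) (s.nat 40) (s.nat 23 0) (s.item (s.nat 21 0)) x := by
    have := hrep done.length (by simp)
    rw [hhead]
    simpa using this
  refine (searchBody_spec hG hd hvx hx ?_ hout).mono ?_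
  · rw [hhead, htail]
    simp
  rintro t s' ⟨ht, h21, hP, hout'⟩
  have hassoc : (done ++ [x]) ++ (pending ++ G.children x) =
    (done ++ x :: pending) ++ G.children x := by simp
  refine ⟨ht, by simp [h21, hhead], ?_, ?_, ?_, ?_, ?_, ?_, ?_⟩
  · rw [hP.tail, htail]
    simp
    omega
  · intro u hu
    have hlen : (done ++ x :: pending).length = s.nat 22 0 := by simp [htail]
    simp only [hassoc] at hu ⊢
    rcases Nat.lt_or_ge u (done ++ x :: pending).length with h | h
    · rw [List.getElem_append_left h, hP.old u (by omega)]
      exact (hrep u h).mono hP.rows hP.oldD hP.oldH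
    · rw [List.getElem_append_right h]
      have := hP.new (u - (done ++ x :: pending).length) (by
        rw [List.length_append] at hu
        omega)
      rwa [show s.nat 22 0 + (u - (done ++ x :: pending).length) = u by omega] at this
  · intro y hy
    rw [hassoc, List.mem_append] at hy
    rcases hy with hy | hy
    · exact hval y hy
    · exact hvx.children hd hZ hy
  · intro y hy z hz
    rw [hassoc, List.mem_append]
    rcases List.mem_append.1 hy with hy | hy
    · exact .inl (hclo y hy z hz)
    · rw [List.mem_singleton.1 hy] at hz
      exact .inr hz
  · intro i hi
    rw [hassoc, List.mem_append]
    exact .inl (hroo i hi)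
  · simpa using hout'
  · have := Ctx.pot_children hε hε1 hvx
    simp only [List.map_cons, List.sum_cons, List.map_append, List.sum_append, List.length_append,
      List.length_singleton, Nat.cast_add, Nat.cast_one] at hpot ⊢
    linarith

/-- Initially the potential is `n` times that of a root, and it bounds the number of nodes ever
processed. When the queue is exhausted, the processed nodes contain the roots and are closed under
children; completeness needs nothing else about the order of the search. -/
theorem searchLoop_spec {G : Ctx} {s : Store} {ε : ℝ} (hG : G.Holds s) (hk : 1 ≤ G.k)
    (hd : 1 ≤ G.d) (hε : 0 < ε) (hε1 : ε ≤ 1) (hZ : ∀ p < G.n * (G.k * G.d), G.Z p ≤ G.len)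
    (h21 : s.nat 21 0 = 0) (h22 : s.nat 22 0 = G.n) (h26 : s.nat 26 0 = 0)
    (hroot : ∀ i < G.n, G.Rep (s.real 12) (s.nat 40) (s.nat 23 0) (s.item i) (G.root i)) :
    searchLoop.wp s fun t s' => t ≤ ⌊G.n * G.total ε⌋₊ * (8 * G.m + 65) + 1 ∧
      searchLoop.Frame s s' ∧ ∃ all : List Node, (∀ i < G.n, G.root i ∈ all) ∧
        (∀ x ∈ all, G.Valid x) ∧ (∀ x ∈ all, ∀ y ∈ G.children x, y ∈ all) ∧
        all.length ≤ G.n * G.total ε ∧ HoldsList (all.flatMap G.output) s' := by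
  unfold searchLoop
  refine (Prog.wp_while (fun i s' => ∃ done pending, done.length = i ∧
    SearchInv G ε done pending s') ⌊G.n * G.total ε⌋₊ (8 * G.m + 64) ?_ ?_).mono ?_
  · refine ⟨[], (List.range G.n).map G.root, rfl, by simpa using h21, by simpa using h22, ?_, ?_,
      by simp, ?_, ⟨by simpa using h26, by simp⟩, ?_⟩
    · intro u hu
      simpa using hroot u (by simpa using hu)
    · intro x hx
      simp only [List.nil_append, List.mem_map, List.mem_range] at hx
      obtain ⟨i, hi, rfl⟩ := hx
      exact Ctx.valid_root hi hk
    · intro i hi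
      simp only [List.nil_append, List.mem_map, List.mem_range]
      exact ⟨i, hi, rfl⟩
    · simp [Function.comp_def, Ctx.pot_root]
  · rintro i s' hf ⟨done, pending, hlen, I⟩ hb
    have hb' : s'.nat 21 0 < s'.nat 22 0 := by simpa using hb
    rw [I.head, I.tail] at hb'
    obtain ⟨x, pending, rfl⟩ : ∃ x p, pending = x :: p := by
      cases pending with
      | nil => simp at hb'
      | cons x p => exact ⟨x, p, rfl⟩
    constructor
    · have h1 := I.pot
      have h2 := Ctx.pot_children hε hε1 (I.valid x (by simp))
      have h3 : ∀ l : List Node, 0 ≤ (l.map (G.pot ε)).sum := fun l =>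
        List.sum_nonneg (by simpa using fun x _ => Ctx.pot_nonneg hε x)
      have h4 := h3 (G.children x)
      have h5 := h3 pending
      rw [List.map_cons, List.sum_cons] at h1
      apply Nat.lt_of_succ_le
      apply Nat.le_floor
      push_cast
      rw [← hlen]
      linarith
    · refine (I.step (hG.congr (hf.nat 0 rfl) (hf.nat 2 rfl) (hf.nat 7 rfl) (hf.real 1 rfl)
        (hf.real 2 rfl) (hf.real 9 rfl)) hd hε hε1 hZ).mono ?_
      rintro t s'' ⟨ht, I'⟩
      exact ⟨ht, _, _, by simp [hlen], I'⟩
  · rintro t s' ⟨ht, hf, hb, i, -, done, pending, hlen, I⟩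
    have hb' : s'.nat 22 0 ≤ s'.nat 21 0 := by simpa using hb
    rw [I.head, I.tail] at hb'
    obtain rfl : pending = [] := List.eq_nil_of_length_eq_zero (by omega)
    obtain ⟨-, -, -, hval, hclo, hroo, hout, hpot⟩ := I
    simp only [List.append_nil] at hval hclo hroo
    exact ⟨ht, ⟨hf.nat, hf.real⟩, done, hroo, hval, hclo, by simpa using hpot, hout⟩

/-! ### The preprocessing program -/

/-- The integer array `2` is the parameter block of the query: table length, dictionary length,
`kd`, and base. Its cell `1` first serves as the number of anchor coordinates to sort, and later as
the number of dictionary entries. -/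
def preprocessProg : Prog :=
  setupProg ;; greedyProg ;; copyAnchors ;; sortProg ;; sweepProg ;; locateAll ;;
  .setNat 2 3 (.get 2 0 + nv 6 + 1) ;;
  curveLength ;; initSearch ;; rootsLoop ;; searchLoop ;;
  .setNat 2 1 (nv 26) ;; sortProg ;;
  -- The common length must accommodate the table, the dictionary and the four parameters, so their
  -- sum is announced.
  .setNat 0 0 (.get 2 0 + .get 2 1 + 4)

/-- What the preprocessing computes: `X` are the anchor coordinates, `S` is the rounded square root
of the dimension, `all` are the nodes of the search trees. -/
structure Built (G : Ctx) (ε r : ℝ) (X : ℕ → ℝ) (S : ℕ) (all : List Node) (s : Store) : Prop where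
  root_ge : G.d ≤ S * S
  root_min : ∀ j < S, j * j < G.d
  budget_ge : 25 * ((G.k * G.d : ℕ) : ℝ) ≤ G.W * ε
  budget_min : ∀ j < G.W, j * ε < 25 * ((G.k * G.d : ℕ) : ℝ)
  close : G.ρ = (r + ε * r / 2) * (r + ε * r / 2)
  sorted : SortedTo G.T G.len
  len_le : G.len ≤ G.n * (G.k * G.d) * (⌈16 * S / ε⌉₊ + 1)
  cut : ∀ p < G.n * (G.k * G.d), IsCut G.T G.len (X p) (G.Z p)
  covered : ∀ p < G.n * (G.k * G.d),
    Covered G.T G.len (ε * r / (2 * S)) (X p - 4 * r) (X p + 4 * r)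
  anchors : ∀ i < G.n, ∀ l ≤ G.m, ∀ a < G.d,
    X (i * (G.k * G.d) + (greedy G.d G.k (4 * r * r) (G.pt i) l).1 * G.d + a) =
      G.pt i (greedy G.d G.k (4 * r * r) (G.pt i) l).2 a
  roots : ∀ i < G.n, G.root i ∈ all
  valid : ∀ x ∈ all, G.Valid x
  closed : ∀ x ∈ all, ∀ y ∈ G.children x, y ∈ all
  size : all.length ≤ G.n * G.total ε
  length : s.nat 0 0 = G.len + (all.flatMap G.output).length + 4
  len : s.nat 2 0 = G.len
  card : s.nat 2 1 = (all.flatMap G.output).length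
  dim : s.nat 2 2 = G.k * G.d
  base : s.nat 2 3 = G.base
  table : s.real 2 = G.T
  keys_sorted : SortedTo (s.real 3) (all.flatMap G.output).length
  keys : pairsIn (s.real 3) (s.nat 1) 0 (all.flatMap G.output).length =
    {x | x ∈ all.flatMap G.output}

theorem Ctx.length_output_le (G : Ctx) (all : List Node) :
    (all.flatMap G.output).length ≤ all.length := by
  induction all with
  | nil => simp
  | cons x l ih =>
    have : (G.output x).length ≤ 1 := by
      unfold Ctx.output
      split_ifs <;> simp
    simp only [List.flatMap_cons, List.length_append, List.length_cons]
    omega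

theorem HoldsList.pairsIn_eq {l : List (ℝ × ℕ)} {s : Store} (h : HoldsList l s) :
    pairsIn (s.real 3) (s.nat 1) 0 l.length = {x | x ∈ l} := by
  ext x
  simp only [pairsIn, Set.mem_ofPred_eq]
  constructor
  · rintro ⟨i, -, hi, rfl⟩
    rw [h.get i hi]
    exact List.getElem_mem hi
  · intro hx
    obtain ⟨i, hi, rfl⟩ := List.getElem_of_mem hx
    exact ⟨i, Nat.zero_le _, hi, (h.get i hi).symm⟩

theorem preprocessProg_spec {s : Store} {n m d k : ℕ} {ε r : ℝ} (hn : s.nat 0 0 = n)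
    (hm : s.nat 0 1 = m) (hd : s.nat 0 2 = d) (hk : s.nat 0 3 = k) (hε' : s.real 0 0 = ε)
    (hr' : s.real 0 1 = r) (hnat : ∀ x p, x ≠ 0 → s.nat x p = 0) (hreal : ∀ p, s.real 12 p = 0)
    (hd1 : 1 ≤ d) (hk1 : 1 ≤ k) (hε : 0 < ε) (hε1 : ε ≤ 1) (hr : 0 < r) :
    preprocessProg.wp s fun t s' => ∃ (G : Ctx) (X : ℕ → ℝ) (S : ℕ) (all : List Node),
      G.n = n ∧ G.m = m ∧ G.d = d ∧ G.k = k ∧ G.C = s.real 1 ∧ Built G ε r X S all s' ∧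
      t ≤ (3 * k + 2 * d + 2 * ⌈25 * ((k * d : ℕ) : ℝ) / ε⌉₊ + 8) +
        ((n * (m * (6 * d + 11) + 3 * d + 9) + 4) +
        ((3 * (n * (k * d)) + 3) +
        (((Nat.log 2 (n * (k * d)) + 1) * (16 * (n * (k * d)) + 6) + 2) +
        ((n * (k * d) * (3 * ⌈16 * S / ε⌉₊ + 6) + 2) +
        ((n * (k * d) * (4 * Nat.log 2 G.len + 11) + 2) +
        (1 + ((3 * m + 3) + (16 + ((16 * n + 1) +
        ((⌊n * G.total ε⌋₊ * (8 * m + 65) + 1) +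
        (1 + (((Nat.log 2 (all.flatMap G.output).length + 1) *
          (16 * (all.flatMap G.output).length + 6) + 2) + 1)))))))))))) := by
  unfold preprocessProg
  rw [Prog.wp_seq]
  refine (setupProg_spec hk hd hε' hr' (hnat 2 2 (by simp)) (hnat 2 0 (by simp))
    (hnat 5 0 (by simp)) (hnat 6 0 (by simp)) hε).mono ?_
  rintro t₁ s₁ ⟨ht₁, hf₁, hset⟩
  obtain ⟨h22, h20', hS, hSm, hW, hWm, hδ, hρ, hfar, hreach⟩ := hset
  have a0 : s₁.nat 0 = s.nat 0 := hf₁.nat 0 rfl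
  rw [Prog.wp_seq]
  refine (greedyProg_spec (n := n) (m := m) (d := d) (k := k) (by rw [a0, hn]) (by rw [a0, hm])
    (by rw [a0, hd]) (by rw [a0, hk]) h22 hfar hk1).mono ?_
  rintro t₂ s₂ ⟨ht₂, hf₂, h20, hX⟩
  rw [hf₁.real 1 rfl] at hX
  rw [Prog.wp_seq]
  refine (copyAnchors_spec h20).mono ?_
  rintro t₃ s₃ ⟨ht₃, hf₃, h21, h2o, hcopy⟩
  rw [Prog.wp_seq]
  refine (sortProg_spec h21).mono ?_
  rintro t₄ s₄ ⟨ht₄, hf₄, hsort, hpairs⟩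
  rw [Prog.wp_seq]
  set S := s₁.nat 5 0 with hSdef
  have hS1 : 1 ≤ S := by
    by_contra h
    have : S = 0 := by omega
    rw [this] at hS
    omega
  have hS1' : (1 : ℝ) ≤ S := by exact_mod_cast hS1
  have hδ0 : 0 < ε * r / (2 * S) := by positivity
  have b2 : ∀ i, i ≠ 1 → s₄.nat 2 i = s₁.nat 2 i := by
    intro i hi
    rw [hf₄.nat 2 rfl, h2o i hi, hf₂.nat 2 rfl]
  -- An interval of radius `4r` around an anchor coordinate takes `8r / δ = 16S/ε` cells.
  have hSn : 2 * (4 * r) ≤ (⌈16 * S / ε⌉₊ : ℝ) * (ε * r / (2 * S)) := by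
    calc 2 * (4 * r) = 16 * S / ε * (ε * r / (2 * S)) := by field_simp; norm_num
      _ ≤ _ := mul_le_mul_of_nonneg_right (Nat.le_ceil _) hδ0.le
  refine (sweepProg_spec (by rw [b2 0 (by simp), h20']) (by rw [hf₄.nat 2 rfl, h21])
    (by rw [hf₄.real 9 rfl, hf₃.real 9 rfl, hf₂.real 9 rfl, hreach])
    (by rw [hf₄.real 4 rfl, hf₃.real 4 rfl, hf₂.real 4 rfl, hδ]) hδ0 hSn hsort).mono ?_
  rintro t₅ s₅ ⟨ht₅, hf₅, h5o, hT, hlen, hcov⟩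
  rw [Prog.wp_seq]
  have hN₅ : s₅.nat 2 1 = n * (k * d) := by rw [h5o 1 (by simp), hf₄.nat 2 rfl, h21]
  refine (locateAll_spec hN₅ hT).mono ?_
  rintro t₆ s₆ ⟨ht₆, hf₆, hcut⟩
  have e5 : s₅.real 5 = s₂.real 5 := by
    rw [hf₅.real 5 rfl, hf₄.real 5 rfl, hf₃.real 5 rfl]
  rw [e5] at hcut
  -- The sweep speaks of the sorted copies. Sorting preserves the set of entries, so each original
  -- coordinate is covered as well.
  have hcov' : ∀ p < n * (k * d), Covered (s₅.real 2) (s₅.nat 2 0) (ε * r / (2 * S))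
      (s₂.real 5 p - 4 * r) (s₂.real 5 p + 4 * r) := by
    intro p hp
    have h : (s₃.real 3 p, s₃.nat 1 p) ∈ pairsIn (s₃.real 3) (s₃.nat 1) 0 (n * (k * d)) :=
      ⟨p, Nat.zero_le _, hp, rfl⟩
    rw [← hpairs] at h
    obtain ⟨q, -, hq, he⟩ := h
    rw [← hcopy p hp, (Prod.mk.inj he).1]
    exact hcov q hq
  rw [Prog.wp_seq, Prog.wp_setNat]
  set s₇ := s₆.putNat 2 (NatExp.eval s₆ 3) (NatExp.eval s₆ (.get 2 0 + nv 6 + 1)) with hs₇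
  let G : Ctx := ⟨n, m, d, k, s₅.nat 2 0, s₁.nat 6 0, s₅.real 2, s₆.nat 7, s.real 1,
    (r + ε * r / 2) * (r + ε * r / 2)⟩
  have c0 : s₇.nat 0 = s.nat 0 := by
    rw [hs₇, Store.nat_putNat_of_ne _ (by simp), hf₆.nat 0 rfl, hf₅.nat 0 rfl, hf₄.nat 0 rfl,
      hf₃.nat 0 rfl, hf₂.nat 0 rfl, a0]
  have c6 : s₆.nat 6 = s₁.nat 6 := by
    rw [hf₆.nat 6 rfl, hf₅.nat 6 rfl, hf₄.nat 6 rfl, hf₃.nat 6 rfl, hf₂.nat 6 rfl]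
  have c20 : s₇.nat 2 0 = G.len := by
    simp [hs₇, hf₆.nat 2 rfl, G]
  have c22 : s₇.nat 2 2 = G.k * G.d := by
    simp [hs₇, hf₆.nat 2 rfl, h5o 2, b2 2, h22, G]
  have c23 : s₇.nat 2 3 = G.base := by
    simp [hs₇, hf₆.nat 2 rfl, c6, Ctx.base, G]
  have c1 : s₇.real 1 = s.real 1 := by
    rw [hs₇, Store.real_putNat, hf₆.real 1 rfl, hf₅.real 1 rfl, hf₄.real 1 rfl,
      hf₃.real 1 rfl, hf₂.real 1 rfl, hf₁.real 1 rfl]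
  have c2 : s₇.real 2 = s₅.real 2 := by
    rw [hs₇, Store.real_putNat, hf₆.real 2 rfl]
  have c9 : s₇.real 9 0 = G.ρ := by
    rw [hs₇, Store.real_putNat, hf₆.real 9 rfl, hf₅.real 9 rfl, hf₄.real 9 rfl,
      hf₃.real 9 rfl, hf₂.real 9 rfl, hρ]
  have c7 : s₇.nat 7 = s₆.nat 7 := by simp [hs₇]
  have c12 : ∀ p, s₇.real 12 p = 0 := by
    rw [hs₇, Store.real_putNat, hf₆.real 12 rfl, hf₅.real 12 rfl, hf₄.real 12 rfl,
      hf₃.real 12 rfl, hf₂.real 12 rfl, hf₁.real 12 rfl]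
    exact hreal
  have c40 : ∀ p, s₇.nat 40 p = 0 := by
    rw [hs₇, Store.nat_putNat_of_ne _ (by simp), hf₆.nat 40 rfl, hf₅.nat 40 rfl, hf₄.nat 40 rfl,
      hf₃.nat 40 rfl, hf₂.nat 40 rfl, hf₁.nat 40 rfl]
    exact fun p => hnat 40 p (by simp)
  have c6' : s₇.nat 6 0 = G.W := by simp [hs₇, c6, G]
  clear_value s₇
  rw [Prog.wp_seq]
  refine (curveLength_spec (m := m) (d := d) (by rw [c0, hm]) (by rw [c0, hd])).mono ?_
  rintro t₈ s₈ ⟨ht₈, hf₈, h27⟩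
  rw [Prog.wp_seq]
  refine (initSearch_spec (G := G) (by rw [hf₈.nat 0 rfl, c0, hm]) (by rw [hf₈.nat 0 rfl, c0, hk])
    (by rw [hf₈.nat 2 rfl, c22]) (by rw [hf₈.nat 6 rfl, c6'])
    (by rw [hf₈.nat 40 rfl]; exact c40)).mono ?_
  rintro t₉ s₉ ⟨ht₉, hf₉, i21, i22, i26, i23, i40, ireg⟩
  rw [Prog.wp_seq]
  refine (rootsLoop_spec (G := G) (by rw [hf₉.nat 0 rfl, hf₈.nat 0 rfl, c0, hn])
    (by rw [hf₉.nat 2 rfl, hf₈.nat 2 rfl, c22]) (by rw [hf₉.nat 27 rfl, h27]) i22 i23 i40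
    (by rw [hf₉.real 12 rfl, hf₈.real 12 rfl]; exact c12) ireg).mono ?_
  rintro t₁₀ s₁₀ ⟨ht₁₀, hf₁₀, j22, hrep⟩
  rw [Prog.wp_seq]
  have d0 : s₁₀.nat 0 = s.nat 0 := by rw [hf₁₀.nat 0 rfl, hf₉.nat 0 rfl, hf₈.nat 0 rfl, c0]
  have d2 : s₁₀.nat 2 = s₇.nat 2 := by rw [hf₁₀.nat 2 rfl, hf₉.nat 2 rfl, hf₈.nat 2 rfl]
  have hHolds : G.Holds s₁₀ := by
    refine ⟨by rw [d0, hm], by rw [d0, hd], by rw [d2, c23], ?_, ?_, ?_, ?_⟩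
    · rw [hf₁₀.real 2 rfl, hf₉.real 2 rfl, hf₈.real 2 rfl, c2]
    · rw [hf₁₀.nat 7 rfl, hf₉.nat 7 rfl, hf₈.nat 7 rfl, c7]
    · rw [hf₁₀.real 1 rfl, hf₉.real 1 rfl, hf₈.real 1 rfl, c1]
    · rw [hf₁₀.real 9 rfl, hf₉.real 9 rfl, hf₈.real 9 rfl, c9]
  refine (searchLoop_spec hHolds hk1 hd1 hε hε1 (fun p hp => (hcut p hp).le)
    (by rw [hf₁₀.nat 21 rfl, i21]) j22 (by rw [hf₁₀.nat 26 rfl, i26]) hrep).mono ?_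
  rintro t₁₁ s₁₁ ⟨ht₁₁, hf₁₁, all, hroots, hvalid, hclosed, hsize, hout⟩
  rw [Prog.wp_seq, Prog.wp_setNat]
  set s₁₂ := s₁₁.putNat 2 (NatExp.eval s₁₁ 1) (NatExp.eval s₁₁ (nv 26)) with hs₁₂
  have k1 : s₁₂.nat 2 1 = (all.flatMap G.output).length := by simp [hs₁₂, hout.len]
  have k2 : ∀ i, i ≠ 1 → s₁₂.nat 2 i = s₇.nat 2 i := by
    intro i hi
    simp [hs₁₂, hi, hf₁₁.nat 2 rfl, d2]
  have k3 : s₁₂.real = s₁₁.real := rfl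
  have k4 : s₁₂.nat 1 = s₁₁.nat 1 := by simp [hs₁₂]
  have k5 : s₁₂.real 2 = G.T := by rw [k3, hf₁₁.real 2 rfl, hHolds.T]
  clear_value s₁₂
  rw [Prog.wp_seq]
  refine (sortProg_spec k1).mono ?_
  rintro t₁₃ s₁₃ ⟨ht₁₃, hf₁₃, hksort, hkeys⟩
  rw [k3, k4, hout.pairsIn_eq] at hkeys
  rw [Prog.wp_setNat]
  have l2 : s₁₃.nat 2 = s₁₂.nat 2 := hf₁₃.nat 2 rfl
  refine ⟨G, s₂.real 5, S, all, rfl, rfl, rfl, rfl, rfl, ?_, ?_⟩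
  · refine ⟨hS, hSm, hW, hWm, rfl, hT, hlen, hcut, hcov', hX, hroots, hvalid, hclosed, hsize, ?_,
      ?_, ?_, ?_, ?_, ?_, ?_, ?_⟩
    · simp [l2, k1, k2, c20]
    · simp [l2, k2, c20]
    · simp [l2, k1]
    · simp [l2, k2, c22]
    · simp [l2, k2, c23]
    · rw [Store.real_putNat, hf₁₃.real 2 rfl, k5]
    · exact hksort
    · simpa using hkeys
  · gcongr ?_ + (?_ + (?_ + (?_ + (?_ + (?_ + (_ + (?_ + (?_ + (?_ + (?_ + (_ + (?_ + _))))))))))))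

/-! ### The query program -/

theorem SortedTo.congr {A A' : ℕ → ℝ} {n : ℕ} (h : SortedTo A n) (e : ∀ i < n, A' i = A i) :
    SortedTo A' n := by
  intro i j hij hj
  rw [e i (hij.trans_lt hj), e j hj]
  exact h i j hij hj

theorem IsCut.congr {A A' : ℕ → ℝ} {n p : ℕ} {x : ℝ} (h : IsCut A n x p)
    (e : ∀ i < n, A' i = A i) : IsCut A' n x p := by
  refine ⟨h.le, fun i hi => ?_, fun i hi hin => ?_⟩
  · rw [e i (hi.trans_le h.le)]
    exact h.below i hi
  · rw [e i hin]
    exact h.above i hi hin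

/-- The first cells of a sequence, latest first. -/
def cells (z : ℕ → ℕ) : ℕ → List ℕ
  | 0 => []
  | t + 1 => z t :: cells z t

theorem length_cells (z : ℕ → ℕ) (t : ℕ) : (cells z t).length = t := by
  induction t with
  | zero => rfl
  | succ t ih => simp [cells, ih]

theorem mem_cells {z : ℕ → ℕ} {t x : ℕ} (h : x ∈ cells z t) : ∃ i < t, x = z i := by
  induction t with
  | zero => simp [cells] at h
  | succ t ih =>
    rcases List.mem_cons.1 h with rfl | h
    · exact ⟨t, by omega, rfl⟩
    · obtain ⟨i, hi, rfl⟩ := ih h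
      exact ⟨i, by omega, rfl⟩

def queryProg : Prog :=
  .setNat 14 0 0 ;;
  .setReal 7 0 (.ofNat 0) ;;
  .while (.natLt (nv 14) (.get 2 2))
    (.setReal 6 0 (.get 0 (nv 14)) ;;
    locateProg 2 0 ;;
    .setReal 7 0 (rv 7 * .ofNat (.get 2 3) + .ofNat (nv 8)) ;;
    .setNat 14 0 (nv 14 + 1)) ;;
  .setReal 6 0 (rv 7) ;;
  locateProg 3 1 ;;
  -- The search returns the number of keys that are at most the given one; if the key is present,
  -- its last occurrence is one position before.
  .setNat 0 0 (.get 1 (nv 8 - 1))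

theorem queryProg_spec {G : Ctx} {s : Store} {c : ℕ} {z : ℕ → ℕ} (hlen : s.nat 2 0 = G.len)
    (hcard : s.nat 2 1 = c) (hdim : s.nat 2 2 = G.k * G.d) (hbase : s.nat 2 3 = G.base)
    (hT : SortedTo (s.real 2) G.len) (hK : SortedTo (s.real 3) c)
    (hz : ∀ t < G.k * G.d, IsCut (s.real 2) G.len (s.real 0 t) (z t)) :
    queryProg.wp s fun t s' =>
      t ≤ G.k * G.d * (4 * Nat.log 2 G.len + 11) + 4 * Nat.log 2 c + 12 ∧
      ∃ p, IsCut (s.real 3) c (G.key (cells z (G.k * G.d))) p ∧ s'.nat 0 0 = s.nat 1 (p - 1) := by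
  unfold queryProg
  simp only [Prog.wp_seq, Prog.wp_setNat, Prog.wp_setReal]
  refine (Prog.wp_for (fun c s' => s'.nat 14 0 = c ∧ s'.real 7 0 = G.key (cells z c))
    (G.k * G.d) (4 * Nat.log 2 G.len + 10) ?_ ?_ ?_).mono ?_
  · simp [cells, Ctx.key]
  · rintro i s' hf - ⟨h, -⟩
    simp [h, hf.nat 2 rfl, hdim]
  · rintro i s' hf hi ⟨h, h7⟩
    have e2 : s'.nat 2 = s.nat 2 := by rw [hf.nat 2 rfl]; funext; simp
    have r2 : s'.real 2 = s.real 2 := by rw [hf.real 2 rfl]; funext; simp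
    have r0 : s'.real 0 = s.real 0 := by rw [hf.real 0 rfl]; funext; simp
    simp only [Prog.wp_seq, Prog.wp_setReal, Prog.wp_setNat]
    refine (locateProg_spec (n := G.len) (by simp [e2, hlen]) (by simpa [r2] using hT)).mono ?_
    rintro t s'' ⟨ht, hf', hc⟩
    have h8 : s''.nat 8 0 = z i := by
      refine hc.unique ?_
      simpa [r2, r0, h] using hz i hi
    have e14 : s''.nat 14 0 = i := by rw [hf'.nat 14 rfl]; simp [h]
    have e7 : s''.real 7 0 = G.key (cells z i) := by rw [hf'.real 7 rfl]; simp [h7]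
    have e2' : s''.nat 2 = s.nat 2 := by rw [hf'.nat 2 rfl]; simp [e2]
    refine ⟨by omega, by simp [e14], ?_⟩
    simp [cells, Ctx.key, e7, e2', hbase, h8]
  · rintro t s' ⟨ht, hf, h, h7⟩
    have e2 : s'.nat 2 = s.nat 2 := by rw [hf.nat 2 rfl]; funext; simp
    have r3 : s'.real 3 = s.real 3 := by rw [hf.real 3 rfl]; funext; simp
    have e1 : s'.nat 1 = s.nat 1 := by rw [hf.nat 1 rfl]; funext; simp
    refine (locateProg_spec (n := c) (by simp [e2, hcard]) (by simpa [r3] using hK)).mono ?_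
    rintro t' s'' ⟨ht', hf', hc⟩
    have e1' : s''.nat 1 = s.nat 1 := by rw [hf'.nat 1 rfl]; simp [e1]
    refine ⟨?_, s''.nat 8 0, ?_, by simp [e1']⟩
    · have e : G.k * G.d * (4 * Nat.log 2 G.len + 10 + 1) =
        G.k * G.d * (4 * Nat.log 2 G.len + 11) := rfl
      omega
    · simpa [r3, h7] using hc

/-- A key that is present in the dictionary is found with one of its curves. -/
theorem IsCut.found {A : ℕ → ℝ} {P : ℕ → ℕ} {n p : ℕ} {x : ℝ} (hp : IsCut A n x p)
    (hA : SortedTo A n) {v : ℕ} (h : (x, v) ∈ pairsIn A P 0 n) :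
    (x, P (p - 1)) ∈ pairsIn A P 0 n := by
  obtain ⟨i, -, hi, e⟩ := h
  obtain ⟨e1, -⟩ := Prod.mk.inj e
  have h1 : i < p := by
    by_contra h
    exact absurd (hp.above i (not_lt.1 h) hi) (by rw [e1]; exact lt_irrefl _)
  have h2 : p ≤ n := hp.le
  refine ⟨p - 1, Nat.zero_le _, by omega, ?_⟩
  rw [Prod.mk.injEq]
  refine ⟨le_antisymm ?_ (hp.below _ (by omega)), rfl⟩
  rw [e1]
  exact hA _ _ (by omega) (by omega)

/-! ### Alignments and the dynamic program -/

/-- `Reach P j l`: there is an alignment of the first `j` and the first `l` points of two curves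
such that all matched pairs satisfy `P`. -/
inductive Reach (P : ℕ → ℕ → Prop) : ℕ → ℕ → Prop
  | zero : Reach P 0 0
  | diag {j l : ℕ} : Reach P j l → P j l → Reach P (j + 1) (l + 1)
  | up {j l : ℕ} : Reach P j (l + 1) → P j l → Reach P (j + 1) (l + 1)
  | right {j l : ℕ} : Reach P (j + 1) l → P j l → Reach P (j + 1) (l + 1)

theorem Reach.mono {P P' : ℕ → ℕ → Prop} {k m : ℕ} (h : Reach P k m)
    (hP : ∀ j < k, ∀ l < m, P j l → P' j l) : Reach P' k m := by
  induction h with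
  | zero => exact .zero
  | diag _ hp ih =>
    exact .diag (ih fun j hj l hl => hP j (by omega) l (by omega)) (hP _ (by omega) _ (by omega) hp)
  | up _ hp ih =>
    exact .up (ih fun j hj l hl => hP j (by omega) l (by omega)) (hP _ (by omega) _ (by omega) hp)
  | right _ hp ih =>
    exact .right (ih fun j hj l hl => hP j (by omega) l (by omega)) (hP _ (by omega) _ (by omega) hp)

/-- The last hop into a pair comes from one of its three predecessors, so the recursive row of the
machine is the row of `Reach`. -/
theorem nextRow_reach (P : ℕ → ℕ → Prop) (j l : ℕ) :
    nextRow (P j) (Reach P j) l ↔ Reach P (j + 1) l := by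
  induction l with
  | zero =>
    constructor
    · exact False.elim
    · intro h; cases h
  | succ l ih =>
    simp only [nextRow]
    rw [ih]
    constructor
    · rintro ⟨h, h1 | h1 | h1⟩
      · exact .up h1 h
      · exact .diag h1 h
      · exact .right h1 h
    · intro h
      cases h with
      | diag a b => exact ⟨b, .inr (.inl a)⟩
      | up a b => exact ⟨b, .inl a⟩
      | right a b => exact ⟨b, .inr (.inr a)⟩

theorem Reach.of_chain {k m : ℕ} {P : ℕ → ℕ → Prop} (τ : List (Fin k × Fin m)) (p q : Fin k × Fin m)
    (hc : (p :: τ).IsChain Hop) (hP : ∀ x ∈ τ, P x.1 x.2) (hq : (p :: τ).getLast? = some q)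
    (h : Reach P (p.1 + 1) (p.2 + 1)) : Reach P (q.1 + 1) (q.2 + 1) := by
  induction τ generalizing p with
  | nil =>
    simp at hq
    rwa [← hq]
  | cons x τ ih =>
    rw [List.isChain_cons_cons] at hc
    refine ih x hc.2 (fun y hy => hP y (by simp [hy])) (by simpa using hq) ?_
    have hx := hP x (by simp)
    rcases hc.1 with ⟨h1, h2⟩ | ⟨h1, h2⟩ | ⟨h1, h2⟩
    · rw [h1, h2] at hx ⊢
      exact .up h hx
    · rw [h1, h2] at hx ⊢
      exact .right h hx
    · rw [h1, h2] at hx ⊢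
      exact .diag h hx

theorem IsAlignment.reach {k m : ℕ} {P : ℕ → ℕ → Prop} {τ : List (Fin k × Fin m)}
    (h : IsAlignment τ) (hP : ∀ x ∈ τ, P x.1 x.2) : Reach P k m := by
  obtain ⟨h0, h1, h2, h3⟩ := h
  cases τ with
  | nil => exact absurd rfl h0
  | cons p τ =>
    obtain ⟨a, b⟩ := h1 p (by simp)
    obtain ⟨q, hq⟩ : ∃ q, (p :: τ).getLast? = some q := ⟨_, List.getLast?_eq_some_getLast h0⟩
    obtain ⟨c, d⟩ := h2 q (by simp [hq])
    have hp := hP p (by simp)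
    have key := Reach.of_chain τ p q h3 (fun x hx => hP x (by simp [hx])) hq (by
      rw [a, b] at hp ⊢
      exact .diag .zero hp)
    rwa [c, d] at key

theorem Reach.exists_chain {k m : ℕ} {P : ℕ → ℕ → Prop} {j l : ℕ} (h : Reach P j l) (hj : j ≤ k)
    (hl : l ≤ m) : (j = 0 ∧ l = 0) ∨ ∃ τ : List (Fin k × Fin m), τ ≠ [] ∧
      (∀ p ∈ τ.head?, p.1.val = 0 ∧ p.2.val = 0) ∧
      (∀ p ∈ τ.getLast?, p.1.val + 1 = j ∧ p.2.val + 1 = l) ∧ τ.IsChain Hop ∧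
      ∀ p ∈ τ, P p.1 p.2 := by
  -- The three hops are treated at once: `(a, b)` is whichever predecessor of the new pair the
  -- alignment so far has reached.
  have append : ∀ {a b j l : ℕ} (τ : List (Fin k × Fin m)) (hj : j < k) (hl : l < m), P j l →
      (a = j + 1 ∧ b = l ∨ a = j ∧ b = l + 1 ∨ a = j ∧ b = l) → τ ≠ [] →
      (∀ p ∈ τ.head?, p.1.val = 0 ∧ p.2.val = 0) →
      (∀ p ∈ τ.getLast?, p.1.val + 1 = a ∧ p.2.val + 1 = b) → τ.IsChain Hop →
      (∀ p ∈ τ, P p.1 p.2) → ∃ τ : List (Fin k × Fin m), τ ≠ [] ∧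
      (∀ p ∈ τ.head?, p.1.val = 0 ∧ p.2.val = 0) ∧
      (∀ p ∈ τ.getLast?, p.1.val + 1 = j + 1 ∧ p.2.val + 1 = l + 1) ∧ τ.IsChain Hop ∧
      ∀ p ∈ τ, P p.1 p.2 := by
    intro a b j l τ hj hl hP hab h0 h1 h2 h3 h4
    refine ⟨τ ++ [(⟨j, hj⟩, ⟨l, hl⟩)], by simp, ?_, by simp, ?_, ?_⟩
    · rw [List.head?_append_of_ne_nil _ h0]
      exact h1
    · refine List.isChain_append.2 ⟨h3, by simp, ?_⟩
      intro x hx y hy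
      obtain ⟨e1, e2⟩ := h2 x hx
      simp at hy
      subst hy
      unfold Hop
      dsimp only
      omega
    · intro p hp
      rcases List.mem_append.1 hp with hp | hp
      · exact h4 p hp
      · simp at hp
        subst hp
        exact hP
  induction h with
  | zero => exact .inl ⟨rfl, rfl⟩
  | @diag j l _ hp ih =>
    right
    rcases ih (by omega) (by omega) with ⟨rfl, rfl⟩ | ⟨τ, h0, h1, h2, h3, h4⟩
    · exact ⟨[(⟨0, by omega⟩, ⟨0, by omega⟩)], by simp, by simp, by simp, by simp, by simpa using hp⟩
    · exact append τ (by omega) (by omega) hp (.inr (.inr ⟨rfl, rfl⟩)) h0 h1 h2 h3 h4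
  | @up j l _ hp ih =>
    right
    obtain ⟨τ, h0, h1, h2, h3, h4⟩ := (ih (by omega) (by omega)).resolve_left (by simp)
    exact append τ (by omega) (by omega) hp (.inr (.inl ⟨rfl, rfl⟩)) h0 h1 h2 h3 h4
  | @right j l _ hp ih =>
    right
    obtain ⟨τ, h0, h1, h2, h3, h4⟩ := (ih (by omega) (by omega)).resolve_left (by simp)
    exact append τ (by omega) (by omega) hp (.inl ⟨rfl, rfl⟩) h0 h1 h2 h3 h4

theorem Reach.exists_alignment {k m : ℕ} {P : ℕ → ℕ → Prop} (hk : 1 ≤ k) (h : Reach P k m) :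
    ∃ τ : List (Fin k × Fin m), IsAlignment τ ∧ ∀ p ∈ τ, P p.1 p.2 := by
  obtain ⟨τ, h0, h1, h2, h3, h4⟩ := (h.exists_chain le_rfl le_rfl).resolve_left (by omega)
  exact ⟨τ, ⟨h0, h1, h2, h3⟩, h4⟩

/-- This supplies at least one alignment, so the infimum in `dfd` is not taken over the empty set.
-/
theorem reach_true {k m : ℕ} (hk : 1 ≤ k) (hm : 1 ≤ m) : Reach (fun _ _ => True) k m := by
  have h1 : ∀ m, Reach (fun _ _ => True) 1 (m + 1) := by
    intro m
    induction m with
    | zero => exact .diag .zero trivial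
    | succ m ih => exact .right ih trivial
  obtain ⟨m, rfl⟩ : ∃ m', m = m' + 1 := ⟨m - 1, by omega⟩
  induction k, hk using Nat.le_induction with
  | base => exact h1 m
  | succ k _ ih => exact .up ih trivial

theorem foldr_max_le_iff {l : List ℝ} {ρ : ℝ} (hρ : 0 ≤ ρ) :
    l.foldr max 0 ≤ ρ ↔ ∀ x ∈ l, x ≤ ρ := by
  induction l with
  | nil => simpa
  | cons x l ih => simp [ih]

theorem foldr_max_mem (l : List ℝ) : l.foldr max 0 = 0 ∨ l.foldr max 0 ∈ l := by
  induction l with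
  | nil => simp
  | cons x l ih =>
    simp only [List.foldr_cons]
    rcases max_choice x (l.foldr max 0) with h | h
    · right; rw [h]; simp
    · rw [h]
      rcases ih with ih | ih
      · exact .inl ih
      · exact .inr (List.mem_cons_of_mem _ ih)

theorem foldr_max_nonneg (l : List ℝ) : 0 ≤ l.foldr max 0 := by
  induction l with
  | nil => simp
  | cons x l ih => exact le_max_of_le_right ih

/-- The infimum in the definition of the discrete Fréchet distance is attained. -/
theorem dfd_le_iff_exists {k m d : ℕ} (hk : 1 ≤ k) (hm : 1 ≤ m) (Q : Curve k d) (C : Curve m d)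
    (ρ : ℝ) : dfd Q C ≤ ρ ↔ ∃ τ : List (Fin k × Fin m), IsAlignment τ ∧ frechetCost Q C τ ≤ ρ := by
  let f : {τ : List (Fin k × Fin m) // IsAlignment τ} → ℝ := fun τ => frechetCost Q C τ
  have hbdd : BddBelow (Set.range f) := ⟨0, by rintro _ ⟨τ, rfl⟩; exact foldr_max_nonneg _⟩
  constructor
  · intro h
    -- A cost is zero or one of the finitely many pairwise distances, so the infimum is a minimum.
    have hfin : (Set.range f).Finite := by
      refine ((Set.finite_range fun p : Fin k × Fin m => dist (Q p.1) (C p.2)).insert 0).subset ?_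
      rintro _ ⟨τ, rfl⟩
      rcases foldr_max_mem ((τ : List (Fin k × Fin m)).map fun p => dist (Q p.1) (C p.2)) with h | h
      · exact .inl h
      · obtain ⟨p, -, hp⟩ := List.mem_map.1 h
        exact .inr ⟨p, hp⟩
    obtain ⟨τ₀, h₀, -⟩ := (reach_true hk hm).exists_alignment hk
    have hne : (Set.range f).Nonempty := ⟨_, ⟨τ₀, h₀⟩, rfl⟩
    obtain ⟨τ, hτ⟩ := hne.csInf_mem hfin
    exact ⟨τ.1, τ.2, hτ.le.trans h⟩
  · rintro ⟨τ, h, hle⟩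
    exact (ciInf_le hbdd ⟨τ, h⟩).trans hle

theorem dfd_le_iff {k m d : ℕ} (hk : 1 ≤ k) (hm : 1 ≤ m) {Q : Curve k d} {C : Curve m d} {ρ : ℝ}
    (hρ : 0 ≤ ρ) {P : ℕ → ℕ → Prop}
    (hP : ∀ (j : Fin k) (l : Fin m), P j l ↔ dist (Q j) (C l) ≤ ρ) :
    dfd Q C ≤ ρ ↔ Reach P k m := by
  have key : ∀ τ : List (Fin k × Fin m), frechetCost Q C τ ≤ ρ ↔ ∀ p ∈ τ, P p.1 p.2 := by
    intro τ
    unfold frechetCost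
    rw [foldr_max_le_iff hρ]
    simp only [List.forall_mem_map, hP]
  rw [dfd_le_iff_exists hk hm]
  constructor
  · rintro ⟨τ, h, hc⟩
    exact h.reach ((key τ).1 hc)
  · intro h
    obtain ⟨τ, h, hc⟩ := h.exists_alignment hk
    exact ⟨τ, h, (key τ).2 hc⟩

/-- An alignment yields monotone maps in both directions. -/
theorem Reach.exists_monotone {P : ℕ → ℕ → Prop} {k m : ℕ} (h : Reach P k m) :
    ∃ f g : ℕ → ℕ, (∀ l < m, f l < k ∧ P (f l) l) ∧ (∀ j < k, g j < m ∧ P j (g j)) ∧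
      (∀ l l', l ≤ l' → l' < m → f l ≤ f l') ∧ ∀ j j', j ≤ j' → j' < k → g j ≤ g j' := by
  -- A monotone map is extended by one value at the end that is at least all earlier ones.
  -- Transposing `P` allows its use in both directions.
  have ext : ∀ {a b : ℕ} {R : ℕ → ℕ → Prop} {f : ℕ → ℕ}, R b a → (∀ l < a, f l ≤ b ∧ R (f l) l) →
      (∀ l l', l ≤ l' → l' < a → f l ≤ f l') → ∃ f' : ℕ → ℕ,
      (∀ l < a + 1, f' l < b + 1 ∧ R (f' l) l) ∧ ∀ l l', l ≤ l' → l' < a + 1 → f' l ≤ f' l' := by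
    intro a b R f hR h1 h2
    refine ⟨fun l => if l = a then b else f l, ?_, ?_⟩
    · intro l hl
      dsimp only
      split_ifs with h
      · subst h; exact ⟨by omega, hR⟩
      · have := h1 l (by omega); exact ⟨by omega, this.2⟩
    · intro l l' hll hl'
      dsimp only
      split_ifs with h h' h'
      · exact le_rfl
      · omega
      · exact (h1 l (by omega)).1
      · exact h2 l l' hll (by omega)
  induction h with
  | zero => exact ⟨id, id, by simp, by simp, by simp, by simp⟩
  | diag _ hp ih =>
    obtain ⟨f, g, h1, h2, h3, h4⟩ := ih
    obtain ⟨f', h1', h3'⟩ := ext (R := P) hp (fun l hl => ⟨(h1 l hl).1.le, (h1 l hl).2⟩) h3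
    obtain ⟨g', h2', h4'⟩ := ext (R := fun l j => P j l) hp
      (fun l hl => ⟨(h2 l hl).1.le, (h2 l hl).2⟩) h4
    exact ⟨f', g', h1', h2', h3', h4'⟩
  | up _ hp ih =>
    obtain ⟨f, g, h1, h2, h3, h4⟩ := ih
    obtain ⟨g', h2', h4'⟩ := ext (R := fun l j => P j l) hp
      (fun l hl => ⟨Nat.le_of_lt_succ (h2 l hl).1, (h2 l hl).2⟩) h4
    exact ⟨f, g', fun l hl => ⟨(h1 l hl).1.trans (Nat.lt_succ_self _), (h1 l hl).2⟩, h2', h3, h4'⟩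
  | right _ hp ih =>
    obtain ⟨f, g, h1, h2, h3, h4⟩ := ih
    obtain ⟨f', h1', h3'⟩ := ext (R := P) hp
      (fun l hl => ⟨Nat.le_of_lt_succ (h1 l hl).1, (h1 l hl).2⟩) h3
    exact ⟨f', g, h1', fun l hl => ⟨(h2 l hl).1.trans (Nat.lt_succ_self _), (h2 l hl).2⟩, h3', h4⟩

/-! ### Squared distances -/

/-- The machine takes no square roots, so every threshold is compared in squared form. -/
theorem sqd_le_iff {d : ℕ} {u v : ℕ → ℝ} {ρ : ℝ} (hρ : 0 ≤ ρ) {x y : EuclideanSpace ℝ (Fin d)}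
    (hx : ∀ a : Fin d, x a = u a) (hy : ∀ a : Fin d, y a = v a) :
    sqd d u v ≤ ρ * ρ ↔ dist x y ≤ ρ := by
  have : sqd d u v = ∑ a : Fin d, dist (x a) (y a) ^ 2 := by
    unfold sqd
    rw [Finset.sum_range]
    refine Finset.sum_congr rfl fun a _ => ?_
    rw [hx, hy, Real.dist_eq, sq_abs, sq]
  rw [EuclideanSpace.dist_eq, Real.sqrt_le_left hρ, ← this, sq]

theorem sqd_triangle {d : ℕ} {u v w : ℕ → ℝ} {ρ σ : ℝ} (hρ : 0 ≤ ρ) (hσ : 0 ≤ σ)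
    (h : sqd d u v ≤ ρ * ρ) (h' : sqd d v w ≤ σ * σ) : sqd d u w ≤ (ρ + σ) * (ρ + σ) := by
  let e : (ℕ → ℝ) → EuclideanSpace ℝ (Fin d) := fun u => WithLp.toLp 2 fun a => u a
  rw [sqd_le_iff hρ (x := e u) (y := e v) (fun _ => rfl) fun _ => rfl] at h
  rw [sqd_le_iff hσ (x := e v) (y := e w) (fun _ => rfl) fun _ => rfl] at h'
  rw [sqd_le_iff (add_nonneg hρ hσ) (x := e u) (y := e w) (fun _ => rfl) fun _ => rfl]
  exact (dist_triangle _ _ _).trans (add_le_add h h')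

theorem sqd_comm (d : ℕ) (u v : ℕ → ℝ) : sqd d u v = sqd d v u :=
  Finset.sum_congr rfl fun _ _ => by ring

/-- If `k` balls of radius `r` visited in order cover the points, then no point is further than `2r`
from its greedy anchor. -/
theorem greedy_close {d k m : ℕ} {c q : ℕ → ℕ → ℝ} {r : ℝ} (hr : 0 ≤ r) {f : ℕ → ℕ}
    (hf : ∀ l < m, f l < k ∧ sqd d (q (f l)) (c l) ≤ r * r)
    (hmono : ∀ l l', l ≤ l' → l' < m → f l ≤ f l') (l : ℕ) (hl : l < m) :
    (greedy d k (4 * r * r) c (l + 1)).1 ≤ f (greedy d k (4 * r * r) c (l + 1)).2 ∧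
      (greedy d k (4 * r * r) c (l + 1)).2 ≤ l ∧
      sqd d (c l) (c (greedy d k (4 * r * r) c (l + 1)).2) ≤ 4 * r * r := by
  have h0 : ∀ u, sqd d u u ≤ 4 * r * r := by
    intro u
    unfold sqd
    simp only [sub_self, mul_zero, Finset.sum_const_zero]
    positivity
  have step : ∀ l < m, (greedy d k (4 * r * r) c l).1 ≤ f (greedy d k (4 * r * r) c l).2 →
      (greedy d k (4 * r * r) c l).2 ≤ l →
      (greedy d k (4 * r * r) c (l + 1)).1 ≤ f (greedy d k (4 * r * r) c (l + 1)).2 ∧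
      (greedy d k (4 * r * r) c (l + 1)).2 ≤ l ∧
      sqd d (c l) (c (greedy d k (4 * r * r) c (l + 1)).2) ≤ 4 * r * r := by
    intro l hl h1 h2
    have hstep : greedy d k (4 * r * r) c (l + 1) =
      if 4 * r * r < sqd d (c l) (c (greedy d k (4 * r * r) c l).2) ∧
        (greedy d k (4 * r * r) c l).1 + 1 < k then ((greedy d k (4 * r * r) c l).1 + 1, l)
      else greedy d k (4 * r * r) c l := rfl
    rw [hstep]
    by_cases hfar : 4 * r * r < sqd d (c l) (c (greedy d k (4 * r * r) c l).2)
    · have hne : f (greedy d k (4 * r * r) c l).2 < f l := by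
        refine lt_of_le_of_ne (hmono _ _ h2 hl) fun heq => ?_
        have a1 := (hf l hl).2
        have a2 := (hf _ (h2.trans_lt hl)).2
        rw [heq] at a2
        rw [sqd_comm] at a1
        have := sqd_triangle hr hr a1 a2
        nlinarith
      have := (hf l hl).1
      -- The anchor number is at most the ball number of the anchor, which is below `f l < k`. Hence
      -- the cap of `k` anchors never prevents a needed one.
      rw [if_pos ⟨hfar, by omega⟩]
      exact ⟨by dsimp only; omega, le_rfl, h0 _⟩
    · rw [if_neg (fun h => hfar h.1)]
      exact ⟨h1, h2, not_lt.1 hfar⟩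
  induction l with
  | zero => exact step 0 hl (Nat.zero_le _) le_rfl
  | succ l ih =>
    obtain ⟨h1, h2, -⟩ := ih (by omega)
    exact step (l + 1) hl h1 (by omega)

/-! ### The candidates of a curve -/

namespace Ctx
variable {G : Ctx}

/-- The corner of the cells of point `j` of a candidate. -/
def corner (G : Ctx) (z : ℕ → ℕ) (j a : ℕ) : ℝ := G.T (z (j * G.d + a) - 1)

theorem rowD_cells (z : ℕ → ℕ) (i j l a : ℕ) (ha : a < G.d) :
    G.rowD i (cells z (j * G.d + a)) l = sqd a (G.corner z j) (G.pt i l) := by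
  induction a with
  | zero =>
    cases j with
    | zero => simp [cells, rowD, sqd]
    | succ j =>
      have e : (j + 1) * G.d + 0 = (j * G.d + (G.d - 1)) + 1 := by rw [Nat.succ_mul]; omega
      rw [e, cells, rowD, length_cells, if_pos]
      · simp [sqd]
      · rw [Nat.mul_add_mod_of_lt (by omega : G.d - 1 < G.d)]
        omega
  | succ a ih =>
    have e : (j * G.d + a) % G.d = a := by
      rw [Nat.mul_add_mod_of_lt (by omega : a < G.d)]
    rw [← add_assoc, cells, rowD, length_cells, e, if_neg (by omega), ih (by omega), sqd, sqd,
      Finset.sum_range_succ]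
    rfl

/-- The row changes only when the last coordinate of a point is appended. At that moment the
accumulated sum of `d - 1` squares plus the new one is the full squared distance. -/
theorem rowH_cells (z : ℕ → ℕ) (i j a : ℕ) (ha : a < G.d) :
    G.rowH i (cells z (j * G.d + a)) =
      Reach (fun j l => sqd G.d (G.corner z j) (G.pt i l) ≤ G.ρ) j := by
  induction j generalizing a with
  | zero =>
    induction a with
    | zero =>
      funext l
      simp only [zero_mul, add_zero, cells, rowH, eq_iff_iff]
      constructor
      · rintro rfl; exact .zero
      · intro h; cases h; rfl
    | succ a ih =>
      funext l
      have e : (0 * G.d + a) % G.d = a := by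
        rw [Nat.mul_add_mod_of_lt (by omega : a < G.d)]
      rw [← add_assoc, cells, rowH, length_cells, e, if_neg (by omega), ih (by omega)]
  | succ j ihj =>
    induction a with
    | zero =>
      funext l
      -- The latest cell in this sequence is the last coordinate of point `j`, not the first of
      -- point `j + 1`.
      have e : (j + 1) * G.d + 0 = (j * G.d + (G.d - 1)) + 1 := by rw [Nat.succ_mul]; omega
      have e' : (j * G.d + (G.d - 1)) % G.d = G.d - 1 := by
        rw [Nat.mul_add_mod_of_lt (by omega : G.d - 1 < G.d)]
      rw [e, cells, rowH, length_cells, e', if_pos (by omega), ihj _ (by omega),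
        ← nextRow_reach]
      congr 1
      funext l
      rw [rowD_cells z i j l _ (by omega)]
      congr 1
      obtain ⟨d, hd⟩ : ∃ d, G.d = d + 1 := ⟨G.d - 1, by omega⟩
      simp only [hd, Nat.add_sub_cancel]
      rw [sqd, sqd, Finset.sum_range_succ]
      simp [corner, hd]
    | succ a ih =>
      funext l
      have e : ((j + 1) * G.d + a) % G.d = a := by
        rw [Nat.mul_add_mod_of_lt (by omega : a < G.d)]
      rw [← add_assoc, cells, rowH, length_cells, e, if_neg (by omega), ih (by omega)]

/-! ### Descending in the search tree -/

theorem mem_of_advance {all : List Node} (hc : ∀ x ∈ all, ∀ y ∈ G.children x, y ∈ all)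
    {i e b w : ℕ} {zs : List ℕ} (c : ℕ) (h : ⟨0, i, zs, e, b, w⟩ ∈ all)
    (hl : zs.length < G.k * G.d) (he : e + c < G.k) : ∃ w, ⟨0, i, zs, e + c, b, w⟩ ∈ all := by
  induction c with
  | zero => exact ⟨w, h⟩
  | succ c ih =>
    obtain ⟨w, hw⟩ := ih (by omega)
    refine ⟨_, hc _ hw ⟨0, i, zs, e + c + 1, b, G.anchorCell ⟨0, i, zs, e + c, b, w⟩⟩ ?_⟩
    unfold children
    rw [if_pos rfl, if_neg hl.ne, if_pos (by dsimp only; omega)]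
    simp

theorem mem_of_walk_up {all : List Node} (hc : ∀ x ∈ all, ∀ y ∈ G.children x, y ∈ all)
    {i e b w : ℕ} {zs : List ℕ} (c : ℕ) (h : ⟨1, i, zs, e, b + c, w⟩ ∈ all) :
    ⟨1, i, zs, e, b, w + c⟩ ∈ all := by
  induction c generalizing w with
  | zero => exact h
  | succ c ih =>
    have : (⟨1, i, zs, e, b + c, w + 1⟩ : Node) ∈ all := by
      refine hc _ h _ ?_
      simp [children]
    have := ih this
    rwa [add_assoc, add_comm 1 c] at this

theorem mem_of_walk_down {all : List Node} (hc : ∀ x ∈ all, ∀ y ∈ G.children x, y ∈ all)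
    {i e b w : ℕ} {zs : List ℕ} (c : ℕ) (h : ⟨3, i, zs, e, b + c, w + c⟩ ∈ all) :
    ⟨3, i, zs, e, b, w⟩ ∈ all := by
  induction c with
  | zero => exact h
  | succ c ih =>
    refine ih (hc _ h _ ?_)
    simp [children]

/-- One of the two truncated differences vanishes, so their sum is the distance from the anchor
cell, and the direction with the nonzero difference spends exactly this much. -/
theorem mem_of_commit {all : List Node} (hc : ∀ x ∈ all, ∀ y ∈ G.children x, y ∈ all)
    {i e b c w z : ℕ} {zs : List ℕ} (h : ⟨0, i, zs, e, b + c, w⟩ ∈ all)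
    (hl : zs.length < G.k * G.d) {z₀ : ℕ}
    (hz₀ : G.Z (i * (G.k * G.d) + e * G.d + zs.length % G.d) = z₀)
    (hcost : z - z₀ + (z₀ - z) = c) : ∃ w, ⟨0, i, z :: zs, e, b, w⟩ ∈ all := by
  have hch : ∀ y ∈ ([⟨1, i, zs, e, b + c, z₀⟩, ⟨3, i, zs, e, b + c, z₀⟩] : List Node), y ∈ all := by
    intro y hy
    refine hc _ h y ?_
    unfold children
    rw [if_pos rfl, if_neg hl.ne]
    exact List.mem_append_left _ (by simpa [anchorCell, hz₀] using hy)
  have commit : ∀ κ, κ ≠ 0 → (⟨κ, i, zs, e, b, z⟩ : Node) ∈ all →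
      ∃ w, (⟨0, i, z :: zs, e, b, w⟩ : Node) ∈ all := by
    intro κ hκ hm
    refine ⟨z, hc _ hm _ ?_⟩
    simp [children, hκ]
  rcases le_total z₀ z with hle | hle
  · refine commit 1 (by simp) ?_
    obtain rfl : z = z₀ + c := by omega
    exact mem_of_walk_up hc c (hch _ (by simp))
  · refine commit 3 (by simp) ?_
    obtain rfl : z₀ = z + c := by omega
    exact mem_of_walk_down hc c (hch _ (by simp))

/-- Since `e` does not decrease, the node can always advance to the required anchor before the next
coordinate. The conclusion allows `e' ≤ e t` because the advance is made only when coordinate `t` is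
about to be read. -/
theorem exists_mem_cells {all : List Node} (hc : ∀ x ∈ all, ∀ y ∈ G.children x, y ∈ all) {i : ℕ}
    (hroot : G.root i ∈ all) {z z₀ e : ℕ → ℕ} (he : Monotone e) (hek : ∀ t, e t < G.k)
    (hz₀ : ∀ t < G.k * G.d, G.Z (i * (G.k * G.d) + e t * G.d + t % G.d) = z₀ t) (t : ℕ)
    (ht : t ≤ G.k * G.d)
    {b : ℕ} (hb : b + ∑ s ∈ Finset.range t, (z s - z₀ s + (z₀ s - z s)) = G.W) :
    ∃ e' ≤ e t, ∃ w, ⟨0, i, cells z t, e', b, w⟩ ∈ all := by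
  induction t generalizing b with
  | zero =>
    simp at hb
    subst hb
    exact ⟨0, Nat.zero_le _, 0, hroot⟩
  | succ t ih =>
    rw [Finset.sum_range_succ] at hb
    obtain ⟨e', he', w, hw⟩ := ih (by omega) (b := b + (z t - z₀ t + (z₀ t - z t))) (by omega)
    obtain ⟨w, hw⟩ := mem_of_advance hc (e t - e') hw (by rw [length_cells]; omega)
      (by have := hek t; omega)
    rw [Nat.add_sub_cancel' he'] at hw
    obtain ⟨w, hw⟩ := mem_of_commit hc hw (z := z t) (by rw [length_cells]; omega)
      (by rw [length_cells]; exact hz₀ t (by omega)) rfl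
    exact ⟨e t, he (Nat.le_succ t), w, hw⟩

end Ctx

/-! ### Cells of nearby numbers -/

/-- Both numbers lie in the stretch of exact grid around `y`. Counted from its start `u`, their
cells are the integer parts of their offsets divided by `δ`, which differ by at most `|x - y| / δ +
1`. -/
theorem Covered.cell {T : ℕ → ℝ} {len : ℕ} {δ x y R : ℝ} {p q : ℕ}
    (hcov : Covered T len δ (y - R) (y + R)) (hx : IsCut T len x p) (hy : IsCut T len y q)
    (hxy : |x - y| < R) : (T (p - 1) ≤ x ∧ x < T (p - 1) + δ) ∧
      δ * ((p - q + (q - p) : ℕ) : ℝ) ≤ |x - y| + δ := by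
  obtain ⟨u, v, huv, hv, hu, hTv, hstep⟩ := hcov
  have hT : ∀ c, u + c ≤ v → T (u + c) = T u + c * δ := by
    intro c
    induction c with
    | zero => simp
    | succ c ih =>
      intro h
      rw [← add_assoc, hstep _ (by omega) (by omega), ih (by omega)]
      push_cast
      ring
  have loc : ∀ {x p}, IsCut T len x p → |x - y| < R → ∃ a : ℕ, p = u + a + 1 ∧
      T (p - 1) = T u + a * δ ∧ T u + a * δ ≤ x ∧ x < T u + (a + 1) * δ := by
    intro x p hx hxy
    rw [abs_lt] at hxy
    have h1 : u < p := by
      by_contra h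
      have := hx.above u (by omega) (by omega)
      linarith
    have h2 : p ≤ v := by
      by_contra h
      have := hx.below v (by omega)
      linarith
    refine ⟨p - 1 - u, by omega, ?_⟩
    have e1 := hT (p - 1 - u) (by omega)
    have e2 := hT (p - 1 - u + 1) (by omega)
    rw [show u + (p - 1 - u) = p - 1 by omega] at e1
    rw [show u + (p - 1 - u + 1) = p by omega] at e2
    push_cast at e2
    refine ⟨e1, ?_, ?_⟩
    · rw [← e1]; exact hx.below _ (by omega)
    · rw [← e2]; exact hx.above _ le_rfl (by omega)
  obtain ⟨a, rfl, ha, ha1, ha2⟩ := loc hx hxy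
  obtain ⟨b, rfl, -, hb1, hb2⟩ := loc hy (by simpa using (abs_nonneg _).trans_lt hxy)
  refine ⟨⟨by rw [ha]; exact ha1, by rw [ha]; linarith⟩, ?_⟩
  have h1 := le_abs_self (x - y)
  have h2 := neg_abs_le (x - y)
  rcases le_total a b with h | h
  · rw [show u + a + 1 - (u + b + 1) + (u + b + 1 - (u + a + 1)) = b - a by omega, Nat.cast_sub h]
    nlinarith
  · rw [show u + a + 1 - (u + b + 1) + (u + b + 1 - (u + a + 1)) = a - b by omega, Nat.cast_sub h]
    nlinarith

/-! ### Correctness of the dictionary -/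

theorem abs_sub_le_of_sqd {d : ℕ} {u v : ℕ → ℝ} {ρ : ℝ} (hρ : 0 ≤ ρ) (h : sqd d u v ≤ ρ * ρ)
    {a : ℕ} (ha : a < d) : |u a - v a| ≤ ρ := by
  have h1 : (u a - v a) * (u a - v a) ≤ sqd d u v :=
    Finset.single_le_sum (f := fun a => (u a - v a) * (u a - v a))
      (fun b _ => mul_self_nonneg _) (Finset.mem_range.2 ha)
  refine abs_le_of_sq_le_sq ?_ hρ
  nlinarith

/-- This is the Cauchy–Schwarz inequality with `√d` replaced by the integer `S`. -/
theorem sum_abs_le_of_sqd {d S : ℕ} {u v : ℕ → ℝ} {ρ : ℝ} (hρ : 0 ≤ ρ) (h : sqd d u v ≤ ρ * ρ)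
    (hS : d ≤ S * S) : ∑ a ∈ Finset.range d, |u a - v a| ≤ S * ρ := by
  refine abs_le_of_sq_le_sq' ?_ (by positivity) |>.2
  have h1 := sq_sum_le_card_mul_sum_sq (s := Finset.range d) (f := fun a => |u a - v a|)
  have h2 : ∑ a ∈ Finset.range d, |u a - v a| ^ 2 = sqd d u v :=
    Finset.sum_congr rfl fun a _ => by rw [sq_abs, sq]
  rw [h2, Finset.card_range] at h1
  have hS' : (d : ℝ) ≤ S * S := by exact_mod_cast hS
  calc _ ≤ (d : ℝ) * sqd d u v := h1
    _ ≤ (S * S) * (ρ * ρ) := by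
      refine mul_le_mul hS' h ?_ (by positivity)
      exact Finset.sum_nonneg fun _ _ => mul_self_nonneg _
    _ = _ := by ring

namespace Built
variable {G : Ctx} {ε r : ℝ} {X : ℕ → ℝ} {S : ℕ} {all : List Node} {s : Store}

theorem one_le_root (B : Built G ε r X S all s) (hd : 1 ≤ G.d) : 1 ≤ S := by
  by_contra h
  obtain rfl : S = 0 := by omega
  have := B.root_ge
  omega

/-- Minimality gives `(S - 1)² < d`, and `S ≤ 2 (S - 1)` unless `S = 1`. -/
theorem root_sq_le (B : Built G ε r X S all s) (hd : 1 ≤ G.d) : S * S ≤ 4 * G.d := by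
  have h1 := B.one_le_root hd
  obtain ⟨q, rfl⟩ : ∃ q, S = q + 1 := ⟨S - 1, by omega⟩
  have := B.root_min q (by omega)
  rcases Nat.eq_zero_or_pos q with rfl | hq
  · omega
  · nlinarith

/-- The corner of the cell of a point is close to the point, and the cell is not far from the cell
of a nearby anchor. -/
theorem point (B : Built G ε r X S all s) (hd : 1 ≤ G.d) (hε : 0 < ε) (hε1 : ε ≤ 1) (hr : 0 < r)
    {x : ℕ → ℝ} {w idx : ℕ → ℕ} (hw : ∀ a < G.d, IsCut G.T G.len (x a) (w a))
    (hidx : ∀ a < G.d, idx a < G.n * (G.k * G.d))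
    (h : sqd G.d x (fun a => X (idx a)) ≤ (3 * r) * (3 * r)) :
    sqd G.d (fun a => G.T (w a - 1)) x ≤ (ε * r / 2) * (ε * r / 2) ∧
      ε * ∑ a ∈ Finset.range G.d, ((w a - G.Z (idx a) + (G.Z (idx a) - w a) : ℕ) : ℝ) ≤
        25 * G.d := by
  have hS := B.one_le_root hd
  have hS' : (0 : ℝ) < S := by exact_mod_cast hS
  have hSd : (G.d : ℝ) ≤ S * S := by exact_mod_cast B.root_ge
  have hdS : (S * S : ℝ) ≤ 4 * G.d := by exact_mod_cast B.root_sq_le hd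
  set δ := ε * r / (2 * S) with hδ
  have hδ0 : 0 < δ := by positivity
  -- The coordinates differ by at most `3r`, and the grid extends to `4r`; the margin gives the
  -- strict inequality that `Covered.cell` needs.
  have hcell := fun a (ha : a < G.d) => (B.covered _ (hidx a ha)).cell (hw a ha)
    (B.cut _ (hidx a ha)) ((abs_sub_le_of_sqd (by positivity) h ha).trans_lt (by linarith))
  constructor
  · calc sqd G.d (fun a => G.T (w a - 1)) x ≤ ∑ a ∈ Finset.range G.d, δ * δ := by
          refine Finset.sum_le_sum fun a ha => ?_
          obtain ⟨⟨h1, h2⟩, -⟩ := hcell a (Finset.mem_range.1 ha)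
          nlinarith
      _ = G.d * (δ * δ) := by simp
      _ ≤ (S * S) * (δ * δ) := by gcongr
      _ = _ := by rw [hδ]; field_simp
  · have h1 : δ * ∑ a ∈ Finset.range G.d, ((w a - G.Z (idx a) + (G.Z (idx a) - w a) : ℕ) : ℝ) ≤
        S * (3 * r) + G.d * δ := by
      rw [Finset.mul_sum]
      calc _ ≤ ∑ a ∈ Finset.range G.d, (|x a - X (idx a)| + δ) :=
            Finset.sum_le_sum fun a ha => (hcell a (Finset.mem_range.1 ha)).2
        _ = ∑ a ∈ Finset.range G.d, |x a - X (idx a)| + G.d * δ := by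
            rw [Finset.sum_add_distrib]; simp
        _ ≤ _ := add_le_add_left (sum_abs_le_of_sqd (by positivity) h B.root_ge) _
    set Y := ∑ a ∈ Finset.range G.d, ((w a - G.Z (idx a) + (G.Z (idx a) - w a) : ℕ) : ℝ)
    -- This factor turns `δ` into `ε` and the bound into `6S² + εd`, at most `24d + d` because `S² ≤
    -- 4d` and `ε ≤ 1`.
    have e : ε * Y = (2 * S / r) * (δ * Y) := by rw [hδ]; field_simp
    calc ε * Y = (2 * S / r) * (δ * Y) := e
      _ ≤ (2 * S / r) * (S * (3 * r) + G.d * δ) := by gcongr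
      _ = 6 * (S * S) + ε * G.d := by rw [hδ]; field_simp; ring
      _ ≤ 25 * G.d := by nlinarith

/-- The alignment assigns query point `j` to the curve point `g j`, and through it to the anchor
current after that point. Monotonicity of `g` orders the anchors, monotonicity of `f` keeps them
within `2r`, and `point` bounds the total displacement by the budget. The tree therefore has a path
spelling the cells of the query, and its leaf passes the test. -/
theorem complete (B : Built G ε r X S all s) (hd : 1 ≤ G.d) (hk : 1 ≤ G.k) (hε : 0 < ε)
    (hε1 : ε ≤ 1) (hr : 0 < r) {x : ℕ → ℝ} {z : ℕ → ℕ}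
    (hz : ∀ t < G.k * G.d, IsCut G.T G.len (x t) (z t)) {i : ℕ} (hi : i < G.n)
    (h : Reach (fun j l => sqd G.d (fun a => x (j * G.d + a)) (G.pt i l) ≤ r * r) G.k G.m) :
    (∀ j < G.k, sqd G.d (G.corner z j) (fun a => x (j * G.d + a)) ≤
      (ε * r / 2) * (ε * r / 2)) ∧
    (G.key (cells z (G.k * G.d)), i) ∈ all.flatMap G.output := by
  obtain ⟨f, g, hf, hg, hfm, hgm⟩ := h.exists_monotone
  let ψ : ℕ → ℕ := fun j => (greedy G.d G.k (4 * r * r) (G.pt i) (g j + 1)).1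
  -- The minimum makes `e` monotone everywhere, as `g` is controlled only below `k`.
  let e : ℕ → ℕ := fun t => ψ (min (t / G.d) (G.k - 1))
  have hek : ∀ t, e t < G.k := fun t => greedy_fst_lt hk _ _ _
  have hem : Monotone e := by
    intro t t' htt
    refine greedy_fst_mono _ _ _ _ (Nat.add_le_add_right (hgm _ _ ?_ (by omega)) 1)
    exact min_le_min_right _ (Nat.div_le_div_right htt)
  have hdiv : ∀ j a, a < G.d → (j * G.d + a) / G.d = j := by
    intro j a ha
    rw [Nat.add_comm, Nat.add_mul_div_right _ _ (by omega), Nat.div_eq_of_lt ha, zero_add]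
  have hmod : ∀ j a, a < G.d → (j * G.d + a) % G.d = a := fun j a ha => Nat.mul_add_mod_of_lt ha
  let idx : ℕ → ℕ := fun t => i * (G.k * G.d) + e t * G.d + t % G.d
  have hidx : ∀ t, idx t < G.n * (G.k * G.d) := by
    intro t
    have h1 := Nat.mul_le_mul_right G.d (Nat.succ_le_of_lt (hek t))
    have h2 := Nat.mul_le_mul_right (G.k * G.d) (Nat.succ_le_of_lt hi)
    have h3 := Nat.mod_lt t hd
    rw [Nat.succ_mul] at h1 h2
    dsimp only [idx]
    omega
  have hX : ∀ j < G.k, ∀ a < G.d, X (idx (j * G.d + a)) =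
      G.pt i (greedy G.d G.k (4 * r * r) (G.pt i) (g j + 1)).2 a := by
    intro j hj a ha
    have := B.anchors i hi (g j + 1) (hg j hj).1 a ha
    rw [← this]
    dsimp only [idx, e, ψ]
    rw [hdiv j a ha, hmod j a ha, min_eq_left (by omega)]
  have hlt : ∀ j < G.k, ∀ a < G.d, j * G.d + a < G.k * G.d := by
    intro j hj a ha
    have h1 := Nat.mul_le_mul_right G.d (Nat.succ_le_of_lt hj)
    rw [Nat.succ_mul] at h1
    omega
  have hclose : ∀ j < G.k, sqd G.d (fun a => x (j * G.d + a)) (fun a => X (idx (j * G.d + a))) ≤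
      (3 * r) * (3 * r) := by
    intro j hj
    have h1 := (hg j hj).2
    have h2 := (greedy_close (q := fun j a => x (j * G.d + a)) hr.le hf hfm (g j) (hg j hj).1).2.2
    -- From the query point to its curve point is at most `r`, from there to the anchor at most
    -- `2r`.
    have h3 := sqd_triangle hr.le (by positivity : 0 ≤ 2 * r) h1 (h2.trans_eq (by ring))
    have h4 : sqd G.d (fun a => x (j * G.d + a)) (fun a => X (idx (j * G.d + a))) =
        sqd G.d (fun a => x (j * G.d + a))
          (G.pt i (greedy G.d G.k (4 * r * r) (G.pt i) (g j + 1)).2) := by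
      refine Finset.sum_congr rfl fun a ha => ?_
      dsimp only
      rw [hX j hj a (Finset.mem_range.1 ha)]
    rw [h4]
    exact h3.trans_eq (by ring)
  have hpoint := fun j (hj : j < G.k) => B.point hd hε hε1 hr (w := fun a => z (j * G.d + a))
    (idx := fun a => idx (j * G.d + a)) (fun a ha => hz _ (hlt j hj a ha)) (fun a _ => hidx _)
    (hclose j hj)
  refine ⟨fun j hj => (hpoint j hj).1, ?_⟩
  have hsum : ∀ j ≤ G.k, ε * ∑ t ∈ Finset.range (j * G.d),
      ((z t - G.Z (idx t) + (G.Z (idx t) - z t) : ℕ) : ℝ) ≤ 25 * (j * G.d) := by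
    intro j hj
    induction j with
    | zero => simp
    | succ j ih =>
      rw [Nat.succ_mul, Finset.sum_range_add, mul_add]
      have := ih (by omega)
      have := (hpoint j hj).2
      push_cast at *
      linarith
  have hbudget : ∑ t ∈ Finset.range (G.k * G.d), (z t - G.Z (idx t) + (G.Z (idx t) - z t)) ≤
      G.W := by
    have h1 := hsum G.k le_rfl
    have h2 := B.budget_ge
    push_cast at h2
    rw [← Nat.cast_sum] at h1
    have h3 := h1.trans h2
    rw [mul_comm] at h3
    exact_mod_cast le_of_mul_le_mul_right h3 hε
  obtain ⟨b, hb⟩ := Nat.exists_eq_add_of_le hbudget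
  obtain ⟨e', -, w, hmem⟩ := Ctx.exists_mem_cells B.closed (B.roots i hi) hem hek
    (z := z) (z₀ := fun t => G.Z (idx t)) (fun _ _ => rfl) (G.k * G.d) le_rfl (b := b)
    (by omega)
  refine List.mem_flatMap.2 ⟨_, hmem, ?_⟩
  unfold Ctx.output
  rw [if_pos]
  · simp
  · refine ⟨rfl, length_cells _ _, ?_⟩
    have := G.rowH_cells z i G.k 0 hd
    rw [add_zero] at this
    dsimp only
    rw [this, B.close]
    -- The same alignment serves the corner curve, with `ε r / 2` added to each matched distance.
    refine h.mono fun j hj l hl hjl => ?_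
    have := sqd_triangle (by positivity) hr.le (hpoint j hj).1 hjl
    exact this.trans_eq (by ring)

/-- The curve found need not be the promised one. But equal keys mean equal cells, so its acceptance
test was made for the very corner curve that is within `ε r / 2` of the query. -/
theorem correct (B : Built G ε r X S all s) (hd : 1 ≤ G.d) (hk : 1 ≤ G.k) (hε : 0 < ε)
    (hε1 : ε ≤ 1) (hr : 0 < r) {x : ℕ → ℝ} {z : ℕ → ℕ}
    (hz : ∀ t < G.k * G.d, IsCut G.T G.len (x t) (z t)) {i : ℕ} (hi : i < G.n)
    (h : Reach (fun j l => sqd G.d (fun a => x (j * G.d + a)) (G.pt i l) ≤ r * r) G.k G.m) {p : ℕ}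
    (hp : IsCut (s.real 3) (all.flatMap G.output).length (G.key (cells z (G.k * G.d))) p) :
    s.nat 1 (p - 1) < G.n ∧
      Reach (fun j l => sqd G.d (fun a => x (j * G.d + a)) (G.pt (s.nat 1 (p - 1)) l) ≤
        ((1 + ε) * r) * ((1 + ε) * r)) G.k G.m ∧ p - 1 < (all.flatMap G.output).length := by
  obtain ⟨hcorner, hmem⟩ := B.complete hd hk hε hε1 hr hz hi h
  have hmem' : (G.key (cells z (G.k * G.d)), i) ∈
      pairsIn (s.real 3) (s.nat 1) 0 (all.flatMap G.output).length := by
    rw [B.keys]; exact hmem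
  have hfound := hp.found B.keys_sorted hmem'
  rw [B.keys] at hfound
  obtain ⟨y, hy, hout⟩ := List.mem_flatMap.1 hfound
  unfold Ctx.output at hout
  split_ifs at hout with hc
  · obtain ⟨hc1, hc2, hc3⟩ := hc
    rw [List.mem_singleton, Prod.mk.injEq] at hout
    obtain ⟨hkey, hcur⟩ := hout
    have hv := B.valid y hy
    have hzs : cells z (G.k * G.d) = y.zs := by
      refine Ctx.key_injective (by rw [length_cells, hc2]) ?_ hv.digits hkey
      intro w hw
      obtain ⟨t, ht, rfl⟩ := mem_cells hw
      exact (hz t ht).le.trans (Nat.le_add_right _ _)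
    refine ⟨hcur ▸ hv.cur_lt, ?_, ?_⟩
    · rw [← hzs] at hc3
      have := G.rowH_cells z y.cur G.k 0 hd
      rw [add_zero] at this
      rw [this, B.close] at hc3
      rw [hcur]
      refine hc3.mono fun j hj l hl hjl => ?_
      have h1 := hcorner j hj
      rw [sqd_comm] at h1
      exact (sqd_triangle (by positivity) (by positivity) h1 hjl).trans_eq (by ring)
    · have := hp.le
      have : 0 < (all.flatMap G.output).length := List.length_pos_of_mem hmem
      omega
  · simp at hout

end Built

/-! ### The input of the programs -/

theorem getD_flatten_ofFn {n L : ℕ} (f : Fin n → List ℝ) (hL : ∀ i, (f i).length = L) (i : Fin n)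
    {a : ℕ} (ha : a < L) : (List.ofFn f).flatten.getD (i * L + a) 0 = (f i).getD a 0 := by
  induction n with
  | zero => exact i.elim0
  | succ n ih =>
    rw [List.ofFn_succ, List.flatten_cons]
    rcases Fin.eq_zero_or_eq_succ i with rfl | ⟨i, rfl⟩
    · rw [List.getD_append _ _ _ _ (by simpa [hL] using ha)]
      simp
    · have e : (i.succ : ℕ) * L + a - L = i * L + a := by
        rw [Fin.val_succ, Nat.succ_mul]; omega
      rw [List.getD_append_right _ _ _ _ (by rw [hL, Fin.val_succ, Nat.succ_mul]; omega), hL, e]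
      exact ih (fun i => f i.succ) (fun i => hL _) i

theorem Curve.length_coords {m d : ℕ} (P : Curve m d) : P.coords.length = m * d := by
  unfold Curve.coords
  rw [List.length_flatten, List.map_ofFn]
  have : List.length ∘ (fun j : Fin m => List.ofFn fun a : Fin d => P j a) = fun _ => d := by
    funext j
    simp
  rw [this]
  simp

theorem Curve.getD_coords {m d : ℕ} (P : Curve m d) (j : Fin m) (a : Fin d) :
    P.coords.getD (j * d + a) 0 = P j a := by
  unfold Curve.coords
  rw [getD_flatten_ofFn _ (fun i => List.length_ofFn) j a.2]
  simp [List.getD_eq_getElem?_getD]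

theorem preprocessInput_real_one {n m d : ℕ} (C : Fin n → Curve m d) (k : ℕ) (ε r : ℝ) (i : Fin n)
    (l : Fin m) (a : Fin d) :
    (preprocessInput C k ε r).real 1 (i * (m * d) + l * d + a) = C i l a := by
  have h1 := Nat.mul_le_mul_right d (Nat.succ_le_of_lt l.2)
  rw [Nat.succ_mul] at h1
  have ha := a.2
  show (List.ofFn fun l : Fin n => (C l).coords).flatten.getD _ 0 = _
  rw [add_assoc, getD_flatten_ofFn _ (fun i => (C i).length_coords) i (by omega),
    Curve.getD_coords]

/-! ### Complexity -/

theorem natLog_le {N : ℕ} {x : ℝ} (h : (N : ℝ) ≤ x) (hx : 1 ≤ x) :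
    (Nat.log 2 N : ℝ) ≤ 2 * Real.log x := by
  have h0 : 0 ≤ Real.log x := Real.log_nonneg hx
  rcases Nat.eq_zero_or_pos N with rfl | hN
  · simpa using h0
  · have h1 : ((2 : ℝ) ^ Nat.log 2 N) ≤ x := by
      refine le_trans ?_ h
      exact_mod_cast Nat.pow_log_le_self 2 hN.ne'
    have h2 := Real.log_le_log (by positivity) h1
    rw [Real.log_pow] at h2
    -- The factor `2` comes from `log 2 > 1/2`.
    have h3 := Real.log_two_gt_d9
    have h4 : (0 : ℝ) ≤ Nat.log 2 N := Nat.cast_nonneg _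
    nlinarith

theorem cast_le_two_pow (K : ℕ) : (K : ℝ) ≤ 2 ^ K := by
  exact_mod_cast Nat.lt_two_pow_self.le

/-- Here `(1 + ε)^W ≤ exp (εW) ≤ exp (26kd) ≤ 3^(26kd)`. The powers of `2` and `18/ε` contribute the
factor `36/ε` to the base. -/
theorem Ctx.total_le {G : Ctx} {ε : ℝ} (hk : 1 ≤ G.k) (hd : 1 ≤ G.d) (hε : 0 < ε)
    (hW : G.W * ε ≤ 26 * ((G.k * G.d : ℕ) : ℝ)) :
    G.total ε ≤ (36 * 3 ^ 26 / ε) ^ (G.k * G.d) := by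
  have h1 : (2 : ℝ) ^ (G.k - 1) ≤ 2 ^ (G.k * G.d) := by
    refine pow_le_pow_right₀ (by norm_num) ?_
    have := Nat.mul_le_mul_left G.k hd
    omega
  have h2 : (1 + ε) ^ G.W ≤ (3 ^ 26) ^ (G.k * G.d) := by
    calc (1 + ε) ^ G.W ≤ Real.exp ε ^ G.W := by
          gcongr
          linarith [Real.add_one_le_exp ε]
      _ = Real.exp (G.W * ε) := by rw [← Real.exp_nat_mul]
      _ ≤ Real.exp ((26 * (G.k * G.d) : ℕ) * 1) := by
          refine Real.exp_le_exp.2 (hW.trans_eq ?_)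
          push_cast
          ring
      _ = Real.exp 1 ^ (26 * (G.k * G.d)) := by rw [← Real.exp_nat_mul]
      _ ≤ 3 ^ (26 * (G.k * G.d)) := by
          gcongr
          exact Real.exp_one_lt_three.le
      _ = _ := by rw [pow_mul]
  unfold total
  calc _ ≤ (2 : ℝ) ^ (G.k * G.d) * (18 / ε) ^ (G.k * G.d) * (3 ^ 26) ^ (G.k * G.d) := by gcongr
    _ = _ := by
      rw [← mul_pow, ← mul_pow]
      congr 1
      ring

/-! ### Explicit bounds for time, space and query time -/

namespace Built
variable {G : Ctx} {ε r : ℝ} {X : ℕ → ℝ} {S : ℕ} {all : List Node} {s : Store}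

theorem budget_le (B : Built G ε r X S all s) (hd : 1 ≤ G.d) (hk : 1 ≤ G.k)
    (hε1 : ε ≤ 1) : G.W * ε ≤ 26 * ((G.k * G.d : ℕ) : ℝ) := by
  have hK : (1 : ℝ) ≤ ((G.k * G.d : ℕ) : ℝ) := by exact_mod_cast Nat.mul_pos hk hd
  rcases Nat.eq_zero_or_pos G.W with h | h
  · rw [h]; simp only [Nat.cast_zero, zero_mul]; positivity
  · have := B.budget_min (G.W - 1) (by omega)
    rw [Nat.cast_sub h] at this
    push_cast at this hK ⊢
    linarith

theorem root_le (B : Built G ε r X S all s) (hd : 1 ≤ G.d) (hk : 1 ≤ G.k) :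
    (S : ℝ) ≤ 4 * ((G.k * G.d : ℕ) : ℝ) := by
  have h1 := B.root_sq_le hd
  have h2 := B.one_le_root hd
  have h3 : S ≤ 4 * (G.k * G.d) := by nlinarith
  exact_mod_cast h3

theorem ceil_le (B : Built G ε r X S all s) (hd : 1 ≤ G.d) (hk : 1 ≤ G.k) (hε : 0 < ε)
    (hε1 : ε ≤ 1) : (⌈16 * S / ε⌉₊ : ℝ) ≤ 65 * ((G.k * G.d : ℕ) : ℝ) * (1 / ε) := by
  have hK : (1 : ℝ) ≤ ((G.k * G.d : ℕ) : ℝ) := by exact_mod_cast Nat.mul_pos hk hd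
  have hE : 1 ≤ 1 / ε := by rw [le_div_iff₀ hε]; linarith
  have h1 := (Nat.ceil_lt_add_one (by positivity : 0 ≤ 16 * (S : ℝ) / ε)).le
  have h2 := B.root_le hd hk
  calc _ ≤ 16 * S * (1 / ε) + 1 * 1 := by rw [mul_one_div, mul_one]; exact h1
    _ ≤ 16 * (4 * ((G.k * G.d : ℕ) : ℝ)) * (1 / ε) + ((G.k * G.d : ℕ) : ℝ) * (1 / ε) := by gcongr
    _ = _ := by ring

/-- For the `kd` lookups of a query the logarithm of the table length must be `O(1 + log (nkd/ε))`,
which this polynomial bound provides. The exponential bound `len_le_pow` suffices for the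
preprocessing. -/
theorem len_le_sq (B : Built G ε r X S all s) (hd : 1 ≤ G.d) (hk : 1 ≤ G.k) (hε : 0 < ε)
    (hε1 : ε ≤ 1) : (G.len : ℝ) ≤ 66 * G.n * ((G.k * G.d : ℕ) : ℝ) ^ 2 * (1 / ε) := by
  have hK : (1 : ℝ) ≤ ((G.k * G.d : ℕ) : ℝ) := by exact_mod_cast Nat.mul_pos hk hd
  have hE : 1 ≤ 1 / ε := by rw [le_div_iff₀ hε]; linarith
  have h1 := B.ceil_le hd hk hε hε1
  have h2 : (G.len : ℝ) ≤ G.n * ((G.k * G.d : ℕ) : ℝ) * (⌈16 * S / ε⌉₊ + 1 * 1) := by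
    rw [mul_one]
    exact_mod_cast B.len_le
  calc _ ≤ _ := h2
    _ ≤ G.n * ((G.k * G.d : ℕ) : ℝ) * (65 * ((G.k * G.d : ℕ) : ℝ) * (1 / ε) +
      ((G.k * G.d : ℕ) : ℝ) * (1 / ε)) := by gcongr
    _ = _ := by ring

theorem len_le_pow (B : Built G ε r X S all s) (hd : 1 ≤ G.d) (hk : 1 ≤ G.k) (hε : 0 < ε)
    (hε1 : ε ≤ 1) : (G.len : ℝ) ≤ G.n * (36 * 3 ^ 26 / ε) ^ (G.k * G.d) := by
  have h := B.len_le_sq hd hk hε hε1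
  have hE : 1 ≤ 1 / ε := by rw [le_div_iff₀ hε]; linarith
  have hK : 1 ≤ G.k * G.d := Nat.mul_pos hk hd
  have h2 := cast_le_two_pow (G.k * G.d)
  calc (G.len : ℝ) ≤ 66 * G.n * ((G.k * G.d : ℕ) : ℝ) ^ 2 * (1 / ε) := h
    _ ≤ 66 ^ (G.k * G.d) * G.n * (2 ^ (G.k * G.d)) ^ 2 * (1 / ε) ^ (G.k * G.d) := by
      gcongr
      · exact le_self_pow₀ (by norm_num) (by omega)
      · exact le_self_pow₀ hE (by omega)
    _ = G.n * (66 ^ (G.k * G.d) * (2 ^ (G.k * G.d)) ^ 2 * (1 / ε) ^ (G.k * G.d)) := by ring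
    _ = G.n * (66 * 2 ^ 2 * (1 / ε)) ^ (G.k * G.d) := by
      rw [pow_right_comm, ← mul_pow, ← mul_pow]
    _ ≤ G.n * (36 * 3 ^ 26 * (1 / ε)) ^ (G.k * G.d) := by
      have : (66 * 2 ^ 2 : ℝ) ≤ 36 * 3 ^ 26 := by norm_num
      gcongr
    _ = _ := by rw [mul_one_div]

theorem card_le (B : Built G ε r X S all s) (hd : 1 ≤ G.d) (hk : 1 ≤ G.k) (hε : 0 < ε)
    (hε1 : ε ≤ 1) :
    ((all.flatMap G.output).length : ℝ) ≤ G.n * (36 * 3 ^ 26 / ε) ^ (G.k * G.d) := by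
  have h1 : ((all.flatMap G.output).length : ℝ) ≤ all.length := by
    exact_mod_cast G.length_output_le all
  refine h1.trans (B.size.trans ?_)
  have := Ctx.total_le hk hd hε (B.budget_le hd hk hε1)
  gcongr

end Built

theorem log_const_le : Real.log (36 * 3 ^ 26) ≤ 87 := by
  rw [Real.log_mul (by norm_num) (by norm_num), Real.log_pow]
  have h1 := Real.log_le_sub_one_of_pos (by norm_num : (0 : ℝ) < 36)
  have h2 := Real.log_le_sub_one_of_pos (by norm_num : (0 : ℝ) < 3)
  push_cast
  linarith

theorem log_div_nonneg {n : ℕ} {ε : ℝ} (hn : 1 ≤ n) (hε : 0 < ε) (hε1 : ε ≤ 1) :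
    0 ≤ Real.log (n / ε) := by
  have hn' : (1 : ℝ) ≤ n := by exact_mod_cast hn
  refine Real.log_nonneg ?_
  rw [le_div_iff₀ hε]
  linarith

/-- The constant `174` is twice the bound `87` for the logarithm of `36 · 3^26`. -/
theorem natLog_le_of_le_pow {n K N : ℕ} {ε : ℝ} (hn : 1 ≤ n) (hK : 1 ≤ K) (hε : 0 < ε)
    (hε1 : ε ≤ 1) (h : (N : ℝ) ≤ n * (36 * 3 ^ 26 / ε) ^ K) :
    (Nat.log 2 N : ℝ) ≤ 174 * K * (1 + Real.log (n / ε)) := by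
  have hn' : (1 : ℝ) ≤ n := by exact_mod_cast hn
  have hK' : (1 : ℝ) ≤ K := by exact_mod_cast hK
  have hA : (1 : ℝ) ≤ 36 * 3 ^ 26 / ε := by rw [le_div_iff₀ hε]; linarith
  have h1 := natLog_le h (one_le_mul_of_one_le_of_one_le hn' (one_le_pow₀ hA))
  refine h1.trans ?_
  have hl := log_div_nonneg hn hε hε1
  have hln : 0 ≤ Real.log n := Real.log_nonneg hn'
  rw [Real.log_mul (by positivity) (by positivity), Real.log_pow,
    Real.log_div (by positivity) hε.ne']
  rw [Real.log_div (by positivity) hε.ne'] at hl ⊢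
  have hA' := log_const_le
  have h2 : Real.log n ≤ K * Real.log n := le_mul_of_one_le_left hln hK'
  have h3 : (K : ℝ) * Real.log (36 * 3 ^ 26) ≤ K * 87 := by gcongr
  have h4 : 0 ≤ (K : ℝ) * (Real.log n - Real.log ε) := by positivity
  nlinarith

/-- Constant factors move into the base of the exponential because the exponent `kd` is at least
one. -/
theorem mul_pow_le_mul_pow {a x : ℝ} {K : ℕ} (ha : 1 ≤ a) (hx : 0 ≤ x) (hK : 1 ≤ K) :
    a * x ^ K ≤ (a * x) ^ K := by
  rw [mul_pow]
  gcongr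
  exact le_self_pow₀ ha (by omega)

/-- The dominating term of the running time of the preprocessing. -/
def timeScale (n m K : ℕ) (ε : ℝ) : ℝ :=
  n * m * (1 + Real.log (n / ε)) * (2 ^ 2 * (36 * 3 ^ 26 / ε)) ^ K

/-- Each summand of the running time is a constant times one of these monomials. Here `Λ` stands for
`1 + log (n/ε)`, `E` for `1/ε`, `U` for `(36 · 3^26 / ε)^K` and `V` for `2^K`; two factors `V`
absorb up to two factors `K`. -/
theorem monomials_le {n m Λ K E U V R : ℝ} (hn : 1 ≤ n) (hm : 1 ≤ m) (hΛ : 1 ≤ Λ) (hK : 1 ≤ K)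
    (hE : 1 ≤ E) (hEU : E ≤ U) (hV : K ≤ V) (hR : R = n * m * Λ * (V ^ 2 * U)) :
    (1 ≤ R ∧ m ≤ R ∧ n ≤ R ∧ K * E ≤ R ∧ n * m * K ≤ R) ∧ n * K ≤ R ∧ n * Λ * K ^ 2 ≤ R ∧
      n * (K ^ 2 * E) ≤ R ∧ n * m * U ≤ R ∧ n * Λ * (K * U) ≤ R := by
  have hU : 1 ≤ U := hE.trans hEU
  have hV1 : 1 ≤ V := hK.trans hV
  have hKV : K ≤ V ^ 2 := hV.trans (le_self_pow₀ hV1 (by norm_num))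
  have hV2 : 1 ≤ V ^ 2 := one_le_pow₀ hV1
  have hle : ∀ {a b l x y : ℝ}, a ≤ n → b ≤ m → l ≤ Λ → x ≤ V ^ 2 → y ≤ U → 0 ≤ b → 0 ≤ l →
      0 ≤ x → 0 ≤ y → a * b * l * (x * y) ≤ R := by
    intro a b l x y h1 h2 h3 h4 h5 h6 h7 h8 h9
    rw [hR]
    gcongr
  have z : (0 : ℝ) ≤ 1 := zero_le_one
  have zm : 0 ≤ m := z.trans hm
  have zK : 0 ≤ K := z.trans hK
  have zE : 0 ≤ E := z.trans hE
  have zU : 0 ≤ U := z.trans hU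
  have zΛ : 0 ≤ Λ := z.trans hΛ
  refine ⟨⟨?_, ?_, ?_, ?_, ?_⟩, ?_, ?_, ?_, ?_, ?_⟩
  · exact (hle hn hm hΛ hV2 hU z z z z).trans_eq' (by ring)
  · exact (hle hn le_rfl hΛ hV2 hU zm z z z).trans_eq' (by ring)
  · exact (hle le_rfl hm hΛ hV2 hU z z z z).trans_eq' (by ring)
  · exact (hle hn hm hΛ hKV hEU z z zK zE).trans_eq' (by ring)
  · exact (hle le_rfl le_rfl hΛ hKV hU zm z zK z).trans_eq' (by ring)
  · exact (hle le_rfl hm hΛ hKV hU z z zK z).trans_eq' (by ring)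
  · exact (hle le_rfl hm le_rfl (pow_le_pow_left₀ zK hV 2) hU z zΛ (by positivity) z).trans_eq'
      (by ring)
  · exact (hle le_rfl hm hΛ (pow_le_pow_left₀ zK hV 2) hEU z z (by positivity) zE).trans_eq'
      (by ring)
  · exact (hle le_rfl le_rfl hΛ hV2 le_rfl zm z z zU).trans_eq' (by ring)
  · exact (hle le_rfl hm le_rfl hKV le_rfl z zΛ zK zU).trans_eq' (by ring)

theorem time_bound {n m k d Λ K E U V b c lN llen lcnt cnt f : ℝ} (hn : 1 ≤ n) (hm : 1 ≤ m)
    (hΛ : 1 ≤ Λ) (hK : 1 ≤ K) (hE : 1 ≤ E) (hEU : E ≤ U) (hV : K ≤ V) (hk : k ≤ K) (hd : d ≤ K)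
    (hb : b ≤ 26 * K * E) (hc : c ≤ 65 * K * E) (hlN : lN ≤ 174 * K * Λ)
    (hllen : llen ≤ 174 * K * Λ) (hlcnt : lcnt ≤ 174 * K * Λ) (hcnt : cnt ≤ n * U)
    (hf : f ≤ n * U) (hcnt0 : 0 ≤ cnt) :
    (3 * k + 2 * d + 2 * b + 8) + ((n * (m * (6 * d + 11) + 3 * d + 9) + 4) +
      ((3 * (n * K) + 3) + (((lN + 1) * (16 * (n * K) + 6) + 2) + ((n * K * (3 * c + 6) + 2) +
      ((n * K * (4 * llen + 11) + 2) + (1 + ((3 * m + 3) + (16 + ((16 * n + 1) +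
      ((f * (8 * m + 65) + 1) + (1 + (((lcnt + 1) * (16 * cnt + 6) + 2) + 1))))))))))))
      ≤ 10000 * (n * m * Λ * (V ^ 2 * U)) := by
  obtain ⟨⟨r0, rm, rn, rKE, rnmK⟩, rnK, rnKKΛ, rnKKE, rnmU, rnΛKU⟩ :=
    monomials_le hn hm hΛ hK hE hEU hV rfl
  generalize n * m * Λ * (V ^ 2 * U) = R at *
  have hU : 1 ≤ U := hE.trans hEU
  have hKE : K ≤ K * E := le_mul_of_one_le_right (by positivity) hE
  have hKΛ : 1 ≤ K * Λ := one_le_mul_of_one_le_of_one_le hK hΛ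
  have hnK : 1 ≤ n * K := one_le_mul_of_one_le_of_one_le hn hK
  have hnU : 1 ≤ n * U := one_le_mul_of_one_le_of_one_le hn hU
  have hmK : 1 ≤ m * K := one_le_mul_of_one_le_of_one_le hm hK
  have hKmK : K ≤ m * K := le_mul_of_one_le_left (by positivity) hm
  have t1 : 3 * k + 2 * d + 2 * b + 8 ≤ 65 * R := by linarith
  have t2 : n * (m * (6 * d + 11) + 3 * d + 9) ≤ 29 * R := by
    calc _ ≤ n * (m * (6 * K + 11 * K) + 3 * (m * K) + 9 * (m * K)) := by
          gcongr <;> linarith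
      _ = 29 * (n * m * K) := by ring
      _ ≤ _ := by gcongr
  have t4 : (lN + 1) * (16 * (n * K) + 6) ≤ 3850 * R := by
    calc _ ≤ (175 * (K * Λ)) * (22 * (n * K)) := by gcongr <;> linarith
      _ = 3850 * (n * Λ * K ^ 2) := by ring
      _ ≤ _ := by gcongr
  have t5 : n * K * (3 * c + 6) ≤ 201 * R := by
    calc _ ≤ n * K * (201 * (K * E)) := by gcongr; linarith
      _ = 201 * (n * (K ^ 2 * E)) := by ring
      _ ≤ _ := by gcongr
  have t6 : n * K * (4 * llen + 11) ≤ 707 * R := by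
    calc _ ≤ n * K * (707 * (K * Λ)) := by gcongr; linarith
      _ = 707 * (n * Λ * K ^ 2) := by ring
      _ ≤ _ := by gcongr
  have t11 : f * (8 * m + 65) ≤ 73 * R := by
    calc _ ≤ n * U * (73 * m) := by gcongr; linarith
      _ = 73 * (n * m * U) := by ring
      _ ≤ _ := by gcongr
  have t13 : (lcnt + 1) * (16 * cnt + 6) ≤ 3850 * R := by
    calc _ ≤ (175 * (K * Λ)) * (22 * (n * U)) := by gcongr <;> linarith
      _ = 3850 * (n * Λ * (K * U)) := by ring
      _ ≤ _ := by gcongr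
  linarith

namespace Built
variable {G : Ctx} {ε r : ℝ} {X : ℕ → ℝ} {S : ℕ} {all : List Node} {s : Store}

theorem time_le (B : Built G ε r X S all s) (hn : 1 ≤ G.n) (hm : 1 ≤ G.m) (hd : 1 ≤ G.d)
    (hk : 1 ≤ G.k) (hε : 0 < ε) (hε1 : ε ≤ 1) {t : ℕ}
    (ht : t ≤ (3 * G.k + 2 * G.d + 2 * ⌈25 * ((G.k * G.d : ℕ) : ℝ) / ε⌉₊ + 8) +
        ((G.n * (G.m * (6 * G.d + 11) + 3 * G.d + 9) + 4) +
        ((3 * (G.n * (G.k * G.d)) + 3) +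
        (((Nat.log 2 (G.n * (G.k * G.d)) + 1) * (16 * (G.n * (G.k * G.d)) + 6) + 2) +
        ((G.n * (G.k * G.d) * (3 * ⌈16 * S / ε⌉₊ + 6) + 2) +
        ((G.n * (G.k * G.d) * (4 * Nat.log 2 G.len + 11) + 2) +
        (1 + ((3 * G.m + 3) + (16 + ((16 * G.n + 1) +
        ((⌊G.n * G.total ε⌋₊ * (8 * G.m + 65) + 1) +
        (1 + (((Nat.log 2 (all.flatMap G.output).length + 1) *
          (16 * (all.flatMap G.output).length + 6) + 2) + 1))))))))))))) :
    (t : ℝ) ≤ 10000 * timeScale G.n G.m (G.k * G.d) ε := by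
  obtain ⟨K, hKdef⟩ : ∃ K, G.k * G.d = K := ⟨_, rfl⟩
  have hK : 1 ≤ K := hKdef ▸ Nat.mul_pos hk hd
  have hkK : G.k ≤ K := hKdef ▸ Nat.le_mul_of_pos_right _ hd
  have hdK : G.d ≤ K := hKdef ▸ Nat.le_mul_of_pos_left _ hk
  have b1 := B.ceil_le hd hk hε hε1
  have b2 := B.len_le_pow hd hk hε hε1
  have b3 := B.card_le hd hk hε hε1
  have b4 := Ctx.total_le hk hd hε (B.budget_le hd hk hε1)
  rw [hKdef] at ht b1 b2 b3 b4 ⊢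
  have ht' : (t : ℝ) ≤ _ := Nat.cast_le.2 ht
  push_cast at ht'
  generalize (all.flatMap G.output).length = cnt at *
  generalize G.len = len at *
  have hK' : (1 : ℝ) ≤ K := by exact_mod_cast hK
  have hn' : (1 : ℝ) ≤ G.n := by exact_mod_cast hn
  have hm' : (1 : ℝ) ≤ G.m := by exact_mod_cast hm
  have hkK' : (G.k : ℝ) ≤ K := by exact_mod_cast hkK
  have hdK' : (G.d : ℝ) ≤ K := by exact_mod_cast hdK
  have hE : 1 ≤ 1 / ε := by rw [le_div_iff₀ hε]; linarith
  have hlog := log_div_nonneg hn hε hε1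
  have hU1 : (1 : ℝ) ≤ (36 * 3 ^ 26 / ε) ^ K := by
    refine one_le_pow₀ ?_
    rw [le_div_iff₀ hε]
    linarith
  have hEU : 1 / ε ≤ (36 * 3 ^ 26 / ε) ^ K := by
    calc 1 / ε ≤ 36 * 3 ^ 26 / ε := by gcongr; norm_num
      _ ≤ _ := le_self_pow₀ (by rw [le_div_iff₀ hε]; linarith) (by omega)
  have hKU : (K : ℝ) ≤ (36 * 3 ^ 26 / ε) ^ K := by
    refine (cast_le_two_pow K).trans ?_
    gcongr
    rw [le_div_iff₀ hε]
    linarith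
  have hlogN : (Nat.log 2 (G.n * K) : ℝ) ≤ 174 * K * (1 + Real.log (G.n / ε)) :=
    natLog_le_of_le_pow hn hK hε hε1 (by push_cast; gcongr)
  have hloglen : (Nat.log 2 len : ℝ) ≤ 174 * K * (1 + Real.log (G.n / ε)) :=
    natLog_le_of_le_pow hn hK hε hε1 b2
  have hlogcnt : (Nat.log 2 cnt : ℝ) ≤ 174 * K * (1 + Real.log (G.n / ε)) :=
    natLog_le_of_le_pow hn hK hε hε1 b3
  have hfloor : (⌊G.n * G.total ε⌋₊ : ℝ) ≤ G.n * (36 * 3 ^ 26 / ε) ^ K := by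
    have h0 : 0 ≤ G.total ε := by unfold Ctx.total; positivity
    refine (Nat.floor_le (by positivity)).trans ?_
    gcongr
  have hceil : (⌈25 * (K : ℝ) / ε⌉₊ : ℝ) ≤ 26 * K * (1 / ε) := by
    have h1 := (Nat.ceil_lt_add_one (by positivity : 0 ≤ 25 * (K : ℝ) / ε)).le
    have h2 : 1 ≤ K * (1 / ε) := one_le_mul_of_one_le_of_one_le hK' hE
    calc _ ≤ _ := h1
      _ ≤ 25 * K * (1 / ε) + K * (1 / ε) := by rw [mul_one_div]; gcongr
      _ = _ := by ring
  unfold timeScale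
  -- The factor `(2²)^K` in `timeScale` becomes `(2^K)²`, the `V²` of the abstract estimate.
  rw [mul_pow, pow_right_comm]
  exact ht'.trans (time_bound hn' hm' (by linarith) hK' hE
    hEU (cast_le_two_pow K) hkK' hdK' hceil b1 hlogN hloglen hlogcnt b3 hfloor
    (Nat.cast_nonneg _))

/-- The factor `6` counts three integer and three real arrays. Table, dictionary and the four
parameters contribute `1 + 1 + 4` multiples of the exponential bound. -/
theorem space_le (B : Built G ε r X S all s) (hn : 1 ≤ G.n) (hd : 1 ≤ G.d)
    (hk : 1 ≤ G.k) (hε : 0 < ε) (hε1 : ε ≤ 1) :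
    ((6 * s.nat 0 0 : ℕ) : ℝ) ≤ 36 * (G.n * (36 * 3 ^ 26 / ε) ^ (G.k * G.d)) := by
  have b2 := B.len_le_pow hd hk hε hε1
  have b3 := B.card_le hd hk hε hε1
  have hn' : (1 : ℝ) ≤ G.n := by exact_mod_cast hn
  have hU1 : (1 : ℝ) ≤ (36 * 3 ^ 26 / ε) ^ (G.k * G.d) := by
    refine one_le_pow₀ ?_
    rw [le_div_iff₀ hε]
    linarith
  have h := one_le_mul_of_one_le_of_one_le hn' hU1
  rw [B.length]
  push_cast
  linarith

/-- The `kd` table lookups cost `O(1 + log (nkd/ε))` each. The single dictionary lookup has a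
logarithm of order `kd (1 + log (n/ε))`, so it is no more expensive than all of them together. -/
theorem query_le (B : Built G ε r X S all s) (hn : 1 ≤ G.n) (hd : 1 ≤ G.d)
    (hk : 1 ≤ G.k) (hε : 0 < ε) (hε1 : ε ≤ 1) {t : ℕ}
    (ht : t ≤ G.k * G.d * (4 * Nat.log 2 G.len + 11) +
      4 * Nat.log 2 (all.flatMap G.output).length + 12) :
    (t : ℝ) ≤ 1300 * (G.k * G.d * (1 + Real.log (G.n * G.k * G.d / ε))) := by
  have hK1 : 1 ≤ G.k * G.d := Nat.mul_pos hk hd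
  have b1 := B.len_le_sq hd hk hε hε1
  have b3 := natLog_le_of_le_pow hn hK1 hε hε1 (B.card_le hd hk hε hε1)
  have ht' : (t : ℝ) ≤ _ := Nat.cast_le.2 ht
  push_cast at ht' b1 b3
  have hK : (1 : ℝ) ≤ G.k * G.d := by exact_mod_cast hK1
  have hn' : (1 : ℝ) ≤ G.n := by exact_mod_cast hn
  have hE : 1 ≤ 1 / ε := by rw [le_div_iff₀ hε]; linarith
  have e : (G.n * G.k * G.d / ε : ℝ) = G.n * (G.k * G.d) * (1 / ε) := by ring
  have e' : (G.n / ε : ℝ) = G.n * 1 * (1 / ε) := by ring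
  rw [e]
  rw [e'] at b3
  generalize (G.k * G.d : ℝ) = K at *
  generalize 1 / ε = E at *
  have hx : 1 ≤ G.n * K * E :=
    one_le_mul_of_one_le_of_one_le (one_le_mul_of_one_le_of_one_le hn' hK) hE
  have hl := Real.log_nonneg hx
  have hlen : (Nat.log 2 G.len : ℝ) ≤ 2 * Real.log (66 * (G.n * K * E) ^ 2) := by
    refine natLog_le (b1.trans ?_) ?_
    · calc 66 * G.n * K ^ 2 * E ≤ 66 * G.n * K ^ 2 * E * (G.n * E) :=
            le_mul_of_one_le_right (by positivity) (one_le_mul_of_one_le_of_one_le hn' hE)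
        _ = _ := by ring
    · exact one_le_mul_of_one_le_of_one_le (by norm_num) (one_le_pow₀ hx)
  rw [Real.log_mul (by norm_num) (by positivity), Real.log_pow] at hlen
  have h66 := Real.log_le_sub_one_of_pos (by norm_num : (0 : ℝ) < 66)
  have hmono : Real.log (G.n * 1 * E) ≤ Real.log (G.n * K * E) :=
    Real.log_le_log (by positivity) (by gcongr)
  generalize Real.log (G.n * K * E) = L at *
  push_cast at hlen
  have h1 : (Nat.log 2 G.len : ℝ) ≤ 130 * (1 + L) := by linarith
  have h2 : (Nat.log 2 (all.flatMap G.output).length : ℝ) ≤ 174 * K * (1 + L) :=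
    b3.trans (by gcongr)
  have hKL : 1 ≤ K * (1 + L) := one_le_mul_of_one_le_of_one_le hK (by linarith)
  calc (t : ℝ) ≤ _ := ht'
    _ ≤ K * (4 * (130 * (1 + L)) + 11 * (1 + L)) + 4 * (174 * K * (1 + L)) +
        12 * (K * (1 + L)) := by
      gcongr <;> linarith
    _ = 1239 * (K * (1 + L)) := by ring
    _ ≤ _ := by linarith

end Built

/-! ### The data structure -/

/-- The data structure: a dictionary of the candidates with a near curve for each. -/
def dictionary : DataStructure := ⟨preprocessProg, queryProg, 3⟩

theorem DataStructure.queryInput_nat (A : DataStructure) (s : Store) {k d x i : ℕ} (Q : Curve k d)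
    (hx : x ≠ 0) (hx' : x ≤ A.arrays) (hi : i < s.nat 0 0) :
    (A.queryInput s Q).nat x i = s.nat x i :=
  (if_neg hx).trans (if_pos ⟨hx', hi⟩)

theorem DataStructure.queryInput_real (A : DataStructure) (s : Store) {k d x i : ℕ} (Q : Curve k d)
    (hx : x ≠ 0) (hx' : x ≤ A.arrays) (hi : i < s.nat 0 0) :
    (A.queryInput s Q).real x i = s.real x i :=
  (if_neg hx).trans (if_pos ⟨hx', hi⟩)

theorem Built.query {n m d k : ℕ} {ε r : ℝ} {C : Fin n → Curve m d} {G : Ctx} {X : ℕ → ℝ} {S : ℕ}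
    {all : List Node} {s : Store} (B : Built G ε r X S all s) (hGn : G.n = n) (hGm : G.m = m)
    (hGd : G.d = d) (hGk : G.k = k) (hGC : ∀ i (hi : i < n) l (hl : l < m) a (ha : a < d),
      G.pt i l a = C ⟨i, hi⟩ ⟨l, hl⟩ ⟨a, ha⟩) (hd : 1 ≤ d) (hk : 1 ≤ k) (hm : 1 ≤ m) (hε : 0 < ε)
    (hε1 : ε ≤ 1) (hr : 0 < r) (Q : Curve k d) :
    queryProg.wp (dictionary.queryInput s Q) fun t s' =>
      t ≤ G.k * G.d * (4 * Nat.log 2 G.len + 11) +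
        4 * Nat.log 2 (all.flatMap G.output).length + 12 ∧
      ((∃ i : Fin n, dfd Q (C i) ≤ r) →
        ∃ j : Fin n, s'.nat 0 0 = j.val ∧ dfd Q (C j) ≤ (1 + ε) * r) := by
  subst hGn hGm hGd hGk
  have hL := B.length
  have r2 : ∀ p < G.len, (dictionary.queryInput s Q).real 2 p = G.T p := by
    intro p hp
    rw [dictionary.queryInput_real s Q (by norm_num) (by norm_num [dictionary]) (by omega), B.table]
  have r3 : ∀ p < (all.flatMap G.output).length,
      (dictionary.queryInput s Q).real 3 p = s.real 3 p := by
    intro p hp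
    exact dictionary.queryInput_real s Q (by norm_num) (by norm_num [dictionary]) (by omega)
  have n1 : ∀ p < (all.flatMap G.output).length,
      (dictionary.queryInput s Q).nat 1 p = s.nat 1 p := by
    intro p hp
    exact dictionary.queryInput_nat s Q (by norm_num) (by norm_num [dictionary]) (by omega)
  have n2 : ∀ p < 4, (dictionary.queryInput s Q).nat 2 p = s.nat 2 p := by
    intro p hp
    exact dictionary.queryInput_nat s Q (by norm_num) (by norm_num [dictionary]) (by omega)
  have r0 : ∀ j (hj : j < G.k) a (ha : a < G.d),
      (dictionary.queryInput s Q).real 0 (j * G.d + a) = Q ⟨j, hj⟩ ⟨a, ha⟩ := by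
    intro j hj a ha
    exact Q.getD_coords ⟨j, hj⟩ ⟨a, ha⟩
  generalize dictionary.queryInput s Q = s₀ at *
  -- The existence of cut positions is read off from a run of the binary search on an artificial
  -- memory.
  have hcut : ∀ t, ∃ p, IsCut G.T G.len (s₀.real 0 t) p := by
    intro t
    let s₁ : Store := ⟨fun _ _ => G.len, fun x _ => if x = 6 then s₀.real 0 t else 0⟩
    let s₂ : Store := ⟨s₁.nat, fun x => if x = 2 then G.T else s₁.real x⟩
    obtain ⟨-, s', -, -, -, h⟩ := locateProg_spec (A := 2) (c := 0) (s := s₂) rfl B.sorted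
    exact ⟨_, h⟩
  choose z hz using hcut
  refine (queryProg_spec (G := G) (z := z) (by rw [n2 0 (by norm_num), B.len])
    (by rw [n2 1 (by norm_num), B.card]) (by rw [n2 2 (by norm_num), B.dim])
    (by rw [n2 3 (by norm_num), B.base]) (B.sorted.congr r2) (B.keys_sorted.congr r3)
    (fun t _ => (hz t).congr r2)).mono ?_
  rintro t s' ⟨ht, p, hp, hres⟩
  refine ⟨ht, ?_⟩
  rintro ⟨i, hi⟩
  have hdfd : ∀ (i : Fin G.n) {ρ : ℝ}, 0 ≤ ρ → (dfd Q (C i) ≤ ρ ↔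
      Reach (fun j l => sqd G.d (fun a => s₀.real 0 (j * G.d + a)) (G.pt i l) ≤ ρ * ρ)
        G.k G.m) := by
    intro i ρ hρ
    refine dfd_le_iff hk hm hρ fun j l => ?_
    exact sqd_le_iff hρ (fun a => (r0 j j.2 a a.2).symm) fun a => (hGC i i.2 l l.2 a a.2).symm
  obtain ⟨h1, h2, h3⟩ := B.correct hd hk hε hε1 hr (fun t _ => hz t) i.2 ((hdfd i hr.le).1 hi)
    (hp.congr fun q hq => (r3 q hq).symm)
  refine ⟨⟨s.nat 1 (p - 1), h1⟩, by rw [hres, n1 _ h3], ?_⟩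
  exact (hdfd ⟨_, h1⟩ (by positivity)).2 h2

theorem dictionary_solves {n m d k : ℕ} {ε r : ℝ} (C : Fin n → Curve m d) (hn : 1 ≤ n)
    (hd : 1 ≤ d) (hk : 1 ≤ k) (hkm : k ≤ m) (hε : 0 < ε) (hε1 : ε ≤ 1) (hr : 0 < r) {c : ℝ}
    (hc : 10000 * (2 ^ 2 * (36 * 3 ^ 26)) ≤ c) :
    dictionary.SolvesANNC C k ε r (n * (c / ε) ^ (d * k))
      (n * m * (1 + Real.log (n / ε)) * (c * (d * Real.log m) + (c / ε) ^ (k * d)))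
      (c * (k * d * (1 + Real.log (n * k * d / ε)))) := by
  have hm : 1 ≤ m := hk.trans hkm
  obtain ⟨t, s, hrun, G, X, S, all, hGn, hGm, hGd, hGk, hGC, B, ht⟩ :=
    preprocessProg_spec (s := preprocessInput C k ε r) (n := n) (m := m) (d := d) (k := k) (ε := ε)
      (r := r) rfl rfl rfl rfl rfl rfl (fun x p hx => if_neg hx) (fun p => rfl) hd hk hε hε1 hr
  have hpt : ∀ i (hi : i < n) l (hl : l < m) a (ha : a < d),
      G.pt i l a = C ⟨i, hi⟩ ⟨l, hl⟩ ⟨a, ha⟩ := by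
    intro i hi l hl a ha
    unfold Ctx.pt
    rw [hGC, hGm, hGd]
    exact preprocessInput_real_one C k ε r ⟨i, hi⟩ ⟨l, hl⟩ ⟨a, ha⟩
  have hquery := B.query hGn hGm hGd hGk hpt hd hk hm hε hε1 hr
  subst hGn hGm hGd hGk
  have hK : 1 ≤ G.k * G.d := Nat.mul_pos hk hd
  have hlog := log_div_nonneg hn hε hε1
  refine ⟨t, s, hrun, ?_, ?_, fun Q => ?_⟩
  · refine (B.time_le hn hm hd hk hε hε1 ht).trans ?_
    have h1 : 10000 * (2 ^ 2 * (36 * 3 ^ 26 / ε)) ^ (G.k * G.d) ≤ (c / ε) ^ (G.k * G.d) := by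
      refine (mul_pow_le_mul_pow (by norm_num) (by positivity) hK).trans ?_
      refine pow_le_pow_left₀ (by positivity) ?_ _
      calc 10000 * (2 ^ 2 * (36 * 3 ^ 26 / ε)) = 10000 * (2 ^ 2 * (36 * 3 ^ 26)) / ε := by ring
        _ ≤ c / ε := by gcongr
    -- The term in `d log m` is not needed; its nonnegativity suffices, as the exponential term
    -- alone dominates the running time.
    have h2 : 0 ≤ c * (G.d * Real.log G.m) := by
      have : 0 ≤ Real.log G.m := Real.log_nonneg (by exact_mod_cast hm)
      have : 0 ≤ c := le_trans (by norm_num) hc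
      positivity
    calc 10000 * timeScale G.n G.m (G.k * G.d) ε = G.n * G.m * (1 + Real.log (G.n / ε)) *
          (0 + 10000 * (2 ^ 2 * (36 * 3 ^ 26 / ε)) ^ (G.k * G.d)) := by unfold timeScale; ring
      _ ≤ _ := by gcongr
  · have h1 : 36 * (36 * 3 ^ 26 / ε) ^ (G.k * G.d) ≤ (c / ε) ^ (G.k * G.d) := by
      refine (mul_pow_le_mul_pow (by norm_num) (by positivity) hK).trans ?_
      refine pow_le_pow_left₀ (by positivity) ?_ _
      calc 36 * (36 * 3 ^ 26 / ε) = 36 * (36 * 3 ^ 26) / ε := by ring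
        _ ≤ c / ε := by
          gcongr
          exact le_trans (by norm_num) hc
    calc (dictionary.space s : ℝ) ≤ 36 * (G.n * (36 * 3 ^ 26 / ε) ^ (G.k * G.d)) :=
          B.space_le hn hd hk hε hε1
      _ = G.n * (36 * (36 * 3 ^ 26 / ε) ^ (G.k * G.d)) := by ring
      _ ≤ G.n * (c / ε) ^ (G.k * G.d) := by gcongr
      _ = _ := by rw [mul_comm G.k]
  · obtain ⟨t', s', hrun', ht', h⟩ := hquery Q
    refine ⟨t', s', hrun', (B.query_le hn hd hk hε hε1 ht').trans ?_, h⟩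
    have : 0 ≤ Real.log (G.n * G.k * G.d / ε) := by
      have := log_div_nonneg (n := G.n * G.k * G.d)
        (Nat.mul_pos (Nat.mul_pos hn hk) hd) hε hε1
      push_cast at this
      exact this
    gcongr
    exact le_trans (by norm_num) hc

end CurveANN

end

theorem theoremB2 :
    ∃ (A : CurveANN.DataStructure) (c : ℝ), 0 < c ∧
      ∀ (n m d k : ℕ) (ε r : ℝ) (C : Fin n → CurveANN.Curve m d),
        1 ≤ n → 1 ≤ d → 1 ≤ k → k ≤ m → 0 < ε → ε ≤ 1 → 0 < r →
        A.SolvesANNC C k ε r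
          (n * (c / ε) ^ (d * k))
          (n * m * (1 + Real.log (n / ε)) * (c * (d * Real.log m) + (c / ε) ^ (k * d)))
          (c * (k * d * (1 + Real.log (n * k * d / ε)))) :=
  -- The preprocessing time dictates the constant; space and query time need less.
  ⟨CurveANN.dictionary, 10000 * (2 ^ 2 * (36 * 3 ^ 26)), by norm_num,
    fun _ _ _ _ _ _ C hn hd hk hkm hε hε1 hr =>
      CurveANN.dictionary_solves C hn hd hk hkm hε hε1 hr le_rfl⟩
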